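/- Fix an integer $\ell\ge 1$. Let $n=2\ell m+r$ with an integer $m\ge 1$ and $r\in\{-1,0,\dots,2\ell-2\}$, and let $V_n(x)=\sum_{j=0}^{n}a_j\cos(jx)$, $x\in(0,2\pi)$, where $a_0,\dots,a_n$ are real random variables. For $0\le i\le 2m-1$ let $A_i=(a_{\ell i},a_{\ell i+1},\dots,a_{\ell i+\ell-1})$, and let $\tilde A$ be the family of the remaining $r+1$ coefficients $a_{2\ell m},\dots,a_n$. Assume that the coefficients in the blocks $A_0,A_2,\dots,A_{2m-2}$ together with those in $\tilde A$ are independent and identically distributed with the Gaussian distribution $\mathcal N(0,\sigma^2)$, $\sigma>0$, and that $A_{2j}=A_{2j+1}$, i.e. $a_{2\ell j+k}=a_{2\ell j+\ell+k}$ for $0\le k\le \ell-1$ (almost surely), for every $j=0,\dots,m-1$. Let $N_n(0,2\pi)$ be the number of distinct real zeros of $V_n$ in $(0,2\pi)$. Then $$\mathbb E\,[N_n(0,2\pi)]=\frac{2n}{\sqrt 3}+\mathcal O\!\left(n^{5/6}\right)\qquad\text{as } n\to\infty,$$ where the implied constant, and the threshold on $n$ from which the bound holds, depend only on $\ell$.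 -/

import Mathlib

open MeasureTheory ProbabilityTheory
open scoped NNReal ENNReal

/-- The indices of the coefficients in the `i`-th block of length `ℓ`,
`A_i = (a_{ℓ i}, a_{ℓ i + 1}, …, a_{ℓ i + ℓ - 1})`. -/
def blockIndices (ℓ i : ℕ) : Finset ℕ :=
  Finset.Ico (ℓ * i) (ℓ * i + ℓ)

/-- The indices of the remaining coefficients: those among `a_0, …, a_n` which lie in none of
the blocks `A_0, …, A_{2m-1}`. -/
def remainingIndices (ℓ m n : ℕ) : Finset ℕ :=
  Finset.range (n + 1) \ (Finset.range (2 * m)).biUnion (blockIndices ℓ)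

/-- The indices of the coefficients in the even blocks `A_0, A_2, …, A_{2m-2}`, together with
those of the remaining coefficients. -/
def freeIndices (ℓ m n : ℕ) : Finset ℕ :=
  (Finset.range m).biUnion (fun j => blockIndices ℓ (2 * j)) ∪ remainingIndices ℓ m n

/-- The cosine polynomial `V_n(x) = ∑_{j=0}^n a_j cos (j x)`. -/
noncomputable def cosPoly (n : ℕ) (a : ℕ → ℝ) (x : ℝ) : ℝ :=
  ∑ j ∈ Finset.range (n + 1), a j * Real.cos (j * x)

/-- The number (possibly infinite) of distinct zeros of `f` in the set `s`. -/
noncomputable def zeroCount (f : ℝ → ℝ) (s : Set ℝ) : ℝ≥0∞ :=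
  (({x ∈ s | f x = 0}.encard : ℕ∞) : ℝ≥0∞)

/-!
Let `g` be the vector of the independent coefficients, divided by `σ`: a standard Gaussian vector
in a Euclidean space `E`. Then `V_n(x) = σ ⟪w x, g⟫` for a curve `w` in `E`, and the zeros depend
only on the projection `u` of `w` to the unit sphere.

**Zeros and arc length.** Two functionals `⟪u, ·⟫` and `⟪v, ·⟫` have opposite signs at `g` with
probability `angle u v / π` (`stdGaussian_inner_mul_inner_neg`). The expected number of sign changes
of `⟪u x, g⟫` along a subdivision is therefore the sum of the angles between consecutive points
over `π`, which tends to the length of `u` over `π`. Sign changes never exceed the number of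
zeros, and by Fatou's lemma they exhaust it in the limit, because almost surely all zeros are simple
(`stdGaussian_multiple_zero`, by Sard's lemma on lines). This gives the two halves
`lintegral_zeroCount_ge` and `lintegral_zeroCount_le` of the Kac–Rice formula.

**The speed.** Equal blocks produce the common factor
`cos (j x) + cos ((j + ℓ) x) = 2 cos (ℓ x / 2) cos ((j + ℓ / 2) x)`. Dividing by `2 cos (ℓ x / 2)`
changes neither the zeros nor the spherical projection up to sign, and leaves the curve
`reducedCurve` with coordinates `cos (ν x)`, apart from fewer than `2 ℓ` unpaired ones. With
`t = n ^ (1 / 6)`, at the points where `t |sin (2 ℓ x)| ≥ 1`, Abel summation shows that the squared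
norms of this curve and of its velocity are `n / 4` and `n ^ 3 / 12` up to lower order terms, and
that their inner product is small. Hence the spherical speed is `n / √3 + O(t ^ 2)`
(`abs_norm_unitCurveDeriv_reducedCurve_sub_le`).

**Short intervals.** The remaining points lie within `O(1 / t)` of the `4 ℓ + 1` multiples of
`π / (2 ℓ)` in `[0, 2π]`. A cosine polynomial with `p` zeros in an interval of length `O(1 / t)` is
tiny on all of it as soon as `p` is a large multiple of `n / t` (`abs_le_of_zeros`), and this has a
negligible probability since the variance is at least `1` at some point of the interval. So these
intervals contribute `O(n / t) = O(n ^ (5 / 6))` zeros (`lintegral_zeroCount_bad`). The part of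
the main term that is lost on them is of the same order.
-/

/-! ### Standard Gaussian vectors -/

section Gaussian

open scoped RealInnerProductSpace

variable {E : Type*} [NormedAddCommGroup E] [InnerProductSpace ℝ E] [FiniteDimensional ℝ E]
  [MeasurableSpace E] [BorelSpace E]

lemma stdGaussian_map_inner (u : E) :
    (stdGaussian E).map (fun g => ⟪u, g⟫) = gaussianReal 0 (‖u‖₊ ^ 2) := by
  apply Measure.ext_of_charFun
  ext t
  rw [charFun_apply, charFun_gaussianReal, integral_map (by fun_prop) (by fun_prop)]
  have := charFun_stdGaussian (E := E) (t • u)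
  rw [charFun_apply] at this
  simp only [real_inner_smul_right] at this
  refine Eq.trans (integral_congr_ae (ae_of_all _ fun g => ?_)) (this.trans ?_)
  · simp [mul_comm, real_inner_comm u]
  · have ht : ((|t| : ℝ) : ℂ) ^ 2 = (t : ℂ) ^ 2 := by exact_mod_cast sq_abs t
    simp [norm_smul, mul_pow, ht]
    ring_nf

lemma stdGaussian_map_inner_pair {e f : E} (he : ‖e‖ = 1) (hf : ‖f‖ = 1) (hef : ⟪e, f⟫ = 0) :
    (stdGaussian E).map (fun g => (⟪e, g⟫, ⟪f, g⟫)) =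
      (gaussianReal 0 1).prod (gaussianReal 0 1) := by
  have hG : HasGaussianLaw (fun g : E => (⟪e, g⟫, ⟪f, g⟫)) (stdGaussian E) := by
    have : IsGaussian (stdGaussian E) := inferInstance
    refine ⟨?_⟩
    exact isGaussian_map (μ := stdGaussian E) ((innerSL ℝ e).prod (innerSL ℝ f))
  have hcov : cov[fun g : E => ⟪e, g⟫, fun g : E => ⟪f, g⟫; stdGaussian E] = 0 := by
    have := covarianceBilin_stdGaussian (E := E)
    have h2 := covarianceBilin_apply_eq_cov (μ := stdGaussian E) (IsGaussian.memLp_two_id) e f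
    rw [this] at h2
    rw [← h2]
    rw [innerSL_apply_apply ℝ, hef]
  have hi := hG.indepFun_of_covariance_eq_zero hcov
  rw [indepFun_iff_map_prod_eq_prod_map_map (by fun_prop) (by fun_prop)] at hi
  rw [hi, stdGaussian_map_inner, stdGaussian_map_inner]
  have h1 : ‖e‖₊ = 1 := by ext; simpa using he
  have h2 : ‖f‖₊ = 1 := by ext; simpa using hf
  simp [h1, h2]

/-- Resampling the component of a standard Gaussian vector along a unit vector `e` does not change
its law. -/
lemma stdGaussian_eq_map_resample {e : E} (he : ‖e‖ = 1) :
    ((stdGaussian E).prod (gaussianReal 0 1)).map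
      (fun p : E × ℝ => p.1 - ⟪e, p.1⟫ • e + p.2 • e) = stdGaussian E := by
  have hm : Measurable (fun p : E × ℝ => p.1 - ⟪e, p.1⟫ • e + p.2 • e) := by fun_prop
  have : IsProbabilityMeasure (((stdGaussian E).prod (gaussianReal 0 1)).map
      (fun p : E × ℝ => p.1 - ⟪e, p.1⟫ • e + p.2 • e)) :=
    Measure.isProbabilityMeasure_map hm.aemeasurable
  apply Measure.ext_of_charFun
  ext ξ
  rw [charFun_stdGaussian, charFun_apply, integral_map hm.aemeasurable (by fun_prop)]
  have h1 : ∀ p : E × ℝ, Complex.exp (⟪p.1 - ⟪e, p.1⟫ • e + p.2 • e, ξ⟫ * Complex.I) =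
      Complex.exp (⟪p.1, ξ - ⟪e, ξ⟫ • e⟫ * Complex.I) *
      Complex.exp (⟪p.2, ⟪e, ξ⟫⟫ * Complex.I) := by
    intro p
    rw [← Complex.exp_add, ← add_mul, ← Complex.ofReal_add]
    congr 3
    simp only [inner_add_left, inner_sub_left, inner_smul_left, inner_sub_right, inner_smul_right,
      real_inner_comm e p.1]
    simp
    ring
  simp_rw [h1]
  rw [integral_prod_mul (fun x => Complex.exp (⟪x, ξ - ⟪e, ξ⟫ • e⟫ * Complex.I))
    (fun x : ℝ => Complex.exp (⟪x, ⟪e, ξ⟫⟫ * Complex.I)), ← charFun_apply, ← charFun_apply,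
    charFun_stdGaussian, charFun_gaussianReal, ← Complex.exp_add]
  congr 1
  have h2 : ‖ξ - ⟪e, ξ⟫ • e‖ ^ 2 = ‖ξ‖ ^ 2 - ⟪e, ξ⟫ ^ 2 := by
    rw [norm_sub_sq_real, inner_smul_right, norm_smul, he, real_inner_comm e ξ]
    simp
    ring
  have h3 : ((‖ξ - ⟪e, ξ⟫ • e‖ : ℝ) : ℂ) ^ 2 = ((‖ξ‖ : ℝ) : ℂ) ^ 2 - ((⟪e, ξ⟫ : ℝ) : ℂ) ^ 2 := by
    exact_mod_cast h2
  rw [h3]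
  simp
  ring

/-- A Borel set is null for the standard Gaussian measure as soon as its trace on every line
parallel to a unit vector `e` is Lebesgue null. -/
lemma stdGaussian_null_of_lines {e : E} (he : ‖e‖ = 1) {D : Set E} (hD : MeasurableSet D)
    (h : ∀ y : E, volume {t : ℝ | y + t • e ∈ D} = 0) : stdGaussian E D = 0 := by
  have hm : Measurable (fun p : E × ℝ => p.1 - ⟪e, p.1⟫ • e + p.2 • e) := by fun_prop
  rw [← stdGaussian_eq_map_resample he, Measure.map_apply hm hD,
    Measure.prod_apply (hm hD), lintegral_eq_zero_iff (measurable_measure_prodMk_left (hm hD))]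
  refine ae_of_all _ fun y => ?_
  exact gaussianReal_absolutelyContinuous 0 one_ne_zero (h (y - ⟪e, y⟫ • e))

/-- The planar standard Gaussian measure of a cone is proportional to its opening. -/
lemma gaussianReal_prod_cone {S : Set (ℝ × ℝ)} (hS : MeasurableSet S) {T : Set ℝ}
    (hST : ∀ r : ℝ, 0 < r → ∀ θ ∈ Set.Ioo (-Real.pi) Real.pi,
      ((r * Real.cos θ, r * Real.sin θ) ∈ S ↔ θ ∈ T)) (hT : MeasurableSet T) :
    ((gaussianReal 0 1).prod (gaussianReal 0 1)) S * ENNReal.ofReal (2 * Real.pi) =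
      volume (T ∩ Set.Ioo (-Real.pi) Real.pi) := by
  have key : ∃ c : ℝ≥0∞, ∀ (S : Set (ℝ × ℝ)) (_ : MeasurableSet S) (T : Set ℝ)
      (_ : ∀ r : ℝ, 0 < r → ∀ θ ∈ Set.Ioo (-Real.pi) Real.pi,
        ((r * Real.cos θ, r * Real.sin θ) ∈ S ↔ θ ∈ T)) (_ : MeasurableSet T),
      ((gaussianReal 0 1).prod (gaussianReal 0 1)) S =
        c * volume (T ∩ Set.Ioo (-Real.pi) Real.pi) := by
    -- in polar coordinates the density depends on `r` only
    refine ⟨∫⁻ r in Set.Ioi (0 : ℝ), ENNReal.ofReal r *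
      ENNReal.ofReal ((2 * Real.pi)⁻¹ * Real.exp (-r ^ 2 / 2)), ?_⟩
    intro S hS T hST hT
    rw [gaussianReal_of_var_ne_zero 0 one_ne_zero,
      prod_withDensity (by fun_prop) (by fun_prop), withDensity_apply _ hS,
      ← lintegral_indicator hS, ← Measure.volume_eq_prod, ← lintegral_comp_polarCoord_symm,
      polarCoord_target]
    have h1 : ∀ p ∈ Set.Ioi (0 : ℝ) ×ˢ Set.Ioo (-Real.pi) Real.pi,
        ENNReal.ofReal p.1 • S.indicator
          (fun z : ℝ × ℝ => gaussianPDF 0 1 z.1 * gaussianPDF 0 1 z.2) (polarCoord.symm p) =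
        (ENNReal.ofReal p.1 * ENNReal.ofReal ((2 * Real.pi)⁻¹ * Real.exp (-p.1 ^ 2 / 2))) *
          T.indicator 1 p.2 := by
      rintro ⟨r, θ⟩ ⟨hr, hθ⟩
      rw [smul_eq_mul, mul_assoc]
      congr 1
      rw [polarCoord_symm_apply]
      by_cases h : θ ∈ T
      · rw [Set.indicator_of_mem ((hST r hr θ hθ).2 h), Set.indicator_of_mem h]
        simp only [gaussianPDF, gaussianPDFReal, Pi.one_apply, mul_one]
        rw [← ENNReal.ofReal_mul (by positivity)]
        congr 1
        have : Real.exp (-r ^ 2 / 2) = Real.exp (-(r * Real.cos θ) ^ 2 / 2) *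
            Real.exp (-(r * Real.sin θ) ^ 2 / 2) := by
          rw [← Real.exp_add]; congr 1
          have := Real.sin_sq_add_cos_sq θ
          linear_combination (r ^ 2 / 2) * this
        rw [this]
        have h2 : (Real.sqrt (2 * Real.pi))⁻¹ * (Real.sqrt (2 * Real.pi))⁻¹ =
            (2 * Real.pi)⁻¹ := by
          rw [← mul_inv, Real.mul_self_sqrt (by positivity)]
        rw [← h2]
        simp only [NNReal.coe_one, mul_one, sub_zero]
        ring
      · rw [Set.indicator_of_notMem (fun h' => h ((hST r hr θ hθ).1 h')),
          Set.indicator_of_notMem h]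
        simp
    rw [setLIntegral_congr_fun (measurableSet_Ioi.prod measurableSet_Ioo) h1,
      Measure.volume_eq_prod, ← Measure.prod_restrict,
      lintegral_prod_mul (f := fun r : ℝ => ENNReal.ofReal r *
        ENNReal.ofReal ((2 * Real.pi)⁻¹ * Real.exp (-r ^ 2 / 2)))
        (g := fun θ => T.indicator 1 θ) (by fun_prop)
        (measurable_one.indicator hT).aemeasurable]
    congr 1
    rw [lintegral_indicator_one hT, Measure.restrict_apply hT]
  obtain ⟨c, hc⟩ := key
  -- the constant is found by taking the whole plane as the cone
  have h1 := hc Set.univ .univ Set.univ (by simp) .univ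
  rw [hc S hS T hST hT]
  simp only [measure_univ, Set.univ_inter, Real.volume_Ioo] at h1
  have h2 : Real.pi - -Real.pi = 2 * Real.pi := by ring
  rw [h2] at h1
  calc _ = (c * ENNReal.ofReal (2 * Real.pi)) * volume (T ∩ Set.Ioo (-Real.pi) Real.pi) := by ring
    _ = _ := by rw [← h1, one_mul]

lemma measurableSet_pos_and_neg {X : Type*} [MeasurableSpace X] {f g : X → ℝ}
    (hf : Measurable f) (hg : Measurable g) : MeasurableSet {x | 0 < f x ∧ g x < 0} := by
  rw [Set.ofPred_and]
  exact (measurableSet_lt measurable_const hf).inter (measurableSet_lt hg measurable_const)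

lemma stdGaussian_pos_neg_of_orthonormal {e f : E} (he : ‖e‖ = 1) (hf : ‖f‖ = 1) (hef : ⟪e, f⟫ = 0)
    {φ : ℝ} (h0 : 0 ≤ φ) (h1 : φ ≤ Real.pi) :
    stdGaussian E {g | 0 < ⟪e, g⟫ ∧ ⟪Real.cos φ • e + Real.sin φ • f, g⟫ < 0} =
      ENNReal.ofReal (φ / (2 * Real.pi)) := by
  have hpi := Real.pi_pos
  set S : Set (ℝ × ℝ) := {p | 0 < p.1 ∧ Real.cos φ * p.1 + Real.sin φ * p.2 < 0} with hSdef
  have hS : MeasurableSet S := measurableSet_pos_and_neg (by fun_prop) (by fun_prop)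
  have hpre : {g : E | 0 < ⟪e, g⟫ ∧ ⟪Real.cos φ • e + Real.sin φ • f, g⟫ < 0} =
      (fun g => (⟪e, g⟫, ⟪f, g⟫)) ⁻¹' S := by
    ext g
    simp [hSdef, inner_add_left, inner_smul_left]
  rw [hpre, ← Measure.map_apply (by fun_prop) hS, stdGaussian_map_inner_pair he hf hef]
  have := gaussianReal_prod_cone hS (T := Set.Ioo (-(Real.pi / 2)) (φ - Real.pi / 2)) ?_
    measurableSet_Ioo
  · rw [Set.inter_eq_left.2 (Set.Ioo_subset_Ioo (by linarith) (by linarith)),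
      Real.volume_Ioo] at this
    rw [ENNReal.ofReal_div_of_pos (by positivity),
      ENNReal.eq_div_iff (by simp [hpi]) ENNReal.ofReal_ne_top,
      mul_comm, this]
    congr 1; ring
  · intro r hr θ hθ
    have e1 : Real.cos φ * (r * Real.cos θ) + Real.sin φ * (r * Real.sin θ) =
      r * Real.cos (θ - φ) := by rw [Real.cos_sub]; ring
    simp only [hSdef, Set.mem_ofPred_eq, e1, mul_neg_iff, hr, hr.not_gt, true_and, false_and,
      or_false, mul_pos_iff, Set.mem_Ioo]
    constructor
    · rintro ⟨h2, h3⟩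
      have hθ1 : -(Real.pi / 2) < θ := by
        by_contra h
        exact absurd h2 (not_lt.2 (by
          rw [← Real.cos_neg]
          exact Real.cos_nonpos_of_pi_div_two_le_of_le (by linarith) (by linarith [hθ.1])))
      have hθ2 : θ < Real.pi / 2 := by
        by_contra h
        exact absurd h2 (not_lt.2
          (Real.cos_nonpos_of_pi_div_two_le_of_le (by linarith) (by linarith [hθ.2])))
      refine ⟨hθ1, ?_⟩
      by_contra h
      exact absurd h3 (not_lt.2 (Real.cos_nonneg_of_neg_pi_div_two_le_of_le (by linarith)
        (by linarith)))
    · rintro ⟨h2, h3⟩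
      refine ⟨Real.cos_pos_of_mem_Ioo ⟨h2, by linarith⟩, ?_⟩
      rw [← Real.cos_neg]
      exact Real.cos_neg_of_pi_div_two_lt_of_lt (by linarith) (by linarith)

lemma stdGaussian_pos_neg {u v : E} (hu : u ≠ 0) (hv : v ≠ 0) :
    stdGaussian E {g | 0 < ⟪u, g⟫ ∧ ⟪v, g⟫ < 0} =
      ENNReal.ofReal (InnerProductGeometry.angle u v / (2 * Real.pi)) := by
  have hpi := Real.pi_pos
  have hu' := norm_pos_iff.2 hu
  have hv' := norm_pos_iff.2 hv
  set e := ‖u‖⁻¹ • u with he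
  have hen : ‖e‖ = 1 := norm_smul_inv_norm hu
  set φ := InnerProductGeometry.angle u v with hφ
  set z := ‖v‖⁻¹ • v - Real.cos φ • e with hz
  have hcos : ⟪e, ‖v‖⁻¹ • v⟫ = Real.cos φ := by
    rw [hφ, InnerProductGeometry.cos_angle, he, inner_smul_left, inner_smul_right]
    simp; field_simp
  have hez : ⟪e, z⟫ = 0 := by
    rw [hz, inner_sub_right, hcos, inner_smul_right, real_inner_self_eq_norm_sq, hen]; ring
  have hvn : ‖(‖v‖⁻¹ • v : E)‖ = 1 := norm_smul_inv_norm hv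
  have hzn : ‖z‖ = Real.sin φ := by
    have : ‖z‖ ^ 2 = Real.sin φ ^ 2 := by
      rw [hz, norm_sub_sq_real, inner_smul_right, real_inner_comm, hcos, hvn, norm_smul, hen,
        Real.sin_sq]
      simp; ring
    have hs : 0 ≤ Real.sin φ := InnerProductGeometry.sin_angle_nonneg u v
    exact (sq_eq_sq₀ (norm_nonneg _) hs).1 this
  have hset : {g : E | 0 < ⟪u, g⟫ ∧ ⟪v, g⟫ < 0} =
      {g : E | 0 < ⟪e, g⟫ ∧ ⟪‖v‖⁻¹ • v, g⟫ < 0} := by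
    ext g
    have a1 : 0 < ‖u‖⁻¹ := by positivity
    have a2 : 0 < ‖v‖⁻¹ := by positivity
    simp [he, inner_smul_left, mul_neg_iff, hu', hv', hv'.le, not_lt]
  have hvz : ‖v‖⁻¹ • v = Real.cos φ • e + z := by rw [hz]; abel
  rw [hset]
  by_cases h0 : z = 0
  · -- `v` is a multiple of `u`, so that the angle is `0` or `π`
    have hsin : Real.sin φ = 0 := by rw [← hzn, h0, norm_zero]
    rw [hvz, h0, add_zero]
    rcases InnerProductGeometry.sin_eq_zero_iff_angle_eq_zero_or_angle_eq_pi.1 hsin with h | h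
    · rw [← hφ] at h
      rw [h]
      have : {g : E | 0 < ⟪e, g⟫ ∧ ⟪Real.cos 0 • e, g⟫ < 0} = ∅ := by
        ext g; simp; intro h; exact h.le
      rw [this]; simp
    · rw [← hφ] at h
      rw [h]
      have h2 : (Real.pi / (2 * Real.pi)) = 1 / 2 := by field_simp
      have : {g : E | 0 < ⟪e, g⟫ ∧ ⟪Real.cos Real.pi • e, g⟫ < 0} =
          (fun g => ⟪e, g⟫) ⁻¹' Set.Ioi 0 := by
        ext g; simp
      rw [this, ← Measure.map_apply (by fun_prop) measurableSet_Ioi, stdGaussian_map_inner, h2]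
      have hn : ‖e‖₊ = 1 := by ext; simpa using hen
      rw [hn, one_pow]
      have hneg : gaussianReal 0 1 (Set.Iio 0) = gaussianReal 0 1 (Set.Ioi 0) := by
        have h3 := gaussianReal_map_neg (μ := 0) (v := 1)
        rw [neg_zero] at h3
        conv_lhs => rw [← h3]
        rw [Measure.map_apply (by fun_prop) measurableSet_Iio]
        congr 1; ext; simp
      have : NullSingletonClass (gaussianReal 0 1) := nullSingletonClass_gaussianReal one_ne_zero
      have htot : gaussianReal 0 1 (Set.Iio 0) + gaussianReal 0 1 (Set.Ioi 0) = 1 := by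
        rw [← measure_union (by
          rw [Set.disjoint_left]; intro x hx hx'; exact lt_asymm (Set.mem_Iio.1 hx) hx')
          measurableSet_Ioi,
          Set.Iio_union_Ioi, measure_compl (measurableSet_singleton _) (measure_ne_top _ _)]
        simp
      rw [hneg, ← two_mul] at htot
      rw [one_div, ENNReal.ofReal_inv_of_pos two_pos]
      simp
      exact ENNReal.eq_inv_of_mul_eq_one_left (by rw [mul_comm]; exact htot)
  · have hz' := norm_pos_iff.2 h0
    have hvz2 : ‖v‖⁻¹ • v = Real.cos φ • e + Real.sin φ • (‖z‖⁻¹ • z) := by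
      rw [hvz, ← hzn, smul_inv_smul₀ hz'.ne']
    rw [hvz2]
    exact stdGaussian_pos_neg_of_orthonormal hen (norm_smul_inv_norm h0)
      (by rw [inner_smul_right, hez, mul_zero]) (InnerProductGeometry.angle_nonneg u v)
      (InnerProductGeometry.angle_le_pi u v)

/-- Two linear functionals of a standard Gaussian vector have opposite signs with probability
proportional to the angle between them. -/
lemma stdGaussian_inner_mul_inner_neg {u v : E} (hu : u ≠ 0) (hv : v ≠ 0) :
    stdGaussian E {g | ⟪u, g⟫ * ⟪v, g⟫ < 0} =
      ENNReal.ofReal (InnerProductGeometry.angle u v / Real.pi) := by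
  have hset : {g : E | ⟪u, g⟫ * ⟪v, g⟫ < 0} =
      {g | 0 < ⟪u, g⟫ ∧ ⟪v, g⟫ < 0} ∪ {g | 0 < ⟪-u, g⟫ ∧ ⟪-v, g⟫ < 0} := by
    ext g
    simp [mul_neg_iff]
  rw [hset, measure_union, stdGaussian_pos_neg hu hv,
    stdGaussian_pos_neg (neg_ne_zero.2 hu) (neg_ne_zero.2 hv), InnerProductGeometry.angle_neg_neg,
    ← ENNReal.ofReal_add]
  · congr 1; ring
  · exact div_nonneg (InnerProductGeometry.angle_nonneg _ _) (by positivity)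
  · exact div_nonneg (InnerProductGeometry.angle_nonneg _ _) (by positivity)
  · rw [Set.disjoint_left]
    rintro g ⟨h1, _⟩ ⟨h2, _⟩
    rw [inner_neg_left] at h2
    linarith
  · exact measurableSet_pos_and_neg (by fun_prop) (by fun_prop)

end Gaussian

/-! ### Counting zeros -/

section ZeroCount

lemma zeroCount_le_of_finset {f : ℝ → ℝ} {s : Set ℝ} {c : ℝ≥0∞}
    (h : ∀ Z : Finset ℝ, (∀ z ∈ Z, z ∈ s ∧ f z = 0) → (Z.card : ℝ≥0∞) ≤ c) :
    zeroCount f s ≤ c := by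
  unfold zeroCount
  by_cases hfin : {x ∈ s | f x = 0}.Finite
  · rw [hfin.encard_eq_coe_toFinset_card]
    simpa using h hfin.toFinset (fun z hz => by simpa using hz)
  · have hinf : {x ∈ s | f x = 0}.Infinite := hfin
    have : c = ∞ := by
      refine ENNReal.eq_top_of_forall_nnreal_le fun r => ?_
      obtain ⟨n, hn⟩ := exists_nat_ge r
      obtain ⟨Z, hZ, hc⟩ := hinf.exists_subset_card_eq n
      have := h Z (fun z hz => by simpa using hZ hz)
      rw [hc] at this
      exact le_trans (by exact_mod_cast hn) this
    rw [this]; exact le_top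

lemma card_le_zeroCount {ι : Type*} {f : ℝ → ℝ} {s : Set ℝ} (T : Finset ι) (z : ι → ℝ)
    (hz : ∀ i ∈ T, z i ∈ s ∧ f (z i) = 0) (hinj : Set.InjOn z T) :
    (T.card : ℝ≥0∞) ≤ zeroCount f s := by
  unfold zeroCount
  have : (T : Set ι).encard ≤ {x ∈ s | f x = 0}.encard :=
    Set.encard_le_encard_of_injOn (f := z) (fun i hi => by simpa using hz i hi) hinj
  rw [Set.encard_coe_eq_coe_finsetCard] at this
  simpa using ENat.toENNReal_le.2 this

lemma zeroCount_mono {f : ℝ → ℝ} {s t : Set ℝ} (h : s ⊆ t) : zeroCount f s ≤ zeroCount f t :=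
  ENat.toENNReal_le.2 (Set.encard_le_encard fun _ hx => ⟨h hx.1, hx.2⟩)

lemma zeroCount_congr {f g : ℝ → ℝ} {s : Set ℝ} (h : ∀ x ∈ s, f x = 0 ↔ g x = 0) :
    zeroCount f s = zeroCount g s := by
  unfold zeroCount
  congr 2
  ext x
  exact and_congr_right fun hx => h x hx

lemma zeroCount_union_le (f : ℝ → ℝ) (s t : Set ℝ) :
    zeroCount f (s ∪ t) ≤ zeroCount f s + zeroCount f t := by
  unfold zeroCount
  rw [← ENat.toENNReal_add, ENat.toENNReal_le]
  refine le_trans (Set.encard_le_encard ?_) (Set.encard_union_le _ _)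
  rintro x ⟨hx | hx, h0⟩
  exacts [Or.inl ⟨hx, h0⟩, Or.inr ⟨hx, h0⟩]

lemma zeroCount_biUnion_le {ι : Type*} (f : ℝ → ℝ) (T : Finset ι) (s : ι → Set ℝ) :
    zeroCount f (⋃ i ∈ T, s i) ≤ ∑ i ∈ T, zeroCount f (s i) := by
  classical
  induction T using Finset.induction_on with
  | empty => simp [zeroCount]
  | insert i T hi ih =>
    rw [Finset.sum_insert hi, Finset.set_biUnion_insert]
    exact (zeroCount_union_le f _ _).trans (add_le_add le_rfl ih)

lemma sum_zeroCount_le {ι : Type*} (f : ℝ → ℝ) (T : Finset ι) (s : ι → Set ℝ) {t : Set ℝ}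
    (hd : (T : Set ι).PairwiseDisjoint s) (hst : ∀ i ∈ T, s i ⊆ t) :
    ∑ i ∈ T, zeroCount f (s i) ≤ zeroCount f t := by
  classical
  suffices h : ∑ i ∈ T, zeroCount f (s i) ≤ zeroCount f (⋃ i ∈ T, s i) from
    h.trans (zeroCount_mono (Set.iUnion₂_subset hst))
  clear hst
  induction T using Finset.induction_on with
  | empty => simp
  | insert i T hi ih =>
    rw [Finset.sum_insert hi, Finset.set_biUnion_insert]
    refine (add_le_add le_rfl (ih (hd.subset (by simp)))).trans ?_
    unfold zeroCount
    rw [← ENat.toENNReal_add, ENat.toENNReal_le, ← Set.encard_union_eq]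
    · refine Set.encard_le_encard ?_
      rintro x (⟨hx, h0⟩ | ⟨hx, h0⟩)
      exacts [⟨Or.inl hx, h0⟩, ⟨Or.inr hx, h0⟩]
    · rw [Set.disjoint_left]
      rintro x ⟨hx, _⟩ ⟨hx', _⟩
      obtain ⟨k, hk, hxk⟩ := Set.mem_iUnion₂.1 hx'
      exact Set.disjoint_left.1 (hd (by simp) (by simp [hk]) (ne_of_mem_of_not_mem hk hi).symm)
        hx hxk

/-- Having a zero in a compact set is a closed condition on the parameter. -/
lemma isClosed_exists_zero {X Y : Type*} [TopologicalSpace X] [TopologicalSpace Y] [T1Space Y]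
    [Zero Y] {F : X → ℝ → Y} {K : Set ℝ} (hK : IsCompact K)
    (hF : ContinuousOn (Function.uncurry F) (Set.univ ×ˢ K)) :
    IsClosed {g | ∃ x ∈ K, F g x = 0} := by
  have : CompactSpace K := isCompact_iff_compactSpace.1 hK
  have hc : Continuous (fun p : X × K => F p.1 p.2) :=
    hF.comp_continuous (f := fun p : X × K => (p.1, (p.2 : ℝ))) (by fun_prop)
      (fun p => ⟨trivial, p.2.2⟩)
  have h2 : IsClosed {p : X × K | F p.1 p.2 = 0} := isClosed_singleton.preimage hc
  have h3 := isClosedMap_fst_of_compactSpace (X := X) (Y := K) _ h2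
  convert h3 using 1
  ext g
  simp

/-- The zero count is the supremum, over the finite disjoint families of compact intervals with
rational end points, of the number of intervals of the family that contain a zero. -/
lemma measurable_zeroCount_Ioo {X : Type*} [TopologicalSpace X] [MeasurableSpace X]
    [BorelSpace X] {F : X → ℝ → ℝ} (hF : Continuous (Function.uncurry F)) (α β : ℝ) :
    Measurable (fun g => zeroCount (F g) (Set.Ioo α β)) := by
  classical
  set D : ℚ × ℚ → Set X := fun q => {g | ∃ x ∈ Set.Icc (q.1 : ℝ) q.2, F g x = 0} with hD
  set A : Set (Finset (ℚ × ℚ)) := {T | (∀ q ∈ T, Set.Icc (q.1 : ℝ) q.2 ⊆ Set.Ioo α β) ∧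
    (T : Set (ℚ × ℚ)).PairwiseDisjoint (fun q => Set.Icc (q.1 : ℝ) q.2)} with hA
  have hmeas : ∀ q, MeasurableSet (D q) := fun q =>
    (isClosed_exists_zero isCompact_Icc hF.continuousOn).measurableSet
  have key : (fun g => zeroCount (F g) (Set.Ioo α β)) =
      fun g => ⨆ T : A, ∑ q ∈ T.1, (D q).indicator (1 : X → ℝ≥0∞) g := by
    ext g
    apply le_antisymm
    · refine zeroCount_le_of_finset fun Z hZ => ?_
      obtain ⟨U, hU, hdisj⟩ := Z.finite_toSet.t2_separation
      have hex : ∀ z : ℝ, ∃ q : ℚ × ℚ, z ∈ Z → (z ∈ Set.Icc (q.1 : ℝ) q.2 ∧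
          Set.Icc (q.1 : ℝ) q.2 ⊆ U z ∩ Set.Ioo α β) := by
        intro z
        by_cases hz : z ∈ Z
        · have hn : U z ∩ Set.Ioo α β ∈ nhds z :=
            ((hU z).2.inter isOpen_Ioo).mem_nhds ⟨(hU z).1, (hZ z hz).1⟩
          obtain ⟨ε, hε, hb⟩ := Metric.mem_nhds_iff.1 hn
          obtain ⟨a, ha1, ha2⟩ := exists_rat_btwn (show z - ε < z by linarith)
          obtain ⟨b, hb1, hb2⟩ := exists_rat_btwn (show z < z + ε by linarith)
          refine ⟨(a, b), fun _ => ⟨⟨ha2.le, hb1.le⟩, fun x hx => hb ?_⟩⟩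
          rw [Metric.mem_ball, Real.dist_eq, abs_lt]
          constructor <;> linarith [hx.1, hx.2]
        · exact ⟨(0, 0), fun h => absurd h hz⟩
      choose q hq using hex
      have hinj : Set.InjOn q Z := by
        intro z hz z' hz' h
        by_contra hne
        have h1 := hq z hz
        have h2 := hq z' hz'
        rw [← h] at h2
        exact Set.disjoint_left.1 (hdisj hz hz' hne) (h1.2 h1.1).1 (h2.2 h1.1).1
      have hT : Z.image q ∈ A := by
        constructor
        · intro p hp
          obtain ⟨z, hz, rfl⟩ := Finset.mem_image.1 hp
          exact fun x hx => ((hq z hz).2 hx).2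
        · intro p hp p' hp' hne
          obtain ⟨z, hz, rfl⟩ := Finset.mem_image.1 (Finset.mem_coe.1 hp)
          obtain ⟨z', hz', rfl⟩ := Finset.mem_image.1 (Finset.mem_coe.1 hp')
          have hne' : z ≠ z' := fun h => hne (h ▸ rfl)
          refine Set.disjoint_left.2 fun x hx hx' => ?_
          exact Set.disjoint_left.1 (hdisj hz hz' hne') ((hq z hz).2 hx).1 ((hq z' hz').2 hx').1
      refine le_trans ?_ (le_iSup (fun T : A => ∑ q ∈ T.1, (D q).indicator
        (1 : X → ℝ≥0∞) g) ⟨Z.image q, hT⟩)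
      dsimp only
      rw [Finset.sum_image hinj]
      rw [← nsmul_one, ← Finset.sum_const]
      refine Finset.sum_le_sum fun z hz => ?_
      have : g ∈ D (q z) := ⟨z, (hq z hz).1, (hZ z hz).2⟩
      rw [Set.indicator_of_mem this]; simp
    · refine iSup_le ?_
      rintro ⟨T, hT1, hT2⟩
      have hsum : ∑ q ∈ T, (D q).indicator (1 : X → ℝ≥0∞) g =
          ((T.filter (fun q => g ∈ D q)).card : ℝ≥0∞) := by
        rw [Finset.card_filter]
        push_cast
        refine Finset.sum_congr rfl fun q _ => ?_
        simp [Set.indicator_apply]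
      dsimp only
      rw [hsum]
      have hex : ∀ q : ℚ × ℚ, ∃ x : ℝ, g ∈ D q → x ∈ Set.Icc (q.1 : ℝ) q.2 ∧ F g x = 0 := by
        intro q
        by_cases h : g ∈ D q
        · obtain ⟨x, hx⟩ := h
          exact ⟨x, fun _ => hx⟩
        · exact ⟨0, fun h' => absurd h' h⟩
      choose x hx using hex
      refine card_le_zeroCount _ x ?_ ?_
      · intro q hq
        obtain ⟨hqT, hqD⟩ := Finset.mem_filter.1 hq
        exact ⟨hT1 q hqT (hx q hqD).1, (hx q hqD).2⟩
      · intro q hq q' hq' h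
        obtain ⟨hqT, hqD⟩ := Finset.mem_filter.1 (Finset.mem_coe.1 hq)
        obtain ⟨hqT', hqD'⟩ := Finset.mem_filter.1 (Finset.mem_coe.1 hq')
        by_contra hne
        have h1 := (hx q hqD).1
        have h2 := (hx q' hqD').1
        rw [← h] at h2
        exact Set.disjoint_left.1 (hT2 hqT hqT' hne) h1 h2
  rw [key]
  refine Measurable.iSup fun T => ?_
  exact Finset.measurable_sum _ fun q _ => measurable_one.indicator (hmeas q)

end ZeroCount

/-! ### Sign changes along subdivisions -/

section SignChanges

/-- The `j`-th point of the subdivision of `[α, β]` into `K` equal cells. -/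
noncomputable def meshPoint (α β : ℝ) (K j : ℕ) : ℝ := α + j * ((β - α) / K)

lemma meshPoint_lt_succ {α β : ℝ} (h : α < β) {K : ℕ} (hK : 0 < K) (j : ℕ) :
    meshPoint α β K j < meshPoint α β K (j + 1) := by
  unfold meshPoint
  have : 0 < (β - α) / K := div_pos (by linarith) (by positivity)
  push_cast
  linarith

lemma meshPoint_mono {α β : ℝ} (h : α < β) (K : ℕ) : Monotone (meshPoint α β K) := by
  intro i j hij
  unfold meshPoint
  have : 0 ≤ (β - α) / K := div_nonneg (by linarith) (by positivity)
  have : (i : ℝ) ≤ j := by exact_mod_cast hij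
  gcongr

lemma meshPoint_mem_Icc {α β : ℝ} (h : α < β) {K j : ℕ} (hK : 0 < K) (hj : j ≤ K) :
    meshPoint α β K j ∈ Set.Icc α β := by
  have h0 := meshPoint_mono h K (Nat.zero_le j)
  have h1 := meshPoint_mono h K hj
  have e0 : meshPoint α β K 0 = α := by simp [meshPoint]
  have e1 : meshPoint α β K K = β := by
    have : (K : ℝ) ≠ 0 := by positivity
    unfold meshPoint; field_simp; ring
  rw [e0] at h0; rw [e1] at h1
  exact ⟨h0, h1⟩

/-- The number of cells of the subdivision of `[α, β]` into `K` equal cells at whose end points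
`f` takes opposite signs. -/
noncomputable def signChanges (f : ℝ → ℝ) (α β : ℝ) (K : ℕ) : ℕ :=
  ((Finset.range K).filter
    (fun j => f (meshPoint α β K j) * f (meshPoint α β K (j + 1)) < 0)).card

lemma signChanges_le_zeroCount {f : ℝ → ℝ} {α β : ℝ} (h : α < β)
    (hf : ContinuousOn f (Set.Icc α β)) (K : ℕ) :
    (signChanges f α β K : ℝ≥0∞) ≤ zeroCount f (Set.Ioo α β) := by
  rcases Nat.eq_zero_or_pos K with rfl | hK
  · simp [signChanges]
  have hex : ∀ j : ℕ, ∃ z : ℝ, j < K → f (meshPoint α β K j) * f (meshPoint α β K (j + 1)) < 0 →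
      z ∈ Set.Ioo (meshPoint α β K j) (meshPoint α β K (j + 1)) ∧ f z = 0 := by
    intro j
    by_cases hj : j < K ∧ f (meshPoint α β K j) * f (meshPoint α β K (j + 1)) < 0
    · obtain ⟨hjK, hneg⟩ := hj
      have m1 := meshPoint_mem_Icc h hK hjK.le
      have m2 := meshPoint_mem_Icc h hK (Nat.succ_le_of_lt hjK)
      have hlt := meshPoint_lt_succ h hK j
      have hc : ContinuousOn f (Set.Icc (meshPoint α β K j) (meshPoint α β K (j + 1))) :=
        hf.mono (Set.Icc_subset_Icc m1.1 m2.2)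
      rcases mul_neg_iff.1 hneg with ⟨h1, h2⟩ | ⟨h1, h2⟩
      · obtain ⟨z, hz, hz0⟩ := intermediate_value_Ioo' hlt.le hc ⟨h2, h1⟩
        exact ⟨z, fun _ _ => ⟨hz, hz0⟩⟩
      · obtain ⟨z, hz, hz0⟩ := intermediate_value_Ioo hlt.le hc ⟨h1, h2⟩
        exact ⟨z, fun _ _ => ⟨hz, hz0⟩⟩
    · exact ⟨0, fun h1 h2 => absurd ⟨h1, h2⟩ hj⟩
  choose z hz using hex
  refine card_le_zeroCount _ z ?_ ?_
  · intro j hj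
    obtain ⟨hjK, hneg⟩ := Finset.mem_filter.1 hj
    have hjK := Finset.mem_range.1 hjK
    obtain ⟨h1, h2⟩ := hz j hjK hneg
    exact ⟨⟨(meshPoint_mem_Icc h hK hjK.le).1.trans_lt h1.1,
      h1.2.trans_le (meshPoint_mem_Icc h hK (Nat.succ_le_of_lt hjK)).2⟩, h2⟩
  · intro i hi j hj hij
    obtain ⟨hiK, hni⟩ := Finset.mem_filter.1 (Finset.mem_coe.1 hi)
    obtain ⟨hjK, hnj⟩ := Finset.mem_filter.1 (Finset.mem_coe.1 hj)
    have h1 := (hz i (Finset.mem_range.1 hiK) hni).1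
    have h2 := (hz j (Finset.mem_range.1 hjK) hnj).1
    rw [← hij] at h2
    rcases lt_trichotomy i j with hlt | rfl | hlt
    · exact absurd (h1.2.trans_le (meshPoint_mono h K (Nat.succ_le_of_lt hlt))) (not_lt.2 h2.1.le)
    · rfl
    · exact absurd (h2.2.trans_le (meshPoint_mono h K (Nat.succ_le_of_lt hlt))) (not_lt.2 h1.1.le)

/-- Sign changes along fine subdivisions detect all simple zeros. -/
lemma card_le_signChanges_eventually {f f' : ℝ → ℝ} {α β : ℝ} (h : α < β) {Z : Finset ℝ}
    (hZ : ∀ z ∈ Z, z ∈ Set.Ioo α β) (hf : ∀ z ∈ Z, HasDerivAt f (f' z) z)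
    (h0 : ∀ z ∈ Z, f z = 0) (h1 : ∀ z ∈ Z, f' z ≠ 0)
    (hmesh : ∀ K j : ℕ, 0 < K → j ≤ K → f (meshPoint α β K j) ≠ 0) :
    ∀ᶠ K : ℕ in Filter.atTop, Z.card ≤ signChanges f α β K := by
  classical
  obtain ⟨U, hU, hdisj⟩ := Z.finite_toSet.t2_separation
  have hloc : ∀ z ∈ Z, ∃ ε > 0, ∀ x, |x - z| < ε →
      x ∈ U z ∧ (x ≠ z → 0 < f' z * (x - z) * f x) := by
    intro z hz
    have hs := (hasDerivAt_iff_tendsto_slope.1 (hf z hz))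
    have hs2 : ∀ᶠ x in nhdsWithin z {z}ᶜ, 0 < f' z * slope f z x :=
      (hs.const_mul (f' z)).eventually_const_lt (mul_self_pos.2 (h1 z hz))
    rw [eventually_nhdsWithin_iff] at hs2
    obtain ⟨ε, hε, hb⟩ := Metric.eventually_nhds_iff.1 (hs2.and ((hU z).2.eventually_mem (hU z).1))
    refine ⟨ε, hε, fun x hx => ⟨(hb hx).2, fun hne => ?_⟩⟩
    have := (hb hx).1 hne
    rw [slope_def_field, h0 z hz, sub_zero] at this
    have hxz : x - z ≠ 0 := sub_ne_zero.2 hne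
    have h3 : f' z * (x - z) * f x = f' z * (f x / (x - z)) * (x - z) ^ 2 := by
      field_simp
    rw [h3]; positivity
  have hev : ∀ z ∈ Z, ∀ᶠ K : ℕ in Filter.atTop, ∀ x, |x - z| ≤ (β - α) / K →
      x ∈ U z ∧ (x ≠ z → 0 < f' z * (x - z) * f x) := by
    intro z hz
    obtain ⟨ε, hε, hb⟩ := hloc z hz
    have ht : Filter.Tendsto (fun K : ℕ => (β - α) / K) Filter.atTop (nhds 0) :=
      tendsto_const_div_atTop_nhds_zero_nat _
    filter_upwards [ht.eventually_lt_const hε] with K hK x hx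
    exact hb x (hx.trans_lt hK)
  filter_upwards [(Filter.eventually_all_finset Z).2 hev,
    Filter.eventually_gt_atTop 0] with K hK hK0
  have hKpos : (0 : ℝ) < K := by exact_mod_cast hK0
  set δ := (β - α) / K with hδ
  have hδpos : 0 < δ := div_pos (by linarith) hKpos
  set J : ℝ → ℕ := fun z => ⌊(z - α) / δ⌋₊ with hJ
  have hJ1 : ∀ z ∈ Z, meshPoint α β K (J z) < z ∧ z < meshPoint α β K (J z + 1) ∧ J z < K := by
    intro z hz
    have hz' := hZ z hz
    have hnn : 0 ≤ (z - α) / δ := div_nonneg (by linarith [hz'.1]) hδpos.le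
    have a1 : (J z : ℝ) * δ ≤ z - α := (le_div_iff₀ hδpos).1 (Nat.floor_le hnn)
    have a2 : z - α < ((J z : ℝ) + 1) * δ := (div_lt_iff₀ hδpos).1 (Nat.lt_floor_add_one _)
    have hlt : J z < K := by
      rw [hJ]
      refine (Nat.floor_lt hnn).2 ?_
      rw [div_lt_iff₀ hδpos, hδ]
      have : (K : ℝ) * ((β - α) / K) = β - α := by field_simp
      rw [this]; linarith [hz'.2]
    have hne : meshPoint α β K (J z) ≠ z := fun e =>
      hmesh K (J z) hK0 hlt.le (by rw [e]; exact h0 z hz)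
    refine ⟨lt_of_le_of_ne ?_ hne, ?_, hlt⟩
    · unfold meshPoint; rw [← hδ]; linarith
    · unfold meshPoint; push_cast; rw [← hδ]; linarith
  have hstep : ∀ j, meshPoint α β K (j + 1) = meshPoint α β K j + δ := by
    intro j; unfold meshPoint; push_cast; rw [← hδ]; ring
  have hnear : ∀ z ∈ Z, |meshPoint α β K (J z) - z| ≤ δ ∧ |meshPoint α β K (J z + 1) - z| ≤ δ := by
    intro z hz
    obtain ⟨b1, b2, _⟩ := hJ1 z hz
    have := hstep (J z)
    constructor <;> rw [abs_le] <;> constructor <;> linarith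
  unfold signChanges
  refine Finset.card_le_card_of_injOn J ?_ ?_
  · intro z hz
    obtain ⟨b1, b2, b3⟩ := hJ1 z hz
    obtain ⟨n1, n2⟩ := hnear z hz
    have p1 := (hK z hz _ n1).2 b1.ne
    have p2 := (hK z hz _ n2).2 b2.ne'
    rw [Finset.mem_coe, Finset.mem_filter, Finset.mem_range]
    refine ⟨b3, ?_⟩
    have p3 := mul_pos p1 p2
    by_contra hcon
    have q1 : (meshPoint α β K (J z) - z) * (meshPoint α β K (J z + 1) - z) < 0 :=
      mul_neg_of_neg_of_pos (by linarith) (by linarith)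
    have q2 : f' z ^ 2 * ((meshPoint α β K (J z) - z) * (meshPoint α β K (J z + 1) - z)) ≤ 0 :=
      mul_nonpos_of_nonneg_of_nonpos (sq_nonneg _) q1.le
    have q3 := mul_nonpos_of_nonpos_of_nonneg q2 (not_lt.1 hcon)
    have q4 : f' z * (meshPoint α β K (J z) - z) * f (meshPoint α β K (J z)) *
      (f' z * (meshPoint α β K (J z + 1) - z) * f (meshPoint α β K (J z + 1))) =
      f' z ^ 2 * ((meshPoint α β K (J z) - z) * (meshPoint α β K (J z + 1) - z)) *
      (f (meshPoint α β K (J z)) * f (meshPoint α β K (J z + 1))) := by ring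
    linarith
  · intro z hz z' hz' hzz
    by_contra hne
    have u1 := (hK z hz _ (hnear z hz).1).1
    have u2 := (hK z' hz' _ (hnear z' hz').1).1
    rw [← hzz] at u2
    exact Set.disjoint_left.1 (hdisj hz hz' hne) u1 u2

end SignChanges

/-! ### Zeros of random combinations are simple -/

section SimpleZeros

open scoped RealInnerProductSpace

variable {E : Type*} [NormedAddCommGroup E] [InnerProductSpace ℝ E] [FiniteDimensional ℝ E]
  [MeasurableSpace E] [BorelSpace E]

lemma stdGaussian_inner_eq_zero {u : E} (hu : u ≠ 0) : stdGaussian E {g | ⟪u, g⟫ = 0} = 0 := by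
  have hset : {g : E | ⟪u, g⟫ = 0} = (fun g => ⟪u, g⟫) ⁻¹' {0} := by ext; simp
  have : NullSingletonClass (gaussianReal 0 (‖u‖₊ ^ 2)) :=
    nullSingletonClass_gaussianReal (by simpa using hu)
  rw [hset, ← Measure.map_apply (by fun_prop) (measurableSet_singleton _), stdGaussian_map_inner]
  exact measure_singleton 0

/-- A random linear combination of the coordinates of a curve almost surely has no multiple zero,
provided that some fixed linear combination does not vanish. Along the line through `y` in the
direction `e` of that fixed combination, the exceptional values are critical values of the function
`-⟪w, y⟫ / ⟪w, e⟫`, so that Sard's lemma applies. -/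
lemma stdGaussian_multiple_zero {w w' : ℝ → E} {α β : ℝ} {e : E}
    (hw : ∀ x ∈ Set.Icc α β, HasDerivAt w (w' x) x) (hw' : ContinuousOn w' (Set.Icc α β))
    (he1 : ‖e‖ = 1) (he : ∀ x ∈ Set.Icc α β, ⟪w x, e⟫ ≠ 0) :
    stdGaussian E {g | ∃ x ∈ Set.Icc α β, ⟪w x, g⟫ = 0 ∧ ⟪w' x, g⟫ = 0} = 0 := by
  have hwc : ContinuousOn w (Set.Icc α β) := fun x hx => (hw x hx).continuousAt.continuousWithinAt
  have hclosed : IsClosed {g : E | ∃ x ∈ Set.Icc α β, ⟪w x, g⟫ = 0 ∧ ⟪w' x, g⟫ = 0} := by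
    have := isClosed_exists_zero (X := E) (Y := ℝ × ℝ)
      (F := fun g x => (⟪w x, g⟫, ⟪w' x, g⟫)) (K := Set.Icc α β) isCompact_Icc ?_
    · simpa [Prod.ext_iff] using this
    · have m2 : Set.MapsTo Prod.snd ((Set.univ : Set E) ×ˢ Set.Icc α β) (Set.Icc α β) :=
        fun p hp => hp.2
      have c1 : ContinuousOn (fun p : E × ℝ => w p.2) (Set.univ ×ˢ Set.Icc α β) :=
        hwc.comp continuousOn_snd m2
      have c2 : ContinuousOn (fun p : E × ℝ => w' p.2) (Set.univ ×ˢ Set.Icc α β) :=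
        hw'.comp continuousOn_snd m2
      exact (ContinuousOn.inner (𝕜 := ℝ) c1 continuousOn_fst).prodMk
        (ContinuousOn.inner (𝕜 := ℝ) c2 continuousOn_fst)
  refine stdGaussian_null_of_lines he1 hclosed.measurableSet fun y => ?_
  set H : ℝ → ℝ := fun x => -(⟪w x, y⟫ / ⟪w x, e⟫) with hH
  set s : Set ℝ := {x ∈ Set.Icc α β | HasDerivAt H 0 x} with hs
  have hsard : volume (H '' s) = 0 := by
    refine addHaar_image_eq_zero_of_det_fderivWithin_eq_zero (f' := fun _ => 0) volume
      (fun x hx => ?_) (fun x _ => ?_)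
    · have := hx.2.hasFDerivAt.hasFDerivWithinAt (s := s)
      simpa using this
    · simp [ContinuousLinearMap.det]
  refine measure_mono_null ?_ hsard
  rintro t ⟨x, hx, h1, h2⟩
  rw [inner_add_right, inner_smul_right] at h1 h2
  have hne := he x hx
  have hHx : H x = t := by
    rw [hH]; dsimp only; field_simp; linarith
  refine ⟨x, ⟨hx, ?_⟩, hHx⟩
  have d1 : HasDerivAt (fun x => ⟪w x, y⟫) ⟪w' x, y⟫ x := by
    simpa using (hw x hx).inner ℝ (hasDerivAt_const x y)
  have d2 : HasDerivAt (fun x => ⟪w x, e⟫) ⟪w' x, e⟫ x := by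
    simpa using (hw x hx).inner ℝ (hasDerivAt_const x e)
  have d3 := (d1.div d2 hne).neg
  have e1 : ⟪w x, y⟫ = -(t * ⟪w x, e⟫) := by linarith
  have e2 : ⟪w' x, y⟫ = -(t * ⟪w' x, e⟫) := by linarith
  have e3 : -((⟪w' x, y⟫ * ⟪w x, e⟫ - ⟪w x, y⟫ * ⟪w' x, e⟫) / ⟪w x, e⟫ ^ 2) = 0 := by
    rw [e1, e2]; ring
  rw [e3] at d3
  exact d3

end SimpleZeros

/-! ### Length of spherical curves and the Kac–Rice formula -/

section ArcLength

open scoped RealInnerProductSpace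

variable {E : Type*} [NormedAddCommGroup E] [InnerProductSpace ℝ E]

lemma norm_sub_sq_eq_cos_angle {u v : E} (hu : ‖u‖ = 1) (hv : ‖v‖ = 1) :
    ‖u - v‖ ^ 2 = 2 - 2 * Real.cos (InnerProductGeometry.angle u v) := by
  rw [norm_sub_sq_real, InnerProductGeometry.cos_angle, hu, hv]
  ring

lemma norm_sub_le_angle {u v : E} (hu : ‖u‖ = 1) (hv : ‖v‖ = 1) :
    ‖u - v‖ ≤ InnerProductGeometry.angle u v := by
  have h := norm_sub_sq_eq_cos_angle hu hv
  have h2 := Real.one_sub_sq_div_two_le_cos (x := InnerProductGeometry.angle u v)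
  exact le_of_sq_le_sq (by linarith) (InnerProductGeometry.angle_nonneg u v)

lemma angle_le_of_norm_sub_le {u v : E} (hu : ‖u‖ = 1) (hv : ‖v‖ = 1) {d : ℝ}
    (hd : ‖u - v‖ ≤ d) (hd1 : d < 1) :
    InnerProductGeometry.angle u v ≤ d / (1 - d ^ 2 / 2) := by
  set θ := InnerProductGeometry.angle u v with hθ
  have h := norm_sub_sq_eq_cos_angle hu hv
  rw [← hθ] at h
  have h0 : 0 ≤ ‖u - v‖ := norm_nonneg _
  have hsq : ‖u - v‖ ^ 2 ≤ d ^ 2 := by gcongr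
  have hd0 : 0 ≤ d := h0.trans hd
  have hcos : 1 - d ^ 2 / 2 ≤ Real.cos θ := by linarith
  have hpos : 0 < 1 - d ^ 2 / 2 := by nlinarith
  have hθ0 : 0 ≤ θ := InnerProductGeometry.angle_nonneg u v
  have hθ1 : θ < Real.pi / 2 := by
    by_contra hcon
    have := Real.cos_nonpos_of_pi_div_two_le_of_le (not_lt.1 hcon)
      (by linarith [InnerProductGeometry.angle_le_pi u v, Real.pi_pos])
    linarith
  have hsin : Real.sin θ ≤ d := by
    refine le_of_sq_le_sq ?_ hd0
    rw [Real.sin_sq]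
    nlinarith [sq_nonneg (1 - Real.cos θ)]
  calc θ ≤ Real.tan θ := Real.le_tan hθ0 hθ1
    _ = Real.sin θ / Real.cos θ := Real.tan_eq_sin_div_cos θ
    _ ≤ d / (1 - d ^ 2 / 2) := div_le_div₀ hd0 hsin hpos hcos

/-- The length of the polygon inscribed in a spherical curve `v` at the points of a regular
subdivision, measured by angles. -/
noncomputable def angleSum (v : ℝ → E) (α β : ℝ) (K : ℕ) : ℝ :=
  ∑ j ∈ Finset.range K,
    InnerProductGeometry.angle (v (meshPoint α β K j)) (v (meshPoint α β K (j + 1)))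

variable {v v' : ℝ → E} {α β : ℝ}

lemma meshPoint_succ_sub (K j : ℕ) :
    meshPoint α β K (j + 1) - meshPoint α β K j = (β - α) / K := by
  unfold meshPoint; push_cast; ring

/-- Angles dominate chords, and chords are close to the velocity times the mesh width. -/
lemma angleSum_lower (h : α < β) (hv : ∀ x ∈ Set.Icc α β, HasDerivAt v (v' x) x)
    (hv' : ContinuousOn v' (Set.Icc α β)) (hn : ∀ x ∈ Set.Icc α β, ‖v x‖ = 1) {L : ℝ}
    (hL : ∀ x ∈ Set.Icc α β, L ≤ ‖v' x‖) {ε : ℝ} (hε : 0 < ε) :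
    ∀ᶠ K : ℕ in Filter.atTop, (β - α) * (L - ε) ≤ angleSum v α β K := by
  have huc := isCompact_Icc.uniformContinuousOn_of_continuous hv'
  obtain ⟨η, hη, hb⟩ := Metric.uniformContinuousOn_iff.1 huc ε hε
  have ht : Filter.Tendsto (fun K : ℕ => (β - α) / K) Filter.atTop (nhds 0) :=
    tendsto_const_div_atTop_nhds_zero_nat _
  filter_upwards [ht.eventually_lt_const hη, Filter.eventually_gt_atTop 0] with K hK hK0
  have hKpos : (0 : ℝ) < K := by exact_mod_cast hK0
  have hcell : ∀ j ∈ Finset.range K, (β - α) / K * (L - ε) ≤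
      InnerProductGeometry.angle (v (meshPoint α β K j)) (v (meshPoint α β K (j + 1))) := by
    intro j hj
    have hjK := Finset.mem_range.1 hj
    have m1 := meshPoint_mem_Icc h hK0 hjK.le
    have m2 := meshPoint_mem_Icc h hK0 (Nat.succ_le_of_lt hjK)
    have hlt := meshPoint_lt_succ h hK0 j
    have hstep := meshPoint_succ_sub (α := α) (β := β) K j
    set x := meshPoint α β K j
    set y := meshPoint α β K (j + 1)
    have hsub : Set.Icc x y ⊆ Set.Icc α β := Set.Icc_subset_Icc m1.1 m2.2
    have hmv := (convex_Icc x y).norm_image_sub_le_of_norm_hasDerivWithin_le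
      (f := fun t => v t - t • v' x) (f' := fun t => v' t - v' x) (C := ε) (x := x) (y := y)
      (fun t htt => by
        have h1 := (hv t (hsub htt)).sub ((hasDerivAt_id t).smul_const (v' x))
        rw [one_smul] at h1
        exact h1.hasDerivWithinAt)
      (fun t htt => by
        have := hb t (hsub htt) x m1 (by
          rw [Real.dist_eq, abs_of_nonneg (by linarith [htt.1])]
          linarith [htt.2])
        rw [dist_eq_norm] at this
        exact this.le) ⟨le_rfl, hlt.le⟩ ⟨hlt.le, le_rfl⟩
    have e1 : v y - y • v' x - (v x - x • v' x) = (v y - v x) - (y - x) • v' x := by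
      rw [sub_smul]; abel
    rw [e1, Real.norm_of_nonneg (by linarith : (0:ℝ) ≤ y - x)] at hmv
    have h3 : ‖(y - x) • v' x‖ - ‖v y - v x‖ ≤ ‖(v y - v x) - (y - x) • v' x‖ := by
      rw [norm_sub_rev (v y - v x)]
      exact norm_sub_norm_le _ _
    rw [norm_smul, Real.norm_of_nonneg (by linarith : (0:ℝ) ≤ y - x)] at h3
    have h4 : (y - x) * L ≤ (y - x) * ‖v' x‖ :=
      mul_le_mul_of_nonneg_left (hL x m1) (by linarith)
    have h5 := norm_sub_le_angle (hn x m1) (hn y m2)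
    rw [norm_sub_rev] at h5
    rw [← hstep]
    linarith
  unfold angleSum
  refine le_trans (le_of_eq ?_) (Finset.sum_le_sum hcell)
  rw [Finset.sum_const, Finset.card_range, nsmul_eq_mul]
  field_simp

lemma angleSum_upper (h : α < β) (hv : ∀ x ∈ Set.Icc α β, HasDerivAt v (v' x) x)
    (hn : ∀ x ∈ Set.Icc α β, ‖v x‖ = 1) {L : ℝ}
    (hL : ∀ x ∈ Set.Icc α β, ‖v' x‖ ≤ L) {ε : ℝ} (hε : 0 < ε) :
    ∀ᶠ K : ℕ in Filter.atTop, angleSum v α β K ≤ (β - α) * L + ε := by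
  have ht : Filter.Tendsto (fun K : ℕ => (β - α) / K) Filter.atTop (nhds 0) :=
    tendsto_const_div_atTop_nhds_zero_nat _
  have ht1 : Filter.Tendsto (fun K : ℕ => L * ((β - α) / K)) Filter.atTop (nhds 0) := by
    simpa using ht.const_mul L
  have ht2 : Filter.Tendsto (fun K : ℕ => (β - α) * L / (1 - (L * ((β - α) / K)) ^ 2 / 2))
      Filter.atTop (nhds ((β - α) * L)) := by
    have := (tendsto_const_nhds (x := (β - α) * L)).div
      ((tendsto_const_nhds (x := (1 : ℝ))).sub ((ht1.pow 2).div_const 2)) (by norm_num)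
    simp only [ne_eq, OfNat.ofNat_ne_zero, not_false_eq_true, zero_pow, zero_div, sub_zero,
      div_one] at this
    exact this
  filter_upwards [ht1.eventually_lt_const one_pos,
    ht2.eventually_lt_const (show (β - α) * L < (β - α) * L + ε by linarith),
    Filter.eventually_gt_atTop 0] with K hK1 hK2 hK0
  have hKpos : (0 : ℝ) < K := by exact_mod_cast hK0
  refine le_trans ?_ hK2.le
  have hcell : ∀ j ∈ Finset.range K,
      InnerProductGeometry.angle (v (meshPoint α β K j)) (v (meshPoint α β K (j + 1))) ≤
      L * ((β - α) / K) / (1 - (L * ((β - α) / K)) ^ 2 / 2) := by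
    intro j hj
    have hjK := Finset.mem_range.1 hj
    have m1 := meshPoint_mem_Icc h hK0 hjK.le
    have m2 := meshPoint_mem_Icc h hK0 (Nat.succ_le_of_lt hjK)
    have hlt := meshPoint_lt_succ h hK0 j
    have hstep := meshPoint_succ_sub (α := α) (β := β) K j
    refine angle_le_of_norm_sub_le (hn _ m1) (hn _ m2) ?_ hK1
    have := (convex_Icc α β).norm_image_sub_le_of_norm_hasDerivWithin_le
      (fun t htt => (hv t htt).hasDerivWithinAt) hL m2 m1
    rw [norm_sub_rev (meshPoint α β K j), hstep, Real.norm_of_nonneg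
      (div_nonneg (by linarith) hKpos.le)] at this
    exact this
  unfold angleSum
  refine (Finset.sum_le_sum hcell).trans (le_of_eq ?_)
  rw [Finset.sum_const, Finset.card_range, nsmul_eq_mul]
  field_simp

variable [FiniteDimensional ℝ E] [MeasurableSpace E] [BorelSpace E]

lemma signChanges_eq_sum_indicator (f : ℝ → ℝ) (α β : ℝ) (K : ℕ) :
    (signChanges f α β K : ℝ≥0∞) = ∑ j ∈ Finset.range K,
      if f (meshPoint α β K j) * f (meshPoint α β K (j + 1)) < 0 then 1 else 0 := by
  unfold signChanges
  rw [Finset.card_filter]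
  push_cast
  rfl

lemma measurableSet_inner_mul_neg (u v : E) : MeasurableSet {g : E | ⟪u, g⟫ * ⟪v, g⟫ < 0} :=
  measurableSet_lt (by fun_prop) (by fun_prop)

lemma measurable_signChanges (v : ℝ → E) (α β : ℝ) (K : ℕ) :
    Measurable (fun g : E => (signChanges (fun x => ⟪v x, g⟫) α β K : ℝ≥0∞)) := by
  simp_rw [signChanges_eq_sum_indicator]
  exact Finset.measurable_sum _ fun j _ =>
    Measurable.ite (measurableSet_inner_mul_neg _ _) measurable_const measurable_const

lemma lintegral_signChanges (h : α < β) (hn : ∀ x ∈ Set.Icc α β, ‖v x‖ = 1) {K : ℕ} (hK : 0 < K) :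
    ∫⁻ g, (signChanges (fun x => ⟪v x, g⟫) α β K : ℝ≥0∞) ∂(stdGaussian E) =
      ENNReal.ofReal (angleSum v α β K / Real.pi) := by
  simp_rw [signChanges_eq_sum_indicator]
  rw [lintegral_finsetSum _ fun j _ =>
    Measurable.ite (measurableSet_inner_mul_neg _ _) measurable_const measurable_const]
  unfold angleSum
  rw [Finset.sum_div, ENNReal.ofReal_sum_of_nonneg fun j _ =>
    div_nonneg (InnerProductGeometry.angle_nonneg _ _) Real.pi_pos.le]
  refine Finset.sum_congr rfl fun j hj => ?_
  have hjK := Finset.mem_range.1 hj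
  have hne : ∀ i, i ≤ K → v (meshPoint α β K i) ≠ 0 := fun i hi h0 => by
    have := hn _ (meshPoint_mem_Icc h hK hi)
    rw [h0, norm_zero] at this
    exact zero_ne_one this
  rw [← stdGaussian_inner_mul_inner_neg (hne j hjK.le) (hne (j + 1) hjK),
    ← lintegral_indicator_one (measurableSet_inner_mul_neg _ _)]
  refine lintegral_congr fun g => ?_
  simp [Set.indicator_apply]

/-- **Kac–Rice lower bound.** The expected number of zeros of a random linear combination of the
coordinates of a spherical curve is at least the length of the curve over `π`. -/
lemma lintegral_zeroCount_ge (h : α < β) (hv : ∀ x ∈ Set.Icc α β, HasDerivAt v (v' x) x)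
    (hv' : ContinuousOn v' (Set.Icc α β)) (hn : ∀ x ∈ Set.Icc α β, ‖v x‖ = 1) {L : ℝ}
    (hL : ∀ x ∈ Set.Icc α β, L ≤ ‖v' x‖) :
    ENNReal.ofReal ((β - α) * L / Real.pi) ≤
      ∫⁻ g, zeroCount (fun x => ⟪v x, g⟫) (Set.Ioo α β) ∂(stdGaussian E) := by
  have hpi := Real.pi_pos
  have hvc : ContinuousOn v (Set.Icc α β) := fun x hx => (hv x hx).continuousAt.continuousWithinAt
  have hle : ∀ ε > 0, ENNReal.ofReal ((β - α) * (L - ε) / Real.pi) ≤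
      ∫⁻ g, zeroCount (fun x => ⟪v x, g⟫) (Set.Ioo α β) ∂(stdGaussian E) := by
    intro ε hε
    obtain ⟨K, hK1, hK2⟩ := ((angleSum_lower h hv hv' hn hL hε).and
      (Filter.eventually_gt_atTop 0)).exists
    calc ENNReal.ofReal ((β - α) * (L - ε) / Real.pi)
        ≤ ENNReal.ofReal (angleSum v α β K / Real.pi) := by gcongr
      _ = ∫⁻ g, (signChanges (fun x => ⟪v x, g⟫) α β K : ℝ≥0∞) ∂(stdGaussian E) :=
        (lintegral_signChanges h hn hK2).symm
      _ ≤ _ := lintegral_mono fun g =>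
        signChanges_le_zeroCount h (ContinuousOn.inner (𝕜 := ℝ) hvc continuousOn_const) K
  have ht : Filter.Tendsto (fun ε : ℝ => ENNReal.ofReal ((β - α) * (L - ε) / Real.pi))
      (nhdsWithin 0 (Set.Ioi 0)) (nhds (ENNReal.ofReal ((β - α) * (L - 0) / Real.pi))) := by
    refine Filter.Tendsto.mono_left ?_ nhdsWithin_le_nhds
    exact (ENNReal.continuous_ofReal.comp (by fun_prop)).tendsto 0
  rw [sub_zero] at ht
  exact le_of_tendsto ht (eventually_nhdsWithin_of_forall fun ε hε => hle ε hε)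

/-- **Kac–Rice upper bound.** The expected number of zeros of a random linear combination of the
coordinates of a spherical curve is at most the length of the curve over `π`. -/
lemma lintegral_zeroCount_le (h : α < β) (hv : ∀ x ∈ Set.Icc α β, HasDerivAt v (v' x) x)
    (hv' : ContinuousOn v' (Set.Icc α β)) (hn : ∀ x ∈ Set.Icc α β, ‖v x‖ = 1) {L : ℝ}
    (hL : ∀ x ∈ Set.Icc α β, ‖v' x‖ ≤ L) {e : E} (he1 : ‖e‖ = 1)
    (he : ∀ x ∈ Set.Icc α β, ⟪v x, e⟫ ≠ 0) :
    ∫⁻ g, zeroCount (fun x => ⟪v x, g⟫) (Set.Ioo α β) ∂(stdGaussian E) ≤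
      ENNReal.ofReal ((β - α) * L / Real.pi) := by
  have hpi := Real.pi_pos
  have hsimple : ∀ᵐ g ∂(stdGaussian E), ¬ ∃ x ∈ Set.Icc α β, ⟪v x, g⟫ = 0 ∧ ⟪v' x, g⟫ = 0 := by
    rw [ae_iff]
    simp only [not_not]
    exact stdGaussian_multiple_zero hv hv' he1 he
  have hmesh : ∀ᵐ g ∂(stdGaussian E), ∀ K j : ℕ, 0 < K → j ≤ K →
      ⟪v (meshPoint α β K j), g⟫ ≠ 0 := by
    refine ae_all_iff.2 fun K => ae_all_iff.2 fun j => ?_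
    by_cases hKj : 0 < K ∧ j ≤ K
    · have hne : v (meshPoint α β K j) ≠ 0 := fun h0 => by
        have := hn _ (meshPoint_mem_Icc h hKj.1 hKj.2)
        rw [h0, norm_zero] at this
        exact zero_ne_one this
      have : ∀ᵐ g ∂(stdGaussian E), ⟪v (meshPoint α β K j), g⟫ ≠ 0 := by
        rw [ae_iff]
        simpa using stdGaussian_inner_eq_zero hne
      filter_upwards [this] with g hg _ _ using hg
    · exact ae_of_all _ fun g h1 h2 => absurd ⟨h1, h2⟩ hKj
  have hlim : ∀ᵐ g ∂(stdGaussian E), zeroCount (fun x => ⟪v x, g⟫) (Set.Ioo α β) ≤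
      Filter.liminf (fun K : ℕ => (signChanges (fun x => ⟪v x, g⟫) α β K : ℝ≥0∞))
        Filter.atTop := by
    filter_upwards [hsimple, hmesh] with g hg1 hg2
    refine zeroCount_le_of_finset fun Z hZ => ?_
    have := card_le_signChanges_eventually (f := fun x => ⟪v x, g⟫) (f' := fun x => ⟪v' x, g⟫) h
      (fun z hz => (hZ z hz).1)
      (fun z hz => by
        simpa using (hv z (Set.Ioo_subset_Icc_self (hZ z hz).1)).inner ℝ (hasDerivAt_const z g))
      (fun z hz => (hZ z hz).2)
      (fun z hz h0 => hg1 ⟨z, Set.Ioo_subset_Icc_self (hZ z hz).1, (hZ z hz).2, h0⟩) hg2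
    refine Filter.le_liminf_of_le (by isBoundedDefault) ?_
    filter_upwards [this] with K hK
    exact_mod_cast hK
  have hle : ∀ ε > 0, ∫⁻ g, zeroCount (fun x => ⟪v x, g⟫) (Set.Ioo α β) ∂(stdGaussian E) ≤
      ENNReal.ofReal (((β - α) * L + ε) / Real.pi) := by
    intro ε hε
    calc ∫⁻ g, zeroCount (fun x => ⟪v x, g⟫) (Set.Ioo α β) ∂(stdGaussian E)
        ≤ ∫⁻ g, Filter.liminf (fun K : ℕ => (signChanges (fun x => ⟪v x, g⟫) α β K : ℝ≥0∞))
            Filter.atTop ∂(stdGaussian E) := lintegral_mono_ae hlim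
      _ ≤ Filter.liminf (fun K : ℕ => ∫⁻ g, (signChanges (fun x => ⟪v x, g⟫) α β K : ℝ≥0∞)
            ∂(stdGaussian E)) Filter.atTop :=
          lintegral_liminf_le fun K => measurable_signChanges v α β K
      _ ≤ ENNReal.ofReal (((β - α) * L + ε) / Real.pi) := by
          refine Filter.liminf_le_of_frequently_le' (Filter.Eventually.frequently ?_)
          filter_upwards [angleSum_upper h hv hn hL hε, Filter.eventually_gt_atTop 0] with K h1 h2
          rw [lintegral_signChanges h hn h2]
          gcongr
  have ht : Filter.Tendsto (fun ε : ℝ => ENNReal.ofReal (((β - α) * L + ε) / Real.pi))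
      (nhdsWithin 0 (Set.Ioi 0)) (nhds (ENNReal.ofReal (((β - α) * L + 0) / Real.pi))) := by
    refine Filter.Tendsto.mono_left ?_ nhdsWithin_le_nhds
    exact (ENNReal.continuous_ofReal.comp (by fun_prop)).tendsto 0
  rw [add_zero] at ht
  exact ge_of_tendsto ht (eventually_nhdsWithin_of_forall fun ε hε => hle ε hε)

end ArcLength

/-! ### The interpolation error -/

section Rolle

/-- Iterated Rolle theorem. -/
lemma exists_iteratedDeriv_eq_zero (p : ℕ) :
    ∀ (f : ℝ → ℝ) (_ : ContDiff ℝ (⊤ : ℕ∞) f) (z : ℕ → ℝ) (_ : ∀ i < p, z i < z (i + 1))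
      (_ : ∀ i ≤ p, f (z i) = 0), ∃ ξ ∈ Set.Icc (z 0) (z p), iteratedDeriv p f ξ = 0 := by
  induction p with
  | zero =>
    intro f _ z _ h0
    exact ⟨z 0, ⟨le_rfl, le_rfl⟩, by simpa using h0 0 le_rfl⟩
  | succ p ih =>
    intro f hf z hz h0
    have hex : ∀ i, ∃ ξ, i ≤ p → ξ ∈ Set.Ioo (z i) (z (i + 1)) ∧ deriv f ξ = 0 := by
      intro i
      by_cases hi : i ≤ p
      · obtain ⟨ξ, h1, h2⟩ := exists_deriv_eq_zero (f := f) (hz i (by omega))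
          hf.continuous.continuousOn (by rw [h0 i (by omega), h0 (i + 1) (by omega)])
        exact ⟨ξ, fun _ => ⟨h1, h2⟩⟩
      · exact ⟨0, fun h => absurd h hi⟩
    choose ξ hξ using hex
    have hf' : ContDiff ℝ (⊤ : ℕ∞) (deriv f) := ((contDiff_infty_iff_deriv).1 hf).2
    obtain ⟨η, h1, h2⟩ := ih (deriv f) hf' ξ
      (fun i hi => (hξ i (by omega)).1.2.trans (hξ (i + 1) (by omega)).1.1)
      (fun i hi => (hξ i hi).2)
    refine ⟨η, ⟨(hξ 0 (by omega)).1.1.le.trans h1.1, h1.2.trans (hξ p le_rfl).1.2.le⟩, ?_⟩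
    rw [iteratedDeriv_succ']
    exact h2

lemma exists_iteratedDeriv_eq_zero_of_finset {p : ℕ} {f : ℝ → ℝ} (hf : ContDiff ℝ (⊤ : ℕ∞) f)
    {Z : Finset ℝ} (hZ : Z.card = p + 1) {α β : ℝ} (hI : ∀ z ∈ Z, z ∈ Set.Icc α β)
    (h0 : ∀ z ∈ Z, f z = 0) : ∃ ξ ∈ Set.Icc α β, iteratedDeriv p f ξ = 0 := by
  set o := Z.orderEmbOfFin hZ
  set z : ℕ → ℝ := fun i => if h : i < p + 1 then o ⟨i, h⟩ else 0 with hz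
  have hmem : ∀ i ≤ p, z i ∈ Z := by
    intro i hi
    rw [hz]; dsimp only; rw [dif_pos (by omega)]
    exact Z.orderEmbOfFin_mem hZ _
  have hlt : ∀ i < p, z i < z (i + 1) := by
    intro i hi
    rw [hz]; dsimp only; rw [dif_pos (by omega), dif_pos (by omega)]
    exact o.strictMono (Fin.mk_lt_mk.2 (Nat.lt_succ_self i))
  obtain ⟨ξ, h1, h2⟩ := exists_iteratedDeriv_eq_zero p f hf z hlt (fun i hi => h0 _ (hmem i hi))
  exact ⟨ξ, ⟨(hI _ (hmem 0 (by omega))).1.trans h1.1, h1.2.trans (hI _ (hmem p le_rfl)).2⟩, h2⟩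

lemma iteratedDeriv_polynomial_eval (P : Polynomial ℝ) (p : ℕ) :
    iteratedDeriv p (fun x => P.eval x) = fun x => (Polynomial.derivative^[p] P).eval x := by
  induction p with
  | zero => simp
  | succ p ih =>
    rw [iteratedDeriv_succ, ih]
    ext x
    rw [Polynomial.deriv, Function.iterate_succ_apply']

lemma iterate_derivative_monic {P : Polynomial ℝ} (hP : P.Monic) :
    Polynomial.derivative^[P.natDegree] P = Polynomial.C (P.natDegree.factorial : ℝ) := by
  have h := Polynomial.natDegree_iterate_derivative P P.natDegree
  rw [Nat.sub_self, Nat.le_zero] at h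
  rw [Polynomial.eq_C_of_natDegree_eq_zero h, Polynomial.coeff_iterate_derivative]
  simp [Nat.descFactorial_self, hP.coeff_natDegree]

/-- A smooth function with `p` zeros in an interval is small there: this is the error bound for
interpolation by the zero polynomial. -/
lemma abs_le_of_zeros {p : ℕ} {f : ℝ → ℝ} (hf : ContDiff ℝ (⊤ : ℕ∞) f) {Z : Finset ℝ}
    (hZ : Z.card = p) {α β M x : ℝ} (hI : ∀ z ∈ Z, z ∈ Set.Icc α β) (h0 : ∀ z ∈ Z, f z = 0)
    (hM : ∀ ξ ∈ Set.Icc α β, |iteratedDeriv p f ξ| ≤ M) (hx : x ∈ Set.Icc α β) :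
    |f x| ≤ M * (β - α) ^ p / p.factorial := by
  have hM0 : 0 ≤ M := (abs_nonneg _).trans (hM x hx)
  have hαβ : 0 ≤ β - α := by linarith [hx.1, hx.2]
  by_cases hxZ : x ∈ Z
  · rw [h0 x hxZ, abs_zero]; positivity
  set P : Polynomial ℝ := ∏ z ∈ Z, (Polynomial.X - Polynomial.C z) with hP
  have hmonic : P.Monic := Polynomial.monic_prod_of_monic _ _ fun z _ => Polynomial.monic_X_sub_C z
  have hdeg : P.natDegree = p := by
    rw [hP, Polynomial.natDegree_prod_of_monic _ _ fun z _ => Polynomial.monic_X_sub_C z]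
    simp [hZ]
  have heval : ∀ y, P.eval y = ∏ z ∈ Z, (y - z) := by
    intro y; rw [hP, Polynomial.eval_prod]; simp
  have hPc : ContDiff ℝ (⊤ : ℕ∞) (fun y => P.eval y) := by
    simpa using P.contDiff_aeval (𝕜 := ℝ) (⊤ : ℕ∞)
  -- `F` vanishes at `x` and on `Z`, so that its `p`-th derivative vanishes somewhere
  set F : ℝ → ℝ := fun y => P.eval x * f y - f x * P.eval y with hF
  obtain ⟨ξ, hξ, hξ0⟩ := exists_iteratedDeriv_eq_zero_of_finset (f := F) (p := p)
    ((contDiff_const.mul hf).sub (contDiff_const.mul hPc)) (Z := insert x Z)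
    (by rw [Finset.card_insert_of_notMem hxZ, hZ]) (α := α) (β := β)
    (fun z hz => by
      rcases Finset.mem_insert.1 hz with rfl | hz
      exacts [hx, hI z hz])
    (fun z hz => by
      rcases Finset.mem_insert.1 hz with rfl | hz
      · rw [hF]; ring
      · have : P.eval z = 0 := by rw [heval]; exact Finset.prod_eq_zero hz (sub_self z)
        rw [hF]; dsimp only; rw [h0 z hz, this]; ring)
  have hle : ((p : ℕ) : WithTop ℕ∞) ≤ ((⊤ : ℕ∞) : WithTop ℕ∞) := by exact_mod_cast le_top
  have hD : iteratedDeriv p F ξ = P.eval x * iteratedDeriv p f ξ - f x * p.factorial := by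
    have e1 : F = (fun y => P.eval x * f y) - (fun y => f x * P.eval y) := rfl
    rw [e1, iteratedDeriv_sub (((contDiff_const.mul hf).of_le hle).contDiffAt)
      (((contDiff_const.mul hPc).of_le hle).contDiffAt),
      iteratedDeriv_const_mul_field, iteratedDeriv_const_mul_field, iteratedDeriv_polynomial_eval,
      ← hdeg, iterate_derivative_monic hmonic]
    simp
  rw [hD] at hξ0
  have hPx : |P.eval x| ≤ (β - α) ^ p := by
    rw [heval, Finset.abs_prod, ← hZ]
    refine (Finset.prod_le_prod (fun z _ => abs_nonneg _) (g := fun _ => β - α)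
      fun z hz => ?_).trans (by rw [Finset.prod_const])
    have := hI z hz
    rw [abs_le]; constructor <;> linarith [hx.1, hx.2, this.1, this.2]
  have hfac : (0 : ℝ) < p.factorial := by exact_mod_cast p.factorial_pos
  rw [le_div_iff₀ hfac]
  calc |f x| * p.factorial = |f x * p.factorial| := by rw [abs_mul, Nat.abs_cast]
    _ = |P.eval x * iteratedDeriv p f ξ| := by rw [sub_eq_zero.1 hξ0]
    _ = |iteratedDeriv p f ξ| * |P.eval x| := by rw [abs_mul, mul_comm]
    _ ≤ M * (β - α) ^ p := mul_le_mul (hM ξ hξ) hPx (abs_nonneg _) hM0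

end Rolle

/-! ### Cosine polynomials -/

section CosPoly

lemma contDiff_cosPoly (n : ℕ) (a : ℕ → ℝ) : ContDiff ℝ (⊤ : ℕ∞) (cosPoly n a) := by
  unfold cosPoly
  exact ContDiff.sum fun j _ => contDiff_const.mul
    (Real.contDiff_cos.comp (contDiff_const.mul contDiff_id))

lemma abs_iteratedDeriv_cosPoly_le (n : ℕ) (a : ℕ → ℝ) (p : ℕ) (x : ℝ) :
    |iteratedDeriv p (cosPoly n a) x| ≤ (∑ j ∈ Finset.range (n + 1), |a j|) * (n : ℝ) ^ p := by
  have hc : ∀ j : ℕ, ContDiff ℝ p (fun x : ℝ => a j * Real.cos (j * x)) := fun j =>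
    contDiff_const.mul (Real.contDiff_cos.comp (contDiff_const.mul contDiff_id))
  unfold cosPoly
  rw [iteratedDeriv_fun_sum fun j _ => (hc j).contDiffAt, Finset.sum_mul]
  refine (Finset.abs_sum_le_sum_abs _ _).trans (Finset.sum_le_sum fun j hj => ?_)
  rw [iteratedDeriv_const_mul_field, iteratedDeriv_comp_const_mul Real.contDiff_cos, abs_mul]
  dsimp only
  rw [abs_mul, abs_pow, Nat.abs_cast]
  have h1 : (j : ℝ) ^ p ≤ (n : ℝ) ^ p := by
    have : j ≤ n := Nat.lt_succ_iff.1 (Finset.mem_range.1 hj)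
    gcongr
  have h2 := Real.abs_iteratedDeriv_cos_le_one p (j * x)
  exact mul_le_mul_of_nonneg_left (by
    calc _ ≤ (n : ℝ) ^ p * 1 := mul_le_mul h1 h2 (abs_nonneg _) (by positivity)
      _ = _ := mul_one _) (abs_nonneg _)

/-- A cosine polynomial which does not vanish identically has at most `2n` zeros in `(0, 2π)`:
it is a polynomial of degree at most `n` in `cos x`. -/
lemma zeroCount_cosPoly_le {n : ℕ} {a : ℕ → ℝ} {x₀ : ℝ} (h : cosPoly n a x₀ ≠ 0) :
    zeroCount (cosPoly n a) (Set.Ioo 0 (2 * Real.pi)) ≤ 2 * n := by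
  classical
  set P : Polynomial ℝ := ∑ j ∈ Finset.range (n + 1),
    Polynomial.C (a j) * Polynomial.Chebyshev.T ℝ (j : ℤ) with hP
  have heval : ∀ x, P.eval (Real.cos x) = cosPoly n a x := by
    intro x
    rw [hP, Polynomial.eval_finsetSum]
    unfold cosPoly
    refine Finset.sum_congr rfl fun j _ => ?_
    rw [Polynomial.eval_mul, Polynomial.eval_C, Polynomial.Chebyshev.T_real_cos]
    simp
  have hP0 : P ≠ 0 := fun h0 => h (by rw [← heval, h0, Polynomial.eval_zero])
  have hdeg : P.natDegree ≤ n := by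
    refine Polynomial.natDegree_sum_le_of_forall_le _ _ fun j hj => ?_
    refine (Polynomial.natDegree_C_mul_le _ _).trans ?_
    rw [Polynomial.Chebyshev.natDegree_T]
    simpa using Nat.lt_succ_iff.1 (Finset.mem_range.1 hj)
  have hroots : P.roots.toFinset.card ≤ n :=
    (Multiset.toFinset_card_le _).trans ((Polynomial.card_roots' P).trans hdeg)
  refine zeroCount_le_of_finset fun Z hZ => ?_
  have hmaps : ∀ z ∈ Z, Real.cos z ∈ P.roots.toFinset := fun z hz => by
    rw [Multiset.mem_toFinset, Polynomial.mem_roots hP0, Polynomial.IsRoot, heval]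
    exact (hZ z hz).2
  have h1 : (Z.filter (· ≤ Real.pi)).card ≤ n := by
    refine le_trans (Finset.card_le_card_of_injOn Real.cos ?_ ?_) hroots
    · intro z hz
      exact hmaps z (Finset.mem_filter.1 (Finset.mem_coe.1 hz)).1
    · intro z hz z' hz' he
      obtain ⟨h1, h2⟩ := Finset.mem_filter.1 (Finset.mem_coe.1 hz)
      obtain ⟨h1', h2'⟩ := Finset.mem_filter.1 (Finset.mem_coe.1 hz')
      exact Real.injOn_cos ⟨(hZ z h1).1.1.le, h2⟩ ⟨(hZ z' h1').1.1.le, h2'⟩ he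
  have h2 : (Z.filter (¬ · ≤ Real.pi)).card ≤ n := by
    refine le_trans (Finset.card_le_card_of_injOn Real.cos ?_ ?_) hroots
    · intro z hz
      exact hmaps z (Finset.mem_filter.1 (Finset.mem_coe.1 hz)).1
    · intro z hz z' hz' he
      obtain ⟨h1, h2⟩ := Finset.mem_filter.1 (Finset.mem_coe.1 hz)
      obtain ⟨h1', h2'⟩ := Finset.mem_filter.1 (Finset.mem_coe.1 hz')
      have e1 := (hZ z h1).1.2
      have e2 := (hZ z' h1').1.2
      have := Real.injOn_cos (x₁ := 2 * Real.pi - z) (x₂ := 2 * Real.pi - z')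
        ⟨by linarith, by linarith⟩ ⟨by linarith, by linarith⟩
        (by rw [Real.cos_two_pi_sub, Real.cos_two_pi_sub]; exact he)
      linarith
  have h3 := Finset.card_filter_add_card_filter_not (s := Z) (· ≤ Real.pi)
  have h4 : Z.card ≤ 2 * n := by omega
  exact_mod_cast h4

end CosPoly

/-! ### Zeros in short intervals -/

section ShortInterval

open scoped RealInnerProductSpace

variable {E : Type*} [NormedAddCommGroup E] [InnerProductSpace ℝ E]

lemma inner_sum_cos_smul (n : ℕ) (c : ℕ → E) (x : ℝ) (g : E) :
    ⟪∑ j ∈ Finset.range (n + 1), Real.cos (j * x) • c j, g⟫ = cosPoly n (fun j => ⟪c j, g⟫) x := by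
  unfold cosPoly
  rw [sum_inner]
  refine Finset.sum_congr rfl fun j _ => ?_
  rw [inner_smul_left]; simp [mul_comm]

variable [FiniteDimensional ℝ E] [MeasurableSpace E] [BorelSpace E]

lemma stdGaussian_abs_inner_le {u : E} (hu : 1 ≤ ‖u‖) (η : ℝ) :
    stdGaussian E {g | |⟪u, g⟫| ≤ η} ≤ ENNReal.ofReal η := by
  have hpi := Real.pi_gt_three
  have hset : {g : E | |⟪u, g⟫| ≤ η} = (fun g => ⟪u, g⟫) ⁻¹' Set.Icc (-η) η := by
    ext; simp [abs_le]
  have hv : (‖u‖₊ ^ 2 : ℝ≥0) ≠ 0 := by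
    have : u ≠ 0 := norm_pos_iff.1 (by linarith)
    simpa using this
  rw [hset, ← Measure.map_apply (by fun_prop) measurableSet_Icc, stdGaussian_map_inner,
    gaussianReal_apply 0 hv]
  calc ∫⁻ x in Set.Icc (-η) η, gaussianPDF 0 (‖u‖₊ ^ 2) x
      ≤ ∫⁻ _ in Set.Icc (-η) η, ENNReal.ofReal (1 / 2) := by
        refine lintegral_mono fun x => ENNReal.ofReal_le_ofReal ?_
        unfold gaussianPDFReal
        have h1 : (2 : ℝ) ≤ Real.sqrt (2 * Real.pi * (‖u‖₊ ^ 2 : ℝ≥0)) := by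
          refine Real.le_sqrt_of_sq_le ?_
          push_cast
          nlinarith
        have h2 : Real.exp (-(x - 0) ^ 2 / (2 * ((‖u‖₊ ^ 2 : ℝ≥0) : ℝ))) ≤ 1 := by
          rw [Real.exp_le_one_iff]
          exact div_nonpos_of_nonpos_of_nonneg (by nlinarith [sq_nonneg (x - 0)]) (by positivity)
        calc _ ≤ (2 : ℝ)⁻¹ * 1 := mul_le_mul (inv_anti₀ (by norm_num) h1) h2 (Real.exp_pos _).le
              (by norm_num)
          _ = 1 / 2 := by norm_num
    _ = ENNReal.ofReal η := by
        rw [setLIntegral_const, Real.volume_Icc, ← ENNReal.ofReal_mul (by norm_num)]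
        congr 1; ring

lemma lintegral_abs_inner_le {c : E} (hc : ‖c‖ ≤ 1) :
    ∫⁻ g, ENNReal.ofReal |⟪c, g⟫| ∂(stdGaussian E) ≤ 1 := by
  have hL2 : MemLp (fun g : E => ⟪c, g⟫) 2 (stdGaussian E) := by
    have := (IsGaussian.memLp_two_id (μ := stdGaussian E))
    exact (innerSL ℝ c).comp_memLp' this
  have hsq : ∫ g, ⟪c, g⟫ ^ 2 ∂(stdGaussian E) = ‖c‖ ^ 2 := by
    have h1 := variance_dual_stdGaussian (innerSL ℝ c)
    have h2 := integral_strongDual_stdGaussian (innerSL ℝ c)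
    rw [variance_of_integral_eq_zero (by fun_prop) h2, innerSL_apply_norm] at h1
    simpa using h1
  have hint : Integrable (fun g : E => (1 + ⟪c, g⟫ ^ 2) / 2) (stdGaussian E) :=
    ((integrable_const 1).add hL2.integrable_sq).div_const 2
  calc ∫⁻ g, ENNReal.ofReal |⟪c, g⟫| ∂(stdGaussian E)
      ≤ ∫⁻ g, ENNReal.ofReal ((1 + ⟪c, g⟫ ^ 2) / 2) ∂(stdGaussian E) := by
        refine lintegral_mono fun g => ENNReal.ofReal_le_ofReal ?_
        nlinarith [sq_nonneg (|⟪c, g⟫| - 1), sq_abs ⟪c, g⟫]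
    _ = ENNReal.ofReal (∫ g, (1 + ⟪c, g⟫ ^ 2) / 2 ∂(stdGaussian E)) :=
        (ofReal_integral_eq_lintegral_ofReal hint (ae_of_all _ fun g => by positivity)).symm
    _ ≤ 1 := by
        rw [integral_div, integral_add (integrable_const 1) hL2.integrable_sq, hsq]
        simp only [integral_const, probReal_univ, smul_eq_mul, mul_one]
        rw [ENNReal.ofReal_le_one]
        nlinarith [norm_nonneg c]

/-- A bound for the expected number of zeros in a short interval `[α, β]`, which needs information
on the variance at a single point `x₀` only. If there are more than `p` zeros, then the polynomial
is tiny at `x₀` by `abs_le_of_zeros`; this is unlikely, and then the bound `2 n` for the number of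
zeros is good enough. -/
lemma lintegral_zeroCount_short {n : ℕ} {c : ℕ → E} (hc : ∀ j, ‖c j‖ ≤ 1) {α β x₀ : ℝ}
    (hx₀ : x₀ ∈ Set.Icc α β)
    (hvar : 1 ≤ ‖∑ j ∈ Finset.range (n + 1), Real.cos (j * x₀) • c j‖) {p : ℕ}
    (hp : Real.exp 2 * (n * (β - α)) ≤ p) :
    ∫⁻ g, zeroCount (cosPoly n (fun j => ⟪c j, g⟫)) (Set.Icc α β ∩ Set.Ioo 0 (2 * Real.pi))
      ∂(stdGaussian E) ≤ ENNReal.ofReal (p + 2 * n * ((n + 2) * Real.exp (-(p / 2)))) := by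
  set W := ∑ j ∈ Finset.range (n + 1), Real.cos (j * x₀) • c j with hW
  set V : E → ℝ → ℝ := fun g => cosPoly n (fun j => ⟪c j, g⟫) with hV
  have hWV : ∀ g, ⟪W, g⟫ = V g x₀ := fun g => inner_sum_cos_smul n c x₀ g
  set S : E → ℝ := fun g => ∑ j ∈ Finset.range (n + 1), |⟪c j, g⟫| with hS
  have hSm : Measurable S := by rw [hS]; fun_prop
  have hαβ : 0 ≤ β - α := by linarith [hx₀.1, hx₀.2]
  set B1 : Set E := {g | |⟪W, g⟫| ≤ Real.exp (-(p / 2))} with hB1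
  set B2 : Set E := {g | ENNReal.ofReal (Real.exp (p / 2)) ≤ ENNReal.ofReal (S g)} with hB2
  have hB1m : MeasurableSet B1 := measurableSet_le (by fun_prop) (by fun_prop)
  have hB2m : MeasurableSet B2 := measurableSet_le (by fun_prop) (by fun_prop)
  have hP1 : stdGaussian E B1 ≤ ENNReal.ofReal (Real.exp (-(p / 2))) :=
    stdGaussian_abs_inner_le hvar _
  have hP2 : stdGaussian E B2 ≤ ENNReal.ofReal ((n + 1) * Real.exp (-(p / 2))) := by
    have hmk := meas_ge_le_lintegral_div (μ := stdGaussian E)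
      (f := fun g => ENNReal.ofReal (S g)) (by fun_prop)
      (ε := ENNReal.ofReal (Real.exp (p / 2))) (by simp [Real.exp_pos]) ENNReal.ofReal_ne_top
    refine hmk.trans ?_
    have hint : ∫⁻ g, ENNReal.ofReal (S g) ∂(stdGaussian E) ≤ (n + 1 : ℕ) := by
      have e1 : ∀ g, ENNReal.ofReal (S g) =
          ∑ j ∈ Finset.range (n + 1), ENNReal.ofReal |⟪c j, g⟫| := fun g =>
        ENNReal.ofReal_sum_of_nonneg fun j _ => abs_nonneg _
      simp_rw [e1]
      rw [lintegral_finsetSum _ fun j _ => by fun_prop]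
      refine (Finset.sum_le_sum fun j _ => lintegral_abs_inner_le (hc j)).trans ?_
      simp
    refine (ENNReal.div_le_div_right hint _).trans (le_of_eq ?_)
    rw [← ENNReal.ofReal_natCast, ← ENNReal.ofReal_div_of_pos (Real.exp_pos _)]
    congr 1
    rw [Real.exp_neg]; push_cast; field_simp
  have hW0 : ∀ᵐ g ∂(stdGaussian E), V g x₀ ≠ 0 := by
    have hne : W ≠ 0 := norm_pos_iff.1 (by linarith)
    have := stdGaussian_inner_eq_zero hne
    rw [ae_iff]
    simpa [hWV] using this
  have hpt : ∀ᵐ g ∂(stdGaussian E),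
      zeroCount (V g) (Set.Icc α β ∩ Set.Ioo 0 (2 * Real.pi)) ≤
        p + (2 * n) * (B1 ∪ B2).indicator 1 g := by
    filter_upwards [hW0] with g hg
    by_cases hB : g ∈ B1 ∪ B2
    · rw [Set.indicator_of_mem hB]
      refine (zeroCount_mono Set.inter_subset_right).trans ((zeroCount_cosPoly_le hg).trans ?_)
      simp
    · rw [Set.indicator_of_notMem hB, mul_zero, add_zero]
      refine zeroCount_le_of_finset fun Z hZ => ?_
      by_contra hcon
      have hcard : p ≤ Z.card := by
        have : (p : ℝ≥0∞) < Z.card := not_le.1 hcon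
        exact le_of_lt (by exact_mod_cast this)
      obtain ⟨Z', hZ', hcard'⟩ := Finset.exists_subset_card_eq hcard
      have hbound := abs_le_of_zeros (contDiff_cosPoly n (fun j => ⟪c j, g⟫)) hcard'
        (fun z hz => (hZ z (hZ' hz)).1.1) (fun z hz => (hZ z (hZ' hz)).2)
        (fun ξ _ => abs_iteratedDeriv_cosPoly_le n _ p ξ) hx₀
      have hS0 : 0 ≤ S g := Finset.sum_nonneg fun j _ => abs_nonneg _
      have hfac : (0 : ℝ) < p.factorial := by exact_mod_cast p.factorial_pos
      -- `(n (β - α)) ^ p / p! ≤ (p e⁻²) ^ p / p! ≤ e⁻ᵖ`, because `p ^ p / p! ≤ eᵖ`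
      have hst : (n : ℝ) ^ p * (β - α) ^ p / p.factorial ≤ Real.exp (-p) := by
        have e1 : (n : ℝ) * (β - α) ≤ Real.exp (-2) * p := by
          rw [Real.exp_neg, inv_mul_eq_div, le_div_iff₀ (Real.exp_pos _)]; linarith
        have e2 : (p : ℝ) ^ p / p.factorial ≤ Real.exp p :=
          Real.pow_div_factorial_le_exp p (by positivity) p
        have e3 : Real.exp (-2) ^ p = Real.exp (-2 * p) := by
          rw [← Real.exp_nat_mul]; ring_nf
        calc (n : ℝ) ^ p * (β - α) ^ p / p.factorial
            = ((n : ℝ) * (β - α)) ^ p / p.factorial := by rw [mul_pow]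
          _ ≤ (Real.exp (-2) * p) ^ p / p.factorial := by gcongr
          _ = Real.exp (-2 * p) * ((p : ℝ) ^ p / p.factorial) := by rw [mul_pow, e3]; ring
          _ ≤ Real.exp (-2 * p) * Real.exp p := by gcongr
          _ = Real.exp (-p) := by rw [← Real.exp_add]; ring_nf
      have hSlt : S g < Real.exp (p / 2) := by
        by_contra h
        exact hB (Or.inr (ENNReal.ofReal_le_ofReal (not_lt.1 h)))
      refine hB (Or.inl ?_)
      change |⟪W, g⟫| ≤ _
      rw [hWV]
      calc |V g x₀| ≤ S g * (n : ℝ) ^ p * (β - α) ^ p / p.factorial := hbound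
        _ = S g * ((n : ℝ) ^ p * (β - α) ^ p / p.factorial) := by ring
        _ ≤ Real.exp (p / 2) * Real.exp (-p) := by gcongr
        _ = Real.exp (-(p / 2)) := by rw [← Real.exp_add]; ring_nf
  refine (lintegral_mono_ae hpt).trans ?_
  have hBm := hB1m.union hB2m
  rw [lintegral_add_left measurable_const, lintegral_const, measure_univ, mul_one,
    lintegral_const_mul _ (measurable_one.indicator hBm), lintegral_indicator_one hBm,
    ENNReal.ofReal_add (by positivity) (by positivity), ENNReal.ofReal_natCast,
    ENNReal.ofReal_mul (by positivity)]
  gcongr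
  · rw [ENNReal.ofReal_mul (by norm_num)]; simp
  · refine (measure_union_le _ _).trans ((add_le_add hP1 hP2).trans (le_of_eq ?_))
    rw [← ENNReal.ofReal_add (by positivity) (by positivity)]
    congr 1; ring

end ShortInterval

/-! ### Abel summation -/

section Abel

/-- Abel summation against a monotone weight. -/
lemma abs_sum_mul_sub_le {w s : ℕ → ℝ} (hw : Monotone w) (h0 : ∀ i, 0 ≤ w i)
    (hs : ∀ i, |s i| ≤ 1) (m : ℕ) :
    |∑ i ∈ Finset.range m, w i * (s (i + 1) - s i) - w m * s m| ≤ w m := by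
  induction m with
  | zero =>
    simp only [Finset.range_zero, Finset.sum_empty, zero_sub, abs_neg, abs_mul,
      abs_of_nonneg (h0 0)]
    exact mul_le_of_le_one_right (h0 0) (hs 0)
  | succ m ih =>
    have e : ∑ i ∈ Finset.range (m + 1), w i * (s (i + 1) - s i) - w (m + 1) * s (m + 1) =
        (∑ i ∈ Finset.range m, w i * (s (i + 1) - s i) - w m * s m) -
          (w (m + 1) - w m) * s (m + 1) := by
      rw [Finset.sum_range_succ]; ring
    have h1 : |(w (m + 1) - w m) * s (m + 1)| ≤ w (m + 1) - w m := by
      have hm : 0 ≤ w (m + 1) - w m := sub_nonneg.2 (hw (Nat.le_succ m))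
      rw [abs_mul, abs_of_nonneg hm]
      exact mul_le_of_le_one_right hm (hs _)
    rw [e]
    calc _ ≤ _ := abs_sub _ _
      _ ≤ w (m + 1) := by linarith

/-- Abel summation for `2 sin θ cos (2 θ i + ψ) = sin (2 θ i + ψ + θ) - sin (2 θ i + ψ - θ)`. -/
lemma abs_sin_mul_sum_cos_le {w : ℕ → ℝ} (hw : Monotone w) (h0 : ∀ i, 0 ≤ w i) (θ ψ : ℝ) (m : ℕ) :
    |Real.sin θ| * |∑ i ∈ Finset.range m, w i * Real.cos (2 * θ * i + ψ)| ≤ w m := by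
  set s : ℕ → ℝ := fun i => Real.sin (2 * θ * i + ψ - θ) with hsdef
  have hs : ∀ i, |s i| ≤ 1 := fun i => Real.abs_sin_le_one _
  have h1 := abs_sum_mul_sub_le hw h0 hs m
  have e : ∑ i ∈ Finset.range m, w i * (s (i + 1) - s i) =
      2 * (Real.sin θ * ∑ i ∈ Finset.range m, w i * Real.cos (2 * θ * i + ψ)) := by
    rw [Finset.mul_sum, Finset.mul_sum]
    refine Finset.sum_congr rfl fun i _ => ?_
    have e1 : 2 * θ * ((i + 1 : ℕ) : ℝ) + ψ - θ = (2 * θ * i + ψ) + θ := by push_cast; ring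
    rw [hsdef]; dsimp only
    rw [e1, Real.sin_add, Real.sin_sub]; ring
  have h2 : |w m * s m| ≤ w m := by
    rw [abs_mul, abs_of_nonneg (h0 m)]
    exact mul_le_of_le_one_right (h0 m) (hs m)
  rw [e] at h1
  rw [← abs_mul]
  rw [abs_le] at h1 h2 ⊢
  constructor <;> linarith [h1.1, h1.2, h2.1, h2.2]

end Abel

/-! ### Sums over frequencies -/

section Frequencies

/-- The frequencies of the cosine polynomial after the factor `2 cos (ℓ x / 2)` has been taken out
of each pair of equal blocks. -/
noncomputable def freq (ℓ k a : ℕ) : ℝ := 2 * ℓ * a + k + ℓ / 2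

lemma freq_nonneg (ℓ k a : ℕ) : 0 ≤ freq ℓ k a := by unfold freq; positivity

lemma freq_mono (ℓ k : ℕ) : Monotone (freq ℓ k) := by
  intro a b hab
  unfold freq
  have : (a : ℝ) ≤ b := by exact_mod_cast hab
  gcongr

variable {ℓ m R n : ℕ} {t x : ℝ}

lemma abs_sum_freq_trig_le (ht : 0 < t) (hx : 1 ≤ t * |Real.sin (2 * ℓ * x)|) (k p : ℕ) :
    |∑ a ∈ Finset.range m, freq ℓ k a ^ p * Real.cos (2 * (freq ℓ k a * x))| ≤
        t * freq ℓ k m ^ p ∧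
    |∑ a ∈ Finset.range m, freq ℓ k a ^ p * Real.sin (2 * (freq ℓ k a * x))| ≤
        t * freq ℓ k m ^ p := by
  have hmono : Monotone (fun a => freq ℓ k a ^ p) := fun a b hab =>
    pow_le_pow_left₀ (freq_nonneg _ _ _) (freq_mono ℓ k hab) p
  have h0 : ∀ a, 0 ≤ freq ℓ k a ^ p := fun a => pow_nonneg (freq_nonneg _ _ _) p
  have key : ∀ S : ℝ, |Real.sin (2 * ℓ * x)| * |S| ≤ freq ℓ k m ^ p →
      |S| ≤ t * freq ℓ k m ^ p := by
    intro S hS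
    calc |S| ≤ (t * |Real.sin (2 * ℓ * x)|) * |S| := le_mul_of_one_le_left (abs_nonneg _) hx
      _ = t * (|Real.sin (2 * ℓ * x)| * |S|) := by ring
      _ ≤ t * freq ℓ k m ^ p := by gcongr
  constructor
  · refine key _ ?_
    convert abs_sin_mul_sum_cos_le hmono h0 (2 * ℓ * x) ((2 * k + ℓ) * x) m using 7
    unfold freq; ring
  · refine key _ ?_
    convert abs_sin_mul_sum_cos_le hmono h0 (2 * ℓ * x) ((2 * k + ℓ) * x - Real.pi / 2) m using 5
    rw [← Real.cos_sub_pi_div_two]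
    congr 1
    unfold freq; ring

lemma freq_le (hℓ : 1 ≤ ℓ) (hn : n + 1 = 2 * ℓ * m + R) (hn1 : 1 ≤ n) {k : ℕ} (hk : k < ℓ) :
    freq ℓ k m ≤ 4 * ℓ * n := by
  unfold freq
  have h1 : (2 * ℓ * m : ℝ) ≤ n + 1 := by
    have : 2 * ℓ * m ≤ n + 1 := by omega
    exact_mod_cast this
  have h2 : (k : ℝ) + 1 ≤ ℓ := by exact_mod_cast hk
  have h3 : (1 : ℝ) ≤ n := by exact_mod_cast hn1
  have h4 : (1 : ℝ) ≤ ℓ := by exact_mod_cast hℓ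
  nlinarith [mul_nonneg (sub_nonneg.2 h3) (sub_nonneg.2 h4)]

/-- Double sums of `ν ^ p cos (2 ν x)` and `ν ^ p sin (2 ν x)` over all frequencies are of lower
order than the corresponding sums of `ν ^ p`. -/
lemma abs_sum_sum_freq_trig_le (hℓ : 1 ≤ ℓ) (hn : n + 1 = 2 * ℓ * m + R) (hn1 : 1 ≤ n) (ht : 0 < t)
    (hx : 1 ≤ t * |Real.sin (2 * ℓ * x)|) (p : ℕ) :
    |∑ k ∈ Finset.range ℓ, ∑ a ∈ Finset.range m,
        freq ℓ k a ^ p * Real.cos (2 * (freq ℓ k a * x))| ≤ ℓ * (t * (4 * ℓ * n) ^ p) ∧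
    |∑ k ∈ Finset.range ℓ, ∑ a ∈ Finset.range m,
        freq ℓ k a ^ p * Real.sin (2 * (freq ℓ k a * x))| ≤ ℓ * (t * (4 * ℓ * n) ^ p) := by
  have hb : ∀ k ∈ Finset.range ℓ, t * freq ℓ k m ^ p ≤ t * (4 * ℓ * n) ^ p := fun k hk => by
    have := freq_le hℓ hn hn1 (Finset.mem_range.1 hk)
    have h0 := freq_nonneg ℓ k m
    gcongr
  have hcard : ∑ k ∈ Finset.range ℓ, t * (4 * ℓ * n : ℝ) ^ p = ℓ * (t * (4 * ℓ * n) ^ p) := by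
    rw [Finset.sum_const, Finset.card_range, nsmul_eq_mul]
  constructor
  · refine (Finset.abs_sum_le_sum_abs _ _).trans ?_
    rw [← hcard]
    exact Finset.sum_le_sum fun k hk => (abs_sum_freq_trig_le ht hx k p).1.trans (hb k hk)
  · refine (Finset.abs_sum_le_sum_abs _ _).trans ?_
    rw [← hcard]
    exact Finset.sum_le_sum fun k hk => (abs_sum_freq_trig_le ht hx k p).2.trans (hb k hk)

lemma sum_range_sq_real (m : ℕ) :
    ∑ a ∈ Finset.range m, (a : ℝ) ^ 2 = m ^ 3 / 3 - m ^ 2 / 2 + m / 6 := by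
  induction m with
  | zero => simp
  | succ m ih => rw [Finset.sum_range_succ, ih]; push_cast; ring

lemma abs_sum_freq_sq_sub_le (hn : n + 1 = 2 * ℓ * m + R) (hR : R < 2 * ℓ) (hn1 : 1 ≤ n) :
    |(∑ k ∈ Finset.range ℓ, ∑ a ∈ Finset.range m, freq ℓ k a ^ 2) / 2 - (n : ℝ) ^ 3 / 12| ≤
      4 * ℓ * (n : ℝ) ^ 2 := by
  have hℓ : 1 ≤ ℓ := by omega
  have hℓ' : (1 : ℝ) ≤ ℓ := by exact_mod_cast hℓ
  have hn' : (1 : ℝ) ≤ n := by exact_mod_cast hn1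
  set S := ∑ k ∈ Finset.range ℓ, ∑ a ∈ Finset.range m, freq ℓ k a ^ 2 with hS
  have hlow : ℓ * (4 * ℓ ^ 2 * ((m : ℝ) ^ 3 / 3 - m ^ 2 / 2 + m / 6)) ≤ S := by
    have : ∀ k ∈ Finset.range ℓ, 4 * (ℓ : ℝ) ^ 2 * ((m : ℝ) ^ 3 / 3 - m ^ 2 / 2 + m / 6) ≤
        ∑ a ∈ Finset.range m, freq ℓ k a ^ 2 := by
      intro k _
      rw [← sum_range_sq_real, Finset.mul_sum]
      refine Finset.sum_le_sum fun a _ => ?_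
      calc 4 * (ℓ : ℝ) ^ 2 * (a : ℝ) ^ 2 = (2 * ℓ * a) ^ 2 := by ring
        _ ≤ freq ℓ k a ^ 2 := by
          refine pow_le_pow_left₀ (by positivity) ?_ 2
          unfold freq
          have : (0 : ℝ) ≤ k + ℓ / 2 := by positivity
          linarith
    have h := Finset.sum_le_sum this
    rwa [Finset.sum_const, Finset.card_range, nsmul_eq_mul] at h
  have hupp : S ≤ ℓ * (4 * ℓ ^ 2 * ((m : ℝ) ^ 3 / 3 + m ^ 2 / 2 + m / 6)) := by
    have e : ∑ a ∈ Finset.range m, ((a : ℝ) + 1) ^ 2 = (m : ℝ) ^ 3 / 3 + m ^ 2 / 2 + m / 6 := by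
      have h1 := sum_range_sq_real (m + 1)
      rw [Finset.sum_range_succ'] at h1
      push_cast at h1
      simp only [ne_eq, OfNat.ofNat_ne_zero, not_false_eq_true, zero_pow, add_zero] at h1
      rw [h1]; ring
    have : ∀ k ∈ Finset.range ℓ, ∑ a ∈ Finset.range m, freq ℓ k a ^ 2 ≤
        4 * (ℓ : ℝ) ^ 2 * ((m : ℝ) ^ 3 / 3 + m ^ 2 / 2 + m / 6) := by
      intro k hk
      have hk' : (k : ℝ) ≤ ℓ := by exact_mod_cast (Finset.mem_range.1 hk).le
      rw [← e, Finset.mul_sum]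
      refine Finset.sum_le_sum fun a _ => ?_
      calc freq ℓ k a ^ 2 ≤ (2 * ℓ * (a + 1)) ^ 2 := by
            refine pow_le_pow_left₀ (freq_nonneg _ _ _) ?_ 2
            unfold freq
            linarith
        _ = 4 * (ℓ : ℝ) ^ 2 * ((a : ℝ) + 1) ^ 2 := by ring
    have h := Finset.sum_le_sum this
    rwa [Finset.sum_const, Finset.card_range, nsmul_eq_mul] at h
  set N : ℝ := 2 * ℓ * m with hN
  have hNn : (n : ℝ) + 1 = N + R := by rw [hN]; exact_mod_cast hn
  have hR0 : (0 : ℝ) ≤ R := by positivity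
  have hR1 : (R : ℝ) + 1 ≤ 2 * ℓ := by exact_mod_cast hR
  have hN0 : 0 ≤ N := by positivity
  have hN2 : N ≤ 2 * n := by linarith
  have hmm : (m : ℝ) ≤ m ^ 2 := by
    rcases Nat.eq_zero_or_pos m with rfl | h
    · simp
    · have : (1 : ℝ) ≤ m := by exact_mod_cast h
      nlinarith
  have hmid : |S / 2 - N ^ 3 / 12| ≤ ℓ * N ^ 2 / 2 := by
    have hl3 : 0 ≤ (ℓ : ℝ) ^ 3 := by positivity
    have h1 : (ℓ : ℝ) ^ 3 * m ≤ ℓ ^ 3 * m ^ 2 := by gcongr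
    have h2 : (0 : ℝ) ≤ ℓ ^ 3 * m := by positivity
    have e1 : N ^ 3 = 8 * (ℓ ^ 3 * (m : ℝ) ^ 3) := by rw [hN]; ring
    have e2 : ℓ * N ^ 2 = 4 * (ℓ ^ 3 * (m : ℝ) ^ 2) := by rw [hN]; ring
    rw [e1, e2, abs_le]
    constructor <;> nlinarith
  have hcube : |N ^ 3 / 12 - (n : ℝ) ^ 3 / 12| ≤ 2 * ℓ * (n : ℝ) ^ 2 := by
    have e : N ^ 3 / 12 - (n : ℝ) ^ 3 / 12 = (N - n) * ((N ^ 2 + N * n + n ^ 2) / 12) := by ring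
    have h1 : |N - n| ≤ 2 * ℓ := by rw [abs_le]; constructor <;> linarith
    have h2 : |(N ^ 2 + N * n + (n : ℝ) ^ 2) / 12| ≤ (n : ℝ) ^ 2 := by
      rw [abs_of_nonneg (by positivity)]
      nlinarith
    rw [e, abs_mul]
    exact mul_le_mul h1 h2 (abs_nonneg _) (by positivity)
  have hN4 : N ^ 2 ≤ 4 * (n : ℝ) ^ 2 := by nlinarith
  have h5 : (ℓ : ℝ) * N ^ 2 ≤ ℓ * (4 * (n : ℝ) ^ 2) := by gcongr
  calc _ = |(S / 2 - N ^ 3 / 12) + (N ^ 3 / 12 - (n : ℝ) ^ 3 / 12)| := by ring_nf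
    _ ≤ _ := abs_add_le _ _
    _ ≤ 4 * ℓ * (n : ℝ) ^ 2 := by linarith

end Frequencies

/-! ### Radial projection of a curve -/

section Normalize

open scoped RealInnerProductSpace

variable {E : Type*} [NormedAddCommGroup E] [InnerProductSpace ℝ E]

/-- The radial projection of a curve to the unit sphere. -/
noncomputable def unitCurve (w : ℝ → E) (x : ℝ) : E := ‖w x‖⁻¹ • w x

/-- The velocity of the radial projection of the curve `w` with velocity `w'`. -/
noncomputable def unitCurveDeriv (w w' : ℝ → E) (x : ℝ) : E :=
  ‖w x‖⁻¹ • w' x + (-(⟪w x, w' x⟫ / ‖w x‖) / ‖w x‖ ^ 2) • w x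

lemma norm_unitCurve {w : ℝ → E} {x : ℝ} (h : w x ≠ 0) : ‖unitCurve w x‖ = 1 :=
  norm_smul_inv_norm h

lemma hasDerivAt_unitCurve {w w' : ℝ → E} {x : ℝ} (hw : HasDerivAt w (w' x) x) (h : w x ≠ 0) :
    HasDerivAt (unitCurve w) (unitCurveDeriv w w' x) x := by
  have hpos := norm_pos_iff.2 h
  have h1 : HasDerivAt (fun x => ‖w x‖) (⟪w x, w' x⟫ / ‖w x‖) x := by
    have h2 := hw.norm_sq.sqrt (by positivity)
    simp only [Real.sqrt_sq (norm_nonneg _)] at h2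
    convert h2 using 1
    field_simp
  exact (h1.inv hpos.ne').smul hw

lemma continuousOn_unitCurveDeriv {w w' : ℝ → E} {s : Set ℝ} (hw : ContinuousOn w s)
    (hw' : ContinuousOn w' s) (h : ∀ x ∈ s, w x ≠ 0) : ContinuousOn (unitCurveDeriv w w') s := by
  have hn : ∀ x ∈ s, ‖w x‖ ≠ 0 := fun x hx => norm_ne_zero_iff.2 (h x hx)
  have hi : ContinuousOn (fun x => ⟪w x, w' x⟫) s := ContinuousOn.inner (𝕜 := ℝ) hw hw'
  exact ((hw.norm.inv₀ hn).smul hw').add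
    (((hi.div hw.norm hn).neg.div (hw.norm.pow 2) (fun x hx => pow_ne_zero 2 (hn x hx))).smul hw)

/-- The spherical speed of a curve differs from `‖w'‖ / ‖w‖` by at most the radial component of the
velocity. -/
lemma abs_norm_unitCurveDeriv_sub_le {w w' : ℝ → E} {x : ℝ} (h : w x ≠ 0) :
    |‖unitCurveDeriv w w' x‖ - ‖w' x‖ / ‖w x‖| ≤ |⟪w x, w' x⟫| / ‖w x‖ ^ 2 := by
  have hpos := norm_pos_iff.2 h
  have e1 : ‖w' x‖ / ‖w x‖ = ‖‖w x‖⁻¹ • w' x‖ := by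
    rw [norm_smul, norm_inv, norm_norm]; field_simp
  rw [e1]
  refine (abs_norm_sub_norm_le _ _).trans (le_of_eq ?_)
  rw [unitCurveDeriv, add_sub_cancel_left, norm_smul, Real.norm_eq_abs, abs_div, abs_neg, abs_div,
    abs_of_pos hpos, abs_of_pos (pow_pos hpos 2)]
  field_simp

end Normalize

/-! ### The coordinate curve -/

section Curve

open scoped RealInnerProductSpace

/-- Index set for the independent coefficients: `Sum.inl (a, k)` stands for the common value of the
coefficients with indices `2 ℓ a + k` and `2 ℓ a + ℓ + k`, and `Sum.inr s` for the remaining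
coefficient with index `2 ℓ m + s`. -/
abbrev CoeffIndex (ℓ m R : ℕ) : Type := (Fin m × Fin ℓ) ⊕ Fin R

lemma sum_coeffIndex {ℓ m R : ℕ} (F : CoeffIndex ℓ m R → ℝ) (G : ℕ → ℕ → ℝ)
    (h : ∀ (a : Fin m) (k : Fin ℓ), F (Sum.inl (a, k)) = G k a) :
    ∑ i, F i = ∑ k ∈ Finset.range ℓ, ∑ a ∈ Finset.range m, G k a + ∑ s, F (Sum.inr s) := by
  rw [Fintype.sum_sum_type, Fintype.sum_prod_type_right, Finset.sum_range]
  congr 1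
  refine Finset.sum_congr rfl fun k _ => ?_
  rw [Finset.sum_range]
  exact Finset.sum_congr rfl fun a _ => h a k

/-- The coordinates of the cosine polynomial with respect to the independent coefficients, divided
by the common factor `2 cos (ℓ x / 2)` of the paired blocks. -/
noncomputable def reducedCurve (ℓ m R : ℕ) (x : ℝ) : EuclideanSpace ℝ (CoeffIndex ℓ m R) :=
  WithLp.toLp 2 (Sum.elim (fun p => Real.cos (freq ℓ p.2 p.1 * x))
    (fun s => Real.cos ((2 * ℓ * m + s) * x) / (2 * Real.cos (ℓ * x / 2))))

/-- The derivative of `reducedCurve`. -/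
noncomputable def reducedCurveDeriv (ℓ m R : ℕ) (x : ℝ) : EuclideanSpace ℝ (CoeffIndex ℓ m R) :=
  WithLp.toLp 2 (Sum.elim (fun p => -(freq ℓ p.2 p.1 * Real.sin (freq ℓ p.2 p.1 * x)))
    (fun s => (-((2 * ℓ * m + s) * Real.sin ((2 * ℓ * m + s) * x)) * (2 * Real.cos (ℓ * x / 2)) +
      Real.cos ((2 * ℓ * m + s) * x) * (ℓ * Real.sin (ℓ * x / 2))) /
        (2 * Real.cos (ℓ * x / 2)) ^ 2))

variable {ℓ m R n : ℕ} {t x : ℝ}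

lemma hasDerivAt_reducedCurve (h : Real.cos (ℓ * x / 2) ≠ 0) :
    HasDerivAt (reducedCurve ℓ m R) (reducedCurveDeriv ℓ m R x) x := by
  have hcos : ∀ c : ℝ, HasDerivAt (fun x => Real.cos (c * x)) (-(c * Real.sin (c * x))) x := by
    intro c
    have h1 : HasDerivAt (fun x : ℝ => c * x) c x := by
      simpa using (hasDerivAt_id' x).const_mul c
    exact h1.cos.congr_deriv (by ring)
  have hden : HasDerivAt (fun x => 2 * Real.cos (ℓ * x / 2)) (-(ℓ * Real.sin (ℓ * x / 2))) x := by
    have h1 : HasDerivAt (fun x : ℝ => ℓ * x / 2) (ℓ / 2 : ℝ) x := by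
      simpa using ((hasDerivAt_id' x).const_mul (ℓ : ℝ)).div_const 2
    exact (h1.cos.const_mul 2).congr_deriv (by ring)
  have hcoord : ∀ i : CoeffIndex ℓ m R, HasDerivAt (fun y => reducedCurve ℓ m R y i)
      (reducedCurveDeriv ℓ m R x i) x := by
    rintro (p | s)
    · exact hcos (freq ℓ p.2 p.1)
    · refine HasDerivAt.congr_deriv (f' := (-((2 * ℓ * m + s) * Real.sin ((2 * ℓ * m + s) * x)) *
        (2 * Real.cos (ℓ * x / 2)) - Real.cos ((2 * ℓ * m + s) * x) *
          -(ℓ * Real.sin (ℓ * x / 2))) / (2 * Real.cos (ℓ * x / 2)) ^ 2)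
        ((hcos (2 * ℓ * m + s)).div hden (mul_ne_zero two_ne_zero h)) ?_
      rw [mul_neg, sub_neg_eq_add]
      rfl
  exact (PiLp.continuousLinearEquiv 2 ℝ
    (fun _ : CoeffIndex ℓ m R => ℝ)).symm.hasFDerivAt.comp_hasDerivAt x (hasDerivAt_pi.2 hcoord)

lemma continuousOn_reducedCurveDeriv {S : Set ℝ} (h : ∀ x ∈ S, Real.cos (ℓ * x / 2) ≠ 0) :
    ContinuousOn (reducedCurveDeriv ℓ m R) S := by
  refine (PiLp.continuous_toLp 2 _).comp_continuousOn (continuousOn_pi.2 ?_)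
  rintro (p | s)
  · simp only [Sum.elim_inl]
    exact Continuous.continuousOn (by fun_prop)
  · simp only [Sum.elim_inr]
    refine ContinuousOn.div (Continuous.continuousOn (by fun_prop))
      (Continuous.continuousOn (by fun_prop)) fun x hx => ?_
    exact pow_ne_zero 2 (mul_ne_zero two_ne_zero (h x hx))

lemma abs_cos_half_ge (ht : 0 < t) (hx : 1 ≤ t * |Real.sin (2 * ℓ * x)|) :
    1 ≤ 4 * t * |Real.cos (ℓ * x / 2)| := by
  have e : Real.sin (2 * ℓ * x) =
      4 * Real.sin (ℓ * x / 2) * Real.cos (ℓ * x) * Real.cos (ℓ * x / 2) := by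
    have h1 : (2 * ℓ * x : ℝ) = 2 * (ℓ * x) := by ring
    have h2 : (ℓ * x : ℝ) = 2 * (ℓ * x / 2) := by ring
    have h3 : Real.sin (ℓ * x) = 2 * Real.sin (ℓ * x / 2) * Real.cos (ℓ * x / 2) := by
      conv_lhs => rw [h2]
      exact Real.sin_two_mul _
    rw [h1, Real.sin_two_mul, h3]; ring
  have h4 : |Real.sin (2 * ℓ * x)| ≤ 4 * |Real.cos (ℓ * x / 2)| := by
    rw [e, abs_mul, abs_mul, abs_mul, abs_of_pos (by norm_num : (0:ℝ) < 4)]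
    have a1 := Real.abs_sin_le_one (ℓ * x / 2)
    have a2 := Real.abs_cos_le_one (ℓ * x)
    have a3 : |Real.sin (ℓ * x / 2)| * |Real.cos (ℓ * x)| ≤ 1 :=
      mul_le_one₀ a1 (abs_nonneg _) a2
    have a4 := mul_le_mul_of_nonneg_right a3 (abs_nonneg (Real.cos (ℓ * x / 2)))
    linarith
  nlinarith

lemma abs_sum_fin_le {f : Fin R → ℝ} {M : ℝ} (hR : R < 2 * ℓ) (h : ∀ s, |f s| ≤ M) (hM : 0 ≤ M) :
    |∑ s, f s| ≤ 2 * ℓ * M := by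
  calc |∑ s, f s| ≤ ∑ s, |f s| := Finset.abs_sum_le_sum_abs _ _
    _ ≤ ∑ _s : Fin R, M := Finset.sum_le_sum fun s _ => h s
    _ = R * M := by simp
    _ ≤ 2 * ℓ * M := by
      have : (R : ℝ) ≤ 2 * ℓ := by exact_mod_cast hR.le
      gcongr

lemma reducedCurve_inr_le (ht : 0 < t) (hx : 1 ≤ t * |Real.sin (2 * ℓ * x)|) (s : Fin R) :
    |reducedCurve ℓ m R x (Sum.inr s)| ≤ 2 * t := by
  have hc := abs_cos_half_ge ht hx
  have hcpos : 0 < |Real.cos (ℓ * x / 2)| := by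
    by_contra h
    have : |Real.cos (ℓ * x / 2)| = 0 := le_antisymm (not_lt.1 h) (abs_nonneg _)
    rw [this] at hc; linarith
  change |Real.cos ((2 * ℓ * m + s) * x) / (2 * Real.cos (ℓ * x / 2))| ≤ _
  rw [abs_div, abs_mul, abs_two, div_le_iff₀ (by positivity)]
  linarith [Real.abs_cos_le_one ((2 * ℓ * m + s) * x)]

lemma reducedCurveDeriv_inr_le (hℓ : 1 ≤ ℓ) (hn : n + 1 = 2 * ℓ * m + R) (ht : 1 ≤ t)
    (htn : t ≤ n) (hx : 1 ≤ t * |Real.sin (2 * ℓ * x)|) (s : Fin R) :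
    |reducedCurveDeriv ℓ m R x (Sum.inr s)| ≤ 6 * ℓ * (n * t) := by
  have ht0 : 0 < t := by linarith
  have hc := abs_cos_half_ge ht0 hx
  have hℓ' : (1 : ℝ) ≤ ℓ := by exact_mod_cast hℓ
  have hcpos : 0 < |Real.cos (ℓ * x / 2)| := by
    by_contra h
    have : |Real.cos (ℓ * x / 2)| = 0 := le_antisymm (not_lt.1 h) (abs_nonneg _)
    rw [this] at hc; linarith
  set c := Real.cos (ℓ * x / 2) with hcdef
  set q : ℝ := 2 * ℓ * m + s with hq
  have hq0 : 0 ≤ q := by positivity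
  have hqn : q ≤ n := by
    have : 2 * ℓ * m + (s : ℕ) ≤ n := by omega
    rw [hq]; exact_mod_cast this
  change |(-(q * Real.sin (q * x)) * (2 * c) + Real.cos (q * x) * (ℓ * Real.sin (ℓ * x / 2))) /
    (2 * c) ^ 2| ≤ _
  have hcc : (2 * c) ^ 2 = (2 * |c|) ^ 2 := by rw [mul_pow, mul_pow, sq_abs]
  rw [abs_div, abs_of_nonneg (sq_nonneg (2 * c)), hcc, div_le_iff₀ (by positivity)]
  have b1 : |-(q * Real.sin (q * x)) * (2 * c)| ≤ n * (2 * |c|) := by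
    rw [abs_mul, abs_neg, abs_mul, abs_of_nonneg hq0, abs_mul, abs_two]
    have : q * |Real.sin (q * x)| ≤ n * 1 :=
      mul_le_mul hqn (Real.abs_sin_le_one _) (abs_nonneg _) (by positivity)
    rw [mul_one] at this
    gcongr
  have b2 : |Real.cos (q * x) * (ℓ * Real.sin (ℓ * x / 2))| ≤ ℓ := by
    rw [abs_mul, abs_mul, Nat.abs_cast]
    have h1 : (ℓ : ℝ) * |Real.sin (ℓ * x / 2)| ≤ ℓ :=
      mul_le_of_le_one_right (by positivity) (Real.abs_sin_le_one _)
    calc _ ≤ 1 * (ℓ : ℝ) := mul_le_mul (Real.abs_cos_le_one _) h1 (by positivity) one_pos.le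
      _ = ℓ := one_mul _
  -- with `y = 2 t (2 |c|) ≥ 1` the two terms are at most `n y t` and `ℓ y² t²` up to constants
  set y := 2 * |c| with hy
  have hy1 : 1 ≤ 2 * t * y := by rw [hy]; linarith
  have hy0 : 0 < y := by positivity
  have c1 : n * y ≤ 2 * (n * t) * y ^ 2 := by
    have : n * y * 1 ≤ n * y * (2 * t * y) := mul_le_mul_of_nonneg_left hy1 (by positivity)
    nlinarith
  have c2 : (ℓ : ℝ) ≤ 4 * ℓ * (n * t) * y ^ 2 := by
    have h1 : 1 ≤ (2 * t * y) ^ 2 := one_le_pow₀ hy1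
    have h2 : t * t ≤ n * t := by gcongr
    have h3 : (2 * t * y) ^ 2 ≤ 4 * (n * t) * y ^ 2 := by
      calc (2 * t * y) ^ 2 = 4 * (t * t) * y ^ 2 := by ring
        _ ≤ 4 * (n * t) * y ^ 2 := by gcongr
    calc (ℓ : ℝ) ≤ ℓ * (4 * (n * t) * y ^ 2) := le_mul_of_one_le_right (by positivity) (h1.trans h3)
      _ = _ := by ring
  have c3 : 2 * ((n : ℝ) * t) * y ^ 2 ≤ ℓ * (2 * (n * t) * y ^ 2) :=
    le_mul_of_one_le_left (by positivity) hℓ'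
  calc _ ≤ _ := abs_add_le _ _
    _ ≤ n * y + ℓ := add_le_add b1 b2
    _ ≤ 6 * ℓ * (n * t) * y ^ 2 := by linarith

/-- There are about `n / 2` paired coordinates, and the mean value of each `cos²` is `1 / 2`. -/
lemma abs_norm_sq_reducedCurve_sub_le (hn : n + 1 = 2 * ℓ * m + R) (hR : R < 2 * ℓ) (ht : 1 ≤ t)
    (htn : t ≤ n) (hx : 1 ≤ t * |Real.sin (2 * ℓ * x)|) :
    |‖reducedCurve ℓ m R x‖ ^ 2 - n / 4| ≤ 10 * ℓ * t ^ 2 := by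
  have hℓ : 1 ≤ ℓ := by omega
  have hℓ' : (1 : ℝ) ≤ ℓ := by exact_mod_cast hℓ
  have ht0 : 0 < t := by linarith
  have hn1 : 1 ≤ n := by exact_mod_cast ht.trans htn
  have hsum : ‖reducedCurve ℓ m R x‖ ^ 2 =
      ∑ k ∈ Finset.range ℓ, ∑ a ∈ Finset.range m, Real.cos (freq ℓ k a * x) ^ 2 +
        ∑ s : Fin R, reducedCurve ℓ m R x (Sum.inr s) ^ 2 := by
    rw [EuclideanSpace.real_norm_sq_eq]
    exact sum_coeffIndex (fun i => reducedCurve ℓ m R x i ^ 2)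
      (fun k a => Real.cos (freq ℓ k a * x) ^ 2) fun a k => rfl
  have hmain : ∑ k ∈ Finset.range ℓ, ∑ a ∈ Finset.range m, Real.cos (freq ℓ k a * x) ^ 2 =
      ℓ * m / 2 + (∑ k ∈ Finset.range ℓ, ∑ a ∈ Finset.range m,
        freq ℓ k a ^ 0 * Real.cos (2 * (freq ℓ k a * x))) / 2 := by
    simp_rw [Real.cos_sq, Finset.sum_add_distrib, Finset.sum_div]
    simp
    ring
  have hosc := (abs_sum_sum_freq_trig_le (m := m) hℓ hn hn1 ht0 hx 0).1
  have hrem : |∑ s : Fin R, reducedCurve ℓ m R x (Sum.inr s) ^ 2| ≤ 2 * ℓ * (2 * t) ^ 2 :=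
    abs_sum_fin_le hR (fun s => by
      rw [abs_pow]
      exact pow_le_pow_left₀ (abs_nonneg _) (reducedCurve_inr_le ht0 hx s) 2) (by positivity)
  have hnm : (n : ℝ) + 1 = 2 * ℓ * m + R := by exact_mod_cast hn
  have hR0 : (0 : ℝ) ≤ R := by positivity
  have hR1 : (R : ℝ) + 1 ≤ 2 * ℓ := by exact_mod_cast hR
  have ht2 : t ≤ t ^ 2 := by nlinarith
  have h1 : (ℓ : ℝ) * t ≤ ℓ * t ^ 2 := by gcongr
  have h2 : (ℓ : ℝ) ≤ ℓ * t := le_mul_of_one_le_right (by positivity) ht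
  rw [hsum, hmain]
  rw [pow_zero, mul_one] at hosc
  rw [abs_le] at hosc hrem ⊢
  constructor <;> nlinarith [hosc.1, hosc.2, hrem.1, hrem.2]

/-- The main term is half the sum of the squared frequencies, which are spread evenly over `[0, n]`
with density `1 / 2`. -/
lemma abs_norm_sq_reducedCurveDeriv_sub_le (hn : n + 1 = 2 * ℓ * m + R) (hR : R < 2 * ℓ)
    (ht : 1 ≤ t) (htn : t ≤ n) (hx : 1 ≤ t * |Real.sin (2 * ℓ * x)|) :
    |‖reducedCurveDeriv ℓ m R x‖ ^ 2 - (n : ℝ) ^ 3 / 12| ≤ 84 * ℓ ^ 3 * ((n : ℝ) ^ 2 * t ^ 2) := by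
  have hℓ : 1 ≤ ℓ := by omega
  have hℓ' : (1 : ℝ) ≤ ℓ := by exact_mod_cast hℓ
  have ht0 : 0 < t := by linarith
  have hn1 : 1 ≤ n := by exact_mod_cast ht.trans htn
  have hsum : ‖reducedCurveDeriv ℓ m R x‖ ^ 2 =
      ∑ k ∈ Finset.range ℓ, ∑ a ∈ Finset.range m,
        (-(freq ℓ k a * Real.sin (freq ℓ k a * x))) ^ 2 +
        ∑ s : Fin R, reducedCurveDeriv ℓ m R x (Sum.inr s) ^ 2 := by
    rw [EuclideanSpace.real_norm_sq_eq]
    exact sum_coeffIndex (fun i => reducedCurveDeriv ℓ m R x i ^ 2)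
      (fun k a => (-(freq ℓ k a * Real.sin (freq ℓ k a * x))) ^ 2) fun a k => rfl
  have hmain : ∑ k ∈ Finset.range ℓ, ∑ a ∈ Finset.range m,
        (-(freq ℓ k a * Real.sin (freq ℓ k a * x))) ^ 2 =
      (∑ k ∈ Finset.range ℓ, ∑ a ∈ Finset.range m, freq ℓ k a ^ 2) / 2 -
      (∑ k ∈ Finset.range ℓ, ∑ a ∈ Finset.range m,
        freq ℓ k a ^ 2 * Real.cos (2 * (freq ℓ k a * x))) / 2 := by
    rw [← sub_div, ← Finset.sum_sub_distrib, Finset.sum_div]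
    refine Finset.sum_congr rfl fun k _ => ?_
    rw [← Finset.sum_sub_distrib, Finset.sum_div]
    refine Finset.sum_congr rfl fun a _ => ?_
    rw [neg_sq, mul_pow, Real.sin_sq, Real.cos_sq]
    ring
  have hosc := (abs_sum_sum_freq_trig_le (m := m) hℓ hn hn1 ht0 hx 2).1
  have hfreq := abs_sum_freq_sq_sub_le hn hR hn1
  have hrem : |∑ s : Fin R, reducedCurveDeriv ℓ m R x (Sum.inr s) ^ 2| ≤
      2 * ℓ * (6 * ℓ * (n * t)) ^ 2 :=
    abs_sum_fin_le hR (fun s => by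
      rw [abs_pow]
      exact pow_le_pow_left₀ (abs_nonneg _) (reducedCurveDeriv_inr_le hℓ hn ht htn hx s) 2)
      (by positivity)
  have ht2 : t ≤ t ^ 2 := by nlinarith
  set P := (ℓ : ℝ) ^ 3 * ((n : ℝ) ^ 2 * t ^ 2) with hP
  have d1 : ℓ * (t * (4 * ℓ * n : ℝ) ^ 2) ≤ 16 * P := by
    calc ℓ * (t * (4 * ℓ * n : ℝ) ^ 2) = 16 * (ℓ ^ 3 * (n ^ 2 * t)) := by ring
      _ ≤ 16 * P := by rw [hP]; gcongr
  have d2 : 4 * ℓ * (n : ℝ) ^ 2 ≤ 4 * P := by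
    have : (ℓ : ℝ) * (n ^ 2 * 1) ≤ ℓ ^ 3 * (n ^ 2 * t ^ 2) := by
      gcongr
      · exact le_self_pow₀ hℓ' (by norm_num)
      · exact one_le_pow₀ ht
    rw [hP]; linarith
  have d3 : 2 * ℓ * (6 * ℓ * (n * t)) ^ 2 = 72 * P := by rw [hP]; ring
  rw [hsum, hmain]
  have goal : 84 * (ℓ : ℝ) ^ 3 * ((n : ℝ) ^ 2 * t ^ 2) = 84 * P := by rw [hP]; ring
  rw [goal]
  rw [d3] at hrem
  rw [abs_le] at hosc hrem hfreq ⊢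
  constructor <;> linarith [hosc.1, hosc.2, hrem.1, hrem.2, hfreq.1, hfreq.2]

/-- The curve is nearly orthogonal to its velocity: every term of the inner product carries an
oscillating factor `sin (2 ν x)`, or belongs to one of the fewer than `2 ℓ` unpaired coordinates. -/
lemma abs_inner_reducedCurve_le (hn : n + 1 = 2 * ℓ * m + R) (hR : R < 2 * ℓ)
    (ht : 1 ≤ t) (htn : t ≤ n) (hx : 1 ≤ t * |Real.sin (2 * ℓ * x)|) :
    |⟪reducedCurve ℓ m R x, reducedCurveDeriv ℓ m R x⟫| ≤ 26 * ℓ ^ 2 * (n * t ^ 2) := by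
  have hℓ : 1 ≤ ℓ := by omega
  have hℓ' : (1 : ℝ) ≤ ℓ := by exact_mod_cast hℓ
  have ht0 : 0 < t := by linarith
  have hn1 : 1 ≤ n := by exact_mod_cast ht.trans htn
  have hsum : ⟪reducedCurve ℓ m R x, reducedCurveDeriv ℓ m R x⟫ =
      ∑ k ∈ Finset.range ℓ, ∑ a ∈ Finset.range m,
        (-(freq ℓ k a * Real.sin (freq ℓ k a * x)) * Real.cos (freq ℓ k a * x)) +
        ∑ s : Fin R, reducedCurveDeriv ℓ m R x (Sum.inr s) *
          reducedCurve ℓ m R x (Sum.inr s) := by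
    rw [PiLp.inner_apply]
    exact sum_coeffIndex (fun i => reducedCurveDeriv ℓ m R x i * reducedCurve ℓ m R x i)
      (fun k a => -(freq ℓ k a * Real.sin (freq ℓ k a * x)) * Real.cos (freq ℓ k a * x))
      fun a k => rfl
  have hmain : ∑ k ∈ Finset.range ℓ, ∑ a ∈ Finset.range m,
        (-(freq ℓ k a * Real.sin (freq ℓ k a * x)) * Real.cos (freq ℓ k a * x)) =
      -(∑ k ∈ Finset.range ℓ, ∑ a ∈ Finset.range m,
        freq ℓ k a ^ 1 * Real.sin (2 * (freq ℓ k a * x))) / 2 := by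
    rw [neg_div, Finset.sum_div, ← Finset.sum_neg_distrib]
    refine Finset.sum_congr rfl fun k _ => ?_
    rw [Finset.sum_div, ← Finset.sum_neg_distrib]
    refine Finset.sum_congr rfl fun a _ => ?_
    rw [Real.sin_two_mul]
    ring
  have hosc := (abs_sum_sum_freq_trig_le (m := m) hℓ hn hn1 ht0 hx 1).2
  have hrem : |∑ s : Fin R, reducedCurveDeriv ℓ m R x (Sum.inr s) *
      reducedCurve ℓ m R x (Sum.inr s)| ≤ 2 * ℓ * (6 * ℓ * (n * t) * (2 * t)) :=
    abs_sum_fin_le hR (fun s => by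
      rw [abs_mul]
      exact mul_le_mul (reducedCurveDeriv_inr_le hℓ hn ht htn hx s) (reducedCurve_inr_le ht0 hx s)
        (abs_nonneg _) (by positivity)) (by positivity)
  have ht2 : t ≤ t ^ 2 := by nlinarith
  set P := (ℓ : ℝ) ^ 2 * (n * t ^ 2) with hP
  have d1 : ℓ * (t * (4 * ℓ * n : ℝ) ^ 1) ≤ 4 * P := by
    calc ℓ * (t * (4 * ℓ * n : ℝ) ^ 1) = 4 * (ℓ ^ 2 * (n * t)) := by ring
      _ ≤ 4 * P := by rw [hP]; gcongr
  have d3 : 2 * ℓ * (6 * ℓ * (n * t) * (2 * t)) = 24 * P := by rw [hP]; ring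
  rw [hsum, hmain]
  have goal : 26 * (ℓ : ℝ) ^ 2 * (n * t ^ 2) = 26 * P := by rw [hP]; ring
  rw [goal]
  rw [d3] at hrem
  rw [abs_le] at hosc hrem ⊢
  constructor <;> linarith [hosc.1, hosc.2, hrem.1, hrem.2]

end Curve

/-! ### The spherical speed of the coordinate curve -/

section Speed

open scoped RealInnerProductSpace

variable {ℓ m R n : ℕ} {t x : ℝ}

lemma norm_sq_reducedCurve_ge (hn : n + 1 = 2 * ℓ * m + R) (hR : R < 2 * ℓ) (ht : 1 ≤ t)
    (htn : 80 * ℓ * t ^ 2 ≤ n) (hx : 1 ≤ t * |Real.sin (2 * ℓ * x)|) :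
    (n : ℝ) / 8 ≤ ‖reducedCurve ℓ m R x‖ ^ 2 := by
  have hℓ : 1 ≤ ℓ := by omega
  have hℓ' : (1 : ℝ) ≤ ℓ := by exact_mod_cast hℓ
  have htn' : t ≤ n := by nlinarith [mul_nonneg (sub_nonneg.2 hℓ') (sq_nonneg t)]
  have h := abs_norm_sq_reducedCurve_sub_le hn hR ht htn' hx
  rw [abs_le] at h
  linarith [h.1]

lemma reducedCurve_ne_zero (hn : n + 1 = 2 * ℓ * m + R) (hR : R < 2 * ℓ) (ht : 1 ≤ t)
    (htn : 80 * ℓ * t ^ 2 ≤ n) (hx : 1 ≤ t * |Real.sin (2 * ℓ * x)|) :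
    reducedCurve ℓ m R x ≠ 0 := by
  have h := norm_sq_reducedCurve_ge hn hR ht htn hx
  have hℓ' : (1 : ℝ) ≤ ℓ := by exact_mod_cast (show 1 ≤ ℓ by omega)
  intro h0
  rw [h0, norm_zero] at h
  have : 0 < 80 * ℓ * t ^ 2 := by positivity
  linarith

/-- The spherical speed of the coordinate curve, which is `π` times the density of real zeros, is
asymptotic to `n / √3` away from the zeros of `sin (2 ℓ x)`. -/
lemma abs_norm_unitCurveDeriv_reducedCurve_sub_le (hn : n + 1 = 2 * ℓ * m + R) (hR : R < 2 * ℓ)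
    (ht : 1 ≤ t) (htn : 80 * ℓ * t ^ 2 ≤ n) (hx : 1 ≤ t * |Real.sin (2 * ℓ * x)|) :
    |‖unitCurveDeriv (reducedCurve ℓ m R) (reducedCurveDeriv ℓ m R) x‖ - n / Real.sqrt 3| ≤
      1616 * ℓ ^ 3 * t ^ 2 := by
  have hℓ : 1 ≤ ℓ := by omega
  have hℓ' : (1 : ℝ) ≤ ℓ := by exact_mod_cast hℓ
  have htn' : t ≤ n := by nlinarith [mul_nonneg (sub_nonneg.2 hℓ') (sq_nonneg t)]
  have hn0 : (0 : ℝ) < n := by linarith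
  have hne := reducedCurve_ne_zero hn hR ht htn hx
  have hA8 := norm_sq_reducedCurve_ge hn hR ht htn hx
  have hA := abs_norm_sq_reducedCurve_sub_le hn hR ht htn' hx
  have hC := abs_norm_sq_reducedCurveDeriv_sub_le hn hR ht htn' hx
  have hB := abs_inner_reducedCurve_le hn hR ht htn' hx
  have hu := abs_norm_unitCurveDeriv_sub_le (w' := reducedCurveDeriv ℓ m R) hne
  set u := ‖unitCurveDeriv (reducedCurve ℓ m R) (reducedCurveDeriv ℓ m R) x‖
  set B := |⟪reducedCurve ℓ m R x, reducedCurveDeriv ℓ m R x⟫|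
  have ha := norm_pos_iff.2 hne
  set a := ‖reducedCurve ℓ m R x‖
  set b := ‖reducedCurveDeriv ℓ m R x‖ with hb
  have hb0 : 0 ≤ b := norm_nonneg _
  have hA0 : 0 < a ^ 2 := by positivity
  have hl3 : (ℓ : ℝ) ≤ ℓ ^ 3 := le_self_pow₀ hℓ' (by norm_num)
  have hl23 : (ℓ : ℝ) ^ 2 ≤ ℓ ^ 3 := pow_le_pow_right₀ hℓ' (by norm_num)
  have h3 : Real.sqrt 3 ^ 2 = 3 := Real.sq_sqrt (by norm_num)
  have hs0 : 0 < Real.sqrt 3 := by positivity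
  have hs2 : Real.sqrt 3 ≤ 2 := by
    rw [Real.sqrt_le_left (by norm_num)]; norm_num
  set z := (n : ℝ) / Real.sqrt 3 with hz
  have hz2 : z ^ 2 = n ^ 2 / 3 := by rw [hz, div_pow, h3]
  have hzn : (n : ℝ) / 2 ≤ z := by rw [hz]; gcongr
  -- `b² - a² n² / 3` is of lower order
  have hCA : |b ^ 2 - a ^ 2 * z ^ 2| ≤ 88 * ℓ ^ 3 * ((n : ℝ) ^ 2 * t ^ 2) := by
    have e : b ^ 2 - a ^ 2 * z ^ 2 = (b ^ 2 - (n : ℝ) ^ 3 / 12) - (a ^ 2 - n / 4) * z ^ 2 := by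
      rw [hz2]; ring
    have h1 : |(a ^ 2 - n / 4) * z ^ 2| ≤ 10 * ℓ * t ^ 2 * (n ^ 2 / 3) := by
      rw [abs_mul, abs_of_nonneg (sq_nonneg z), hz2]
      gcongr
    have h2 : 10 * (ℓ : ℝ) * t ^ 2 * (n ^ 2 / 3) ≤ 4 * ℓ ^ 3 * (n ^ 2 * t ^ 2) := by
      have : (ℓ : ℝ) * (n ^ 2 * t ^ 2) ≤ ℓ ^ 3 * (n ^ 2 * t ^ 2) := by gcongr
      have h0 : 0 ≤ (ℓ : ℝ) * (n ^ 2 * t ^ 2) := by positivity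
      nlinarith
    rw [e]
    refine (abs_sub _ _).trans ?_
    linarith
  have hq : |b / a - z| ≤ 1408 * ℓ ^ 3 * t ^ 2 := by
    have e : b ^ 2 - a ^ 2 * z ^ 2 = (b / a - z) * ((b / a + z) * a ^ 2) := by
      field_simp
      ring
    have hpos : 0 ≤ (b / a + z) * a ^ 2 := by positivity
    have hlow : (n : ℝ) / 2 * (n / 8) ≤ (b / a + z) * a ^ 2 := by
      have : 0 ≤ b / a := by positivity
      gcongr
      linarith
    have h1 : |b / a - z| * ((n : ℝ) / 2 * (n / 8)) ≤ 88 * ℓ ^ 3 * ((n : ℝ) ^ 2 * t ^ 2) := by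
      calc _ ≤ |b / a - z| * ((b / a + z) * a ^ 2) := by gcongr
        _ = |b ^ 2 - a ^ 2 * z ^ 2| := by rw [e, abs_mul, abs_of_nonneg hpos]
        _ ≤ _ := hCA
    have h2 : |b / a - z| * (n : ℝ) ^ 2 ≤ 1408 * ℓ ^ 3 * t ^ 2 * (n : ℝ) ^ 2 := by linarith
    exact le_of_mul_le_mul_right h2 (by positivity)
  have hBA : B / a ^ 2 ≤ 208 * ℓ ^ 3 * t ^ 2 := by
    rw [div_le_iff₀ hA0]
    calc B ≤ 26 * ℓ ^ 2 * (n * t ^ 2) := hB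
      _ ≤ 26 * ℓ ^ 3 * (n * t ^ 2) := by gcongr
      _ = 208 * ℓ ^ 3 * t ^ 2 * (n / 8) := by ring
      _ ≤ 208 * ℓ ^ 3 * t ^ 2 * a ^ 2 := by gcongr
  calc |u - z| = |(u - b / a) + (b / a - z)| := by ring_nf
    _ ≤ _ := abs_add_le _ _
    _ ≤ 1616 * ℓ ^ 3 * t ^ 2 := by linarith

end Speed

/-! ### Equal blocks and the coordinate curve -/

section Blocks

open scoped RealInnerProductSpace

variable {ℓ m R n : ℕ}

lemma sum_range_blocks (ℓ m R : ℕ) (F : ℕ → ℝ) :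
    ∑ j ∈ Finset.range (2 * ℓ * m + R), F j =
      ∑ a ∈ Finset.range m, ∑ k ∈ Finset.range ℓ, (F (2 * ℓ * a + k) + F (2 * ℓ * a + ℓ + k)) +
      ∑ s ∈ Finset.range R, F (2 * ℓ * m + s) := by
  rw [Finset.sum_range_add]
  congr 1
  induction m with
  | zero => simp
  | succ m ih =>
    rw [Finset.sum_range_succ, ← ih, show 2 * ℓ * (m + 1) = 2 * ℓ * m + (ℓ + ℓ) by ring,
      Finset.sum_range_add, Finset.sum_range_add, ← Finset.sum_add_distrib]
    congr 1
    exact Finset.sum_congr rfl fun k _ => by rw [add_assoc (2 * ℓ * m)]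

/-- Pairing equal blocks brings out the common factor `2 cos (ℓ x / 2)`. -/
lemma cosPoly_eq_inner_reducedCurve (hn : n + 1 = 2 * ℓ * m + R) {b : ℕ → ℝ}
    {g : EuclideanSpace ℝ (CoeffIndex ℓ m R)}
    (h1 : ∀ (a : Fin m) (k : Fin ℓ), b (2 * ℓ * a + k) = g (Sum.inl (a, k)))
    (h2 : ∀ (a : Fin m) (k : Fin ℓ), b (2 * ℓ * a + ℓ + k) = g (Sum.inl (a, k)))
    (h3 : ∀ s : Fin R, b (2 * ℓ * m + s) = g (Sum.inr s)) {x : ℝ}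
    (hx : Real.cos (ℓ * x / 2) ≠ 0) :
    cosPoly n b x = 2 * Real.cos (ℓ * x / 2) * ⟪reducedCurve ℓ m R x, g⟫ := by
  unfold cosPoly
  rw [hn, sum_range_blocks, PiLp.inner_apply, Fintype.sum_sum_type, Fintype.sum_prod_type,
    Finset.sum_range, Finset.sum_range, mul_add]
  congr 1
  · rw [Finset.mul_sum]
    refine Finset.sum_congr rfl fun a _ => ?_
    rw [Finset.sum_range, Finset.mul_sum]
    refine Finset.sum_congr rfl fun k _ => ?_
    rw [h1, h2, ← mul_add, Real.cos_add_cos]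
    change _ = 2 * Real.cos (ℓ * x / 2) * (g (Sum.inl (a, k)) * Real.cos (freq ℓ k a * x))
    have e1 : ((((2 * ℓ * a + k : ℕ) : ℝ)) * x + ((2 * ℓ * a + ℓ + k : ℕ) : ℝ) * x) / 2 =
        freq ℓ k a * x := by unfold freq; push_cast; ring
    have e2 : ((((2 * ℓ * a + k : ℕ) : ℝ)) * x - ((2 * ℓ * a + ℓ + k : ℕ) : ℝ) * x) / 2 =
        -(ℓ * x / 2) := by push_cast; ring
    rw [e1, e2, Real.cos_neg]
    ring
  · rw [Finset.mul_sum]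
    refine Finset.sum_congr rfl fun s _ => ?_
    rw [h3]
    change _ = 2 * Real.cos (ℓ * x / 2) * (g (Sum.inr s) *
      (Real.cos ((2 * ℓ * m + s) * x) / (2 * Real.cos (ℓ * x / 2))))
    push_cast
    field_simp

/-- The vector representing the `j`-th coefficient of the cosine polynomial as a linear functional
of the independent coefficients. It is `0` for `j ≥ 2 ℓ m + R`. -/
noncomputable def coeffVector (ℓ m R j : ℕ) : EuclideanSpace ℝ (CoeffIndex ℓ m R) :=
  if h : j < 2 * ℓ * m then
    EuclideanSpace.single (Sum.inl (⟨j / (2 * ℓ), Nat.div_lt_of_lt_mul h⟩,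
      ⟨j % ℓ, Nat.mod_lt _ (Nat.pos_of_ne_zero fun h0 => by simp [h0] at h)⟩)) 1
  else if h' : j - 2 * ℓ * m < R then EuclideanSpace.single (Sum.inr ⟨j - 2 * ℓ * m, h'⟩) 1
  else 0

lemma norm_coeffVector_le (ℓ m R j : ℕ) : ‖coeffVector ℓ m R j‖ ≤ 1 := by
  unfold coeffVector
  split_ifs <;> simp

lemma two_mul_mul_add_lt {a k : ℕ} (ha : a < m) (hk : k < 2 * ℓ) : 2 * ℓ * a + k < 2 * ℓ * m := by
  calc 2 * ℓ * a + k < 2 * ℓ * a + 2 * ℓ := by omega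
    _ = 2 * ℓ * (a + 1) := by ring
    _ ≤ 2 * ℓ * m := Nat.mul_le_mul_left _ ha

lemma inner_coeffVector_even (a : Fin m) (k : Fin ℓ) (g : EuclideanSpace ℝ (CoeffIndex ℓ m R)) :
    ⟪coeffVector ℓ m R (2 * ℓ * a + k), g⟫ = g (Sum.inl (a, k)) := by
  have hk := k.2
  have hlt : 2 * ℓ * (a : ℕ) + k < 2 * ℓ * m := two_mul_mul_add_lt a.2 (by omega)
  have e1 : (2 * ℓ * (a : ℕ) + k) / (2 * ℓ) = a := by
    rw [Nat.mul_add_div (by omega), Nat.div_eq_of_lt (by omega), add_zero]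
  have e2 : (2 * ℓ * (a : ℕ) + k) % ℓ = k := by
    rw [show 2 * ℓ * (a : ℕ) + k = k + ℓ * (2 * a) by ring, Nat.add_mul_mod_self_left,
      Nat.mod_eq_of_lt hk]
  unfold coeffVector
  rw [dif_pos hlt, EuclideanSpace.inner_single_left]
  simp only [e1, e2, map_one, one_mul, Fin.eta]

lemma inner_coeffVector_odd (a : Fin m) (k : Fin ℓ) (g : EuclideanSpace ℝ (CoeffIndex ℓ m R)) :
    ⟪coeffVector ℓ m R (2 * ℓ * a + ℓ + k), g⟫ = g (Sum.inl (a, k)) := by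
  have hk := k.2
  have hlt : 2 * ℓ * (a : ℕ) + ℓ + k < 2 * ℓ * m := by
    rw [add_assoc]; exact two_mul_mul_add_lt a.2 (by omega)
  have e1 : (2 * ℓ * (a : ℕ) + ℓ + k) / (2 * ℓ) = a := by
    rw [add_assoc, Nat.mul_add_div (by omega), Nat.div_eq_of_lt (by omega), add_zero]
  have e2 : (2 * ℓ * (a : ℕ) + ℓ + k) % ℓ = k := by
    rw [show 2 * ℓ * (a : ℕ) + ℓ + k = k + ℓ * (2 * a + 1) by ring, Nat.add_mul_mod_self_left,
      Nat.mod_eq_of_lt hk]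
  unfold coeffVector
  rw [dif_pos hlt, EuclideanSpace.inner_single_left]
  simp only [e1, e2, map_one, one_mul, Fin.eta]

lemma inner_coeffVector_rem (s : Fin R) (g : EuclideanSpace ℝ (CoeffIndex ℓ m R)) :
    ⟪coeffVector ℓ m R (2 * ℓ * m + s), g⟫ = g (Sum.inr s) := by
  have hs := s.2
  have h' : 2 * ℓ * m + (s : ℕ) - 2 * ℓ * m = s := by omega
  unfold coeffVector
  rw [dif_neg (by omega), dif_pos (by omega), EuclideanSpace.inner_single_left]
  simp only [h', map_one, one_mul, Fin.eta]

/-- The random cosine polynomial as a function of the normalized independent coefficients. -/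
noncomputable def blockPoly (ℓ m R n : ℕ) (g : EuclideanSpace ℝ (CoeffIndex ℓ m R)) : ℝ → ℝ :=
  cosPoly n (fun j => ⟪coeffVector ℓ m R j, g⟫)

lemma blockPoly_eq (hn : n + 1 = 2 * ℓ * m + R) (g : EuclideanSpace ℝ (CoeffIndex ℓ m R)) {x : ℝ}
    (hx : Real.cos (ℓ * x / 2) ≠ 0) :
    blockPoly ℓ m R n g x = 2 * Real.cos (ℓ * x / 2) * ⟪reducedCurve ℓ m R x, g⟫ :=
  cosPoly_eq_inner_reducedCurve hn (fun a k => inner_coeffVector_even a k g)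
    (fun a k => inner_coeffVector_odd a k g) (fun s => inner_coeffVector_rem s g) hx

lemma sum_cos_smul_coeffVector (hn : n + 1 = 2 * ℓ * m + R) {x : ℝ}
    (hx : Real.cos (ℓ * x / 2) ≠ 0) :
    ∑ j ∈ Finset.range (n + 1), Real.cos (j * x) • coeffVector ℓ m R j =
      (2 * Real.cos (ℓ * x / 2)) • reducedCurve ℓ m R x := by
  refine ext_inner_right ℝ fun g => ?_
  rw [inner_sum_cos_smul, inner_smul_left]
  exact blockPoly_eq hn g hx

end Blocks

/-! ### The expected number of zeros -/

section Expectation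

open scoped RealInnerProductSpace

variable {ℓ m R n : ℕ} {t x : ℝ}

lemma cos_half_ne_zero (ht : 0 < t) (hx : 1 ≤ t * |Real.sin (2 * ℓ * x)|) :
    Real.cos (ℓ * x / 2) ≠ 0 := by
  intro h0
  have := abs_cos_half_ge ht hx
  rw [h0, abs_zero, mul_zero] at this
  linarith

/-- Points at distance at least `t⁻¹` from the multiples of `π / (2 ℓ)` satisfy the quantitative
non-degeneracy condition. -/
lemma one_le_mul_abs_sin (hℓ : 1 ≤ ℓ) (ht : 0 < t) {k : ℕ}
    (h1 : k * (Real.pi / (2 * ℓ)) + t⁻¹ ≤ x) (h2 : x ≤ (k + 1) * (Real.pi / (2 * ℓ)) - t⁻¹) :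
    1 ≤ t * |Real.sin (2 * ℓ * x)| := by
  have hpi := Real.pi_pos
  have hpi4 := Real.pi_le_four
  have hℓ' : (1 : ℝ) ≤ ℓ := by exact_mod_cast hℓ
  set y := 2 * ℓ * x - k * Real.pi with hy
  have hsin : |Real.sin (2 * ℓ * x)| = |Real.sin y| := by
    have : 2 * ℓ * x = y + k * Real.pi := by rw [hy]; ring
    rw [this, Real.sin_add_nat_mul_pi, abs_mul, abs_pow, abs_neg, abs_one, one_pow, one_mul]
  have e : 2 * (ℓ : ℝ) * (Real.pi / (2 * ℓ)) = Real.pi := by field_simp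
  have hti : 0 < t⁻¹ := inv_pos.2 ht
  have hlt : 2 * t⁻¹ ≤ 2 * ℓ * t⁻¹ := by nlinarith
  have y1 : 2 * t⁻¹ ≤ y := by
    have : 2 * (ℓ : ℝ) * (k * (Real.pi / (2 * ℓ)) + t⁻¹) ≤ 2 * ℓ * x := by gcongr
    have e2 : 2 * (ℓ : ℝ) * (k * (Real.pi / (2 * ℓ)) + t⁻¹) = k * Real.pi + 2 * ℓ * t⁻¹ := by
      linear_combination k * e
    linarith
  have y2 : y ≤ Real.pi - 2 * t⁻¹ := by
    have : 2 * (ℓ : ℝ) * x ≤ 2 * ℓ * ((k + 1) * (Real.pi / (2 * ℓ)) - t⁻¹) := by gcongr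
    have e2 : 2 * (ℓ : ℝ) * ((k + 1) * (Real.pi / (2 * ℓ)) - t⁻¹) =
      (k + 1) * Real.pi - 2 * ℓ * t⁻¹ := by linear_combination (k + 1) * e
    linarith
  have hjordan : ∀ z, 2 * t⁻¹ ≤ z → z ≤ Real.pi / 2 → t⁻¹ ≤ Real.sin z := by
    intro z hz1 hz2
    have h := Real.mul_le_sin (by linarith) hz2
    have h3 : t⁻¹ ≤ 2 / Real.pi * z := by
      rw [div_mul_eq_mul_div, le_div_iff₀ hpi]
      nlinarith
    linarith
  have hfin : t⁻¹ ≤ Real.sin y := by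
    rcases le_total y (Real.pi / 2) with hy2 | hy2
    · exact hjordan y y1 hy2
    · rw [← Real.sin_pi_sub]
      exact hjordan _ (by linarith) (by linarith)
  rw [hsin]
  calc 1 = t * t⁻¹ := (mul_inv_cancel₀ ht.ne').symm
    _ ≤ t * |Real.sin y| := by
      have := le_abs_self (Real.sin y)
      gcongr
      linarith

/-- The expected number of zeros in an interval on which the coordinate curve is
non-degenerate. -/
lemma lintegral_zeroCount_good (hm : 1 ≤ m) (hn : n + 1 = 2 * ℓ * m + R) (hR : R < 2 * ℓ)
    (ht : 1 ≤ t) (htn : 80 * ℓ * t ^ 2 ≤ n) {α β : ℝ} (hαβ : α < β)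
    (hx : ∀ x ∈ Set.Icc α β, 1 ≤ t * |Real.sin (2 * ℓ * x)|) :
    ENNReal.ofReal ((β - α) * (n / Real.sqrt 3 - 1616 * ℓ ^ 3 * t ^ 2) / Real.pi) ≤
      ∫⁻ g, zeroCount (blockPoly ℓ m R n g) (Set.Ioo α β) ∂(stdGaussian _) ∧
    ∫⁻ g, zeroCount (blockPoly ℓ m R n g) (Set.Ioo α β) ∂(stdGaussian _) ≤
      ENNReal.ofReal ((β - α) * (n / Real.sqrt 3 + 1616 * ℓ ^ 3 * t ^ 2) / Real.pi) := by
  have ht0 : 0 < t := by linarith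
  have hcos : ∀ x ∈ Set.Icc α β, Real.cos (ℓ * x / 2) ≠ 0 := fun x h =>
    cos_half_ne_zero ht0 (hx x h)
  have hne : ∀ x ∈ Set.Icc α β, reducedCurve ℓ m R x ≠ 0 := fun x h =>
    reducedCurve_ne_zero hn hR ht htn (hx x h)
  have hcount : ∀ g : EuclideanSpace ℝ (CoeffIndex ℓ m R),
      zeroCount (blockPoly ℓ m R n g) (Set.Ioo α β) =
        zeroCount (fun x => ⟪unitCurve (reducedCurve ℓ m R) x, g⟫) (Set.Ioo α β) := by
    intro g
    refine zeroCount_congr fun x h => ?_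
    have hxI := Set.Ioo_subset_Icc_self h
    have hpos := norm_pos_iff.2 (hne x hxI)
    rw [blockPoly_eq hn g (hcos x hxI), unitCurve, inner_smul_left]
    simp [hcos x hxI, hpos.ne']
  simp_rw [hcount]
  have hder : ∀ x ∈ Set.Icc α β, HasDerivAt (reducedCurve ℓ m R) (reducedCurveDeriv ℓ m R x) x :=
    fun x h => hasDerivAt_reducedCurve (hcos x h)
  have hw : ∀ x ∈ Set.Icc α β, HasDerivAt (unitCurve (reducedCurve ℓ m R))
      (unitCurveDeriv (reducedCurve ℓ m R) (reducedCurveDeriv ℓ m R) x) x := fun x h =>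
    hasDerivAt_unitCurve (hder x h) (hne x h)
  have hw' : ContinuousOn (unitCurveDeriv (reducedCurve ℓ m R) (reducedCurveDeriv ℓ m R))
      (Set.Icc α β) :=
    continuousOn_unitCurveDeriv (fun x h => (hder x h).continuousAt.continuousWithinAt)
      (continuousOn_reducedCurveDeriv hcos) hne
  have hnorm : ∀ x ∈ Set.Icc α β, ‖unitCurve (reducedCurve ℓ m R) x‖ = 1 := fun x h =>
    norm_unitCurve (hne x h)
  have hspeed := fun x h => abs_le.1
    (abs_norm_unitCurveDeriv_reducedCurve_sub_le hn hR ht htn (hx x h))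
  have hℓ : 0 < ℓ := by omega
  set i₀ : CoeffIndex ℓ m R := Sum.inl (⟨0, hm⟩, ⟨0, hℓ⟩)
  refine ⟨lintegral_zeroCount_ge hαβ hw hw' hnorm fun x h => by linarith [(hspeed x h).1],
    lintegral_zeroCount_le hαβ hw hw' hnorm (fun x h => by linarith [(hspeed x h).2])
      (e := EuclideanSpace.single i₀ (1 : ℝ)) (by simp) fun x h => ?_⟩
  -- the coordinate of the coefficient with index `0` is `cos (ℓ x / 2)` up to normalization
  have hcoord : reducedCurve ℓ m R x i₀ = Real.cos (ℓ * x / 2) := by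
    change Real.cos (freq ℓ 0 0 * x) = _
    unfold freq
    congr 1; push_cast; ring
  rw [EuclideanSpace.inner_single_right, unitCurve, one_mul, conj_trivial, PiLp.smul_apply, hcoord]
  exact smul_ne_zero (inv_ne_zero (norm_ne_zero_iff.2 (hne x h))) (hcos x h)

/-- The variance of the random cosine polynomial is bounded below at non-degenerate points. -/
lemma one_le_norm_sum_cos (hn : n + 1 = 2 * ℓ * m + R) (hR : R < 2 * ℓ) (ht : 1 ≤ t)
    (htn : 80 * ℓ * t ^ 2 ≤ n) (hx : 1 ≤ t * |Real.sin (2 * ℓ * x)|) :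
    1 ≤ ‖∑ j ∈ Finset.range (n + 1), Real.cos (j * x) • coeffVector ℓ m R j‖ := by
  have ht0 : 0 < t := by linarith
  have hℓ' : (1 : ℝ) ≤ ℓ := by exact_mod_cast (show 1 ≤ ℓ by omega)
  have hc := abs_cos_half_ge ht0 hx
  have hA := norm_sq_reducedCurve_ge hn hR ht htn hx
  rw [sum_cos_smul_coeffVector hn (cos_half_ne_zero ht0 hx), norm_smul, Real.norm_eq_abs,
    ← one_le_sq_iff₀ (by positivity), mul_pow, sq_abs, mul_pow]
  have h1 : 1 ≤ 16 * t ^ 2 * Real.cos (ℓ * x / 2) ^ 2 := by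
    have := one_le_pow₀ (n := 2) hc
    rw [mul_pow, sq_abs] at this
    linarith
  have h2 : 10 * t ^ 2 ≤ ‖reducedCurve ℓ m R x‖ ^ 2 := by
    nlinarith [mul_nonneg (sub_nonneg.2 hℓ') (sq_nonneg t)]
  calc (1 : ℝ) ≤ 2 ^ 2 * Real.cos (ℓ * x / 2) ^ 2 * (10 * t ^ 2) := by linarith
    _ ≤ _ := by gcongr

/-- The expected number of zeros close to a multiple of `π / (2 ℓ)`. -/
lemma lintegral_zeroCount_bad (hn : n + 1 = 2 * ℓ * m + R) (hR : R < 2 * ℓ) (ht : 80 * ℓ ≤ t)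
    (htn : t ^ 6 = n) (k : ℕ) :
    ∫⁻ g, zeroCount (blockPoly ℓ m R n g)
      (Set.Ioo (k * (Real.pi / (2 * ℓ)) - 2 * t⁻¹) (k * (Real.pi / (2 * ℓ)) + 2 * t⁻¹) ∩
        Set.Ioo 0 (2 * Real.pi)) ∂(stdGaussian _) ≤ ENNReal.ofReal (330 * t ^ 5) := by
  have hℓ : 1 ≤ ℓ := by omega
  have hℓ' : (1 : ℝ) ≤ ℓ := by exact_mod_cast hℓ
  have hpi := Real.pi_gt_three
  have ht1 : 1 ≤ t := by linarith
  have ht0 : 0 < t := by linarith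
  have htn2 : 80 * ℓ * t ^ 2 ≤ n := by
    rw [← htn]
    calc 80 * ℓ * t ^ 2 ≤ t * t ^ 2 := by gcongr
      _ = t ^ 3 := by ring
      _ ≤ t ^ 6 := pow_le_pow_right₀ ht1 (by norm_num)
  have hti : 0 < t⁻¹ := inv_pos.2 ht0
  have hstep : 2 * t⁻¹ ≤ Real.pi / (2 * ℓ) := by
    rw [le_div_iff₀ (by positivity), inv_eq_one_div, mul_one_div, div_mul_eq_mul_div,
      div_le_iff₀ ht0]
    nlinarith
  set x₀ := k * (Real.pi / (2 * ℓ)) + t⁻¹ with hx₀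
  have hx : 1 ≤ t * |Real.sin (2 * ℓ * x₀)| :=
    one_le_mul_abs_sin hℓ ht0 le_rfl (by rw [hx₀]; linarith)
  -- the length of the interval is `4 / t`, and `n * (4 / t) = 4 t ^ 5`
  set p := ⌈4 * Real.exp 2 * t ^ 5⌉₊ with hp
  have hp1 : 4 * Real.exp 2 * t ^ 5 ≤ p := Nat.le_ceil _
  have hp2 : (p : ℝ) < 4 * Real.exp 2 * t ^ 5 + 1 := Nat.ceil_lt_add_one (by positivity)
  have he : Real.exp 2 ≤ 8 := by
    have h1 := Real.exp_one_lt_d9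
    have h2 : Real.exp 2 = Real.exp 1 ^ 2 := by rw [← Real.exp_nat_mul]; norm_num
    rw [h2]
    calc Real.exp 1 ^ 2 ≤ 2.7182818286 ^ 2 := pow_le_pow_left₀ (Real.exp_pos 1).le h1.le 2
      _ ≤ 8 := by norm_num
  have he1 : 1 ≤ Real.exp 2 := Real.one_le_exp (by norm_num)
  have ht5 : 1 ≤ t ^ 5 := one_le_pow₀ ht1
  have hmain := lintegral_zeroCount_short (n := n) (c := coeffVector ℓ m R)
    (norm_coeffVector_le ℓ m R) (α := k * (Real.pi / (2 * ℓ)) - 2 * t⁻¹)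
    (β := k * (Real.pi / (2 * ℓ)) + 2 * t⁻¹) (x₀ := x₀)
    ⟨by rw [hx₀]; linarith, by rw [hx₀]; linarith⟩
    (one_le_norm_sum_cos hn hR ht1 htn2 hx) (p := p) (by
      have e : (n : ℝ) * (k * (Real.pi / (2 * ℓ)) + 2 * t⁻¹ -
          (k * (Real.pi / (2 * ℓ)) - 2 * t⁻¹)) = 4 * t ^ 5 := by
        rw [← htn]; field_simp; ring
      rw [e]; linarith)
  refine (lintegral_mono fun g => zeroCount_mono (Set.inter_subset_inter_left _
    Set.Ioo_subset_Icc_self)).trans (hmain.trans (ENNReal.ofReal_le_ofReal ?_))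
  have hpt : t ^ 5 ≤ p := by nlinarith
  have hexp : Real.exp (-(p / 2)) ≤ 48 / t ^ 15 := by
    have hy : 0 ≤ t ^ 5 / 2 := by positivity
    have h1 := Real.pow_div_factorial_le_exp (t ^ 5 / 2) hy 3
    have h2 : (t ^ 5 / 2) ^ 3 / (Nat.factorial 3 : ℝ) = t ^ 15 / 48 := by
      norm_num [Nat.factorial]; ring
    rw [h2] at h1
    calc Real.exp (-(p / 2)) ≤ Real.exp (-(t ^ 5 / 2)) := Real.exp_le_exp.2 (by linarith)
      _ = (Real.exp (t ^ 5 / 2))⁻¹ := Real.exp_neg _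
      _ ≤ (t ^ 15 / 48)⁻¹ := inv_anti₀ (by positivity) h1
      _ = 48 / t ^ 15 := by rw [inv_div]
  have hn1 : (1 : ℝ) ≤ n := by rw [← htn]; exact one_le_pow₀ ht1
  have herr : 2 * (n : ℝ) * ((n + 2) * Real.exp (-(p / 2))) ≤ 288 * t ^ 5 := by
    calc 2 * (n : ℝ) * ((n + 2) * Real.exp (-(p / 2)))
        ≤ 2 * (n : ℝ) * ((3 * n) * (48 / t ^ 15)) := by gcongr; linarith
      _ = 288 * (t ^ 3)⁻¹ := by rw [← htn]; field_simp; ring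
      _ ≤ 288 * 1 := by
        have : (t ^ 3)⁻¹ ≤ 1 := inv_le_one_of_one_le₀ (one_le_pow₀ ht1)
        gcongr
      _ ≤ 288 * t ^ 5 := by gcongr
  have : 4 * Real.exp 2 * t ^ 5 ≤ 32 * t ^ 5 := by gcongr; linarith
  linarith

lemma measurable_zeroCount_blockPoly (α β : ℝ) :
    Measurable (fun g => zeroCount (blockPoly ℓ m R n g) (Set.Ioo α β)) := by
  refine measurable_zeroCount_Ioo ?_ α β
  unfold blockPoly cosPoly Function.uncurry
  fun_prop

/-- The expected number of zeros in `(0, 2π)`, as a function of `t = n ^ (1 / 6)`. -/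
lemma lintegral_zeroCount_blockPoly (hm : 1 ≤ m) (hn : n + 1 = 2 * ℓ * m + R) (hR : R < 2 * ℓ)
    (ht : 80 * ℓ ≤ t) (htn : t ^ 6 = n) :
    ∫⁻ g, zeroCount (blockPoly ℓ m R n g) (Set.Ioo 0 (2 * Real.pi)) ∂(stdGaussian _) ≠ ∞ ∧
    |(∫⁻ g, zeroCount (blockPoly ℓ m R n g) (Set.Ioo 0 (2 * Real.pi)) ∂(stdGaussian _)).toReal -
      2 * n / Real.sqrt 3| ≤ 5000 * ℓ ^ 3 * t ^ 5 := by
  have hℓ : 1 ≤ ℓ := by omega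
  have hℓ' : (1 : ℝ) ≤ ℓ := by exact_mod_cast hℓ
  have hpi := Real.pi_gt_three
  have ht1 : 1 ≤ t := by linarith
  have ht0 : 0 < t := by linarith
  have htn2 : 80 * ℓ * t ^ 2 ≤ n := by
    rw [← htn]
    calc 80 * ℓ * t ^ 2 ≤ t * t ^ 2 := by gcongr
      _ = t ^ 3 := by ring
      _ ≤ t ^ 6 := pow_le_pow_right₀ ht1 (by norm_num)
  have hti : 0 < t⁻¹ := inv_pos.2 ht0
  set h := Real.pi / (2 * ℓ) with hh
  have hh0 : 0 < h := by positivity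
  have hstep : 2 * t⁻¹ < h := by
    rw [hh, lt_div_iff₀ (by positivity), inv_eq_one_div, mul_one_div, div_mul_eq_mul_div,
      div_lt_iff₀ ht0]
    nlinarith
  have h4 : ((4 * ℓ : ℕ) : ℝ) * h = 2 * Real.pi := by rw [hh]; push_cast; field_simp; ring
  -- the intervals `G k` between the multiples of `h` cover `(0, 2π)` up to neighbourhoods `B k`
  -- of these multiples
  set G : ℕ → Set ℝ := fun k => Set.Ioo (k * h + t⁻¹) ((k + 1) * h - t⁻¹) with hG
  set B : ℕ → Set ℝ := fun k => Set.Ioo (k * h - 2 * t⁻¹) (k * h + 2 * t⁻¹) ∩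
    Set.Ioo 0 (2 * Real.pi)
    with hB
  set L := (n : ℝ) / Real.sqrt 3 with hL
  set D := 1616 * (ℓ : ℝ) ^ 3 * t ^ 2 with hD
  set I := ∫⁻ g, zeroCount (blockPoly ℓ m R n g) (Set.Ioo 0 (2 * Real.pi))
    ∂(stdGaussian (EuclideanSpace ℝ (CoeffIndex ℓ m R))) with hI
  have hgood : ∀ k : ℕ, ENNReal.ofReal ((h - 2 * t⁻¹) * (L - D) / Real.pi) ≤
      ∫⁻ g, zeroCount (blockPoly ℓ m R n g) (G k) ∂(stdGaussian _) ∧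
      ∫⁻ g, zeroCount (blockPoly ℓ m R n g) (G k) ∂(stdGaussian _) ≤
        ENNReal.ofReal ((h - 2 * t⁻¹) * (L + D) / Real.pi) := by
    intro k
    have := lintegral_zeroCount_good (α := k * h + t⁻¹) (β := (k + 1) * h - t⁻¹) hm hn hR ht1 htn2
      (by linarith) (fun x hx => one_le_mul_abs_sin hℓ ht0 hx.1 hx.2)
    have e : (k + 1) * h - t⁻¹ - (k * h + t⁻¹) = h - 2 * t⁻¹ := by ring
    rwa [e] at this
  have hGsub : ∀ k ∈ Finset.range (4 * ℓ), G k ⊆ Set.Ioo 0 (2 * Real.pi) := by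
    intro k hk x hx
    have hk' : ((k : ℝ) + 1) ≤ (4 * ℓ : ℕ) := by exact_mod_cast Finset.mem_range.1 hk
    have h1 : ((k : ℝ) + 1) * h ≤ 2 * Real.pi := by rw [← h4]; gcongr
    have h2 : 0 ≤ (k : ℝ) * h := by positivity
    exact ⟨by linarith [hx.1], by linarith [hx.2]⟩
  have hGdisj : ((Finset.range (4 * ℓ) : Finset ℕ) : Set ℕ).PairwiseDisjoint G := by
    have aux : ∀ i j : ℕ, i < j → Disjoint (G i) (G j) := by
      intro i j hij
      refine Set.disjoint_left.2 fun x hx hx' => ?_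
      have : ((i : ℝ) + 1) ≤ j := by exact_mod_cast hij
      have h1 : ((i : ℝ) + 1) * h ≤ j * h := by gcongr
      linarith [hx.2, hx'.1]
    intro i _ j _ hij
    rcases lt_or_gt_of_ne hij with h1 | h1
    · exact aux i j h1
    · exact (aux j i h1).symm
  have hcover : Set.Ioo 0 (2 * Real.pi) ⊆
      (⋃ k ∈ Finset.range (4 * ℓ), G k) ∪ ⋃ k ∈ Finset.range (4 * ℓ + 1), B k := by
    intro x hx
    have hx0 : 0 ≤ x / h := div_nonneg hx.1.le hh0.le
    set k := ⌊x / h⌋₊ with hk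
    have k1 : k * h ≤ x := (le_div_iff₀ hh0).1 (Nat.floor_le hx0)
    have k2 : x < (k + 1) * h := (div_lt_iff₀ hh0).1 (Nat.lt_floor_add_one _)
    have k3 : k < 4 * ℓ := by
      rw [hk, Nat.floor_lt hx0, div_lt_iff₀ hh0, h4]
      exact hx.2
    by_cases c1 : x ≤ k * h + t⁻¹
    · refine Or.inr (Set.mem_iUnion₂.2 ⟨k, Finset.mem_range.2 (by omega), ⟨⟨?_, ?_⟩, hx⟩⟩) <;>
        linarith
    · by_cases c2 : (k + 1) * h - t⁻¹ ≤ x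
      · refine Or.inr (Set.mem_iUnion₂.2 ⟨k + 1, Finset.mem_range.2 (by omega), ⟨⟨?_, ?_⟩, hx⟩⟩)
        · push_cast; linarith
        · push_cast; linarith
      · exact Or.inl (Set.mem_iUnion₂.2 ⟨k, Finset.mem_range.2 k3, ⟨not_le.1 c1, not_le.1 c2⟩⟩)
  have hlow : ENNReal.ofReal ((4 * ℓ : ℕ) * ((h - 2 * t⁻¹) * (L - D) / Real.pi)) ≤ I := by
    calc _ = ∑ _k ∈ Finset.range (4 * ℓ), ENNReal.ofReal ((h - 2 * t⁻¹) * (L - D) / Real.pi) := by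
          rw [Finset.sum_const, Finset.card_range, nsmul_eq_mul, ENNReal.ofReal_mul (by positivity),
            ENNReal.ofReal_natCast]
      _ ≤ ∑ k ∈ Finset.range (4 * ℓ), ∫⁻ g, zeroCount (blockPoly ℓ m R n g) (G k)
            ∂(stdGaussian _) := Finset.sum_le_sum fun k _ => (hgood k).1
      _ = ∫⁻ g, ∑ k ∈ Finset.range (4 * ℓ), zeroCount (blockPoly ℓ m R n g) (G k)
            ∂(stdGaussian _) :=
          (lintegral_finsetSum _ fun k _ => measurable_zeroCount_blockPoly _ _).symm
      _ ≤ I := lintegral_mono fun g => sum_zeroCount_le _ _ G hGdisj hGsub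
  have hupp : I ≤ ENNReal.ofReal ((4 * ℓ : ℕ) * ((h - 2 * t⁻¹) * (L + D) / Real.pi) +
      (4 * ℓ + 1 : ℕ) * (330 * t ^ 5)) := by
    have hLD : 0 ≤ L + D := by positivity
    have hBint : ∫⁻ g, ∑ k ∈ Finset.range (4 * ℓ + 1), zeroCount (blockPoly ℓ m R n g) (B k)
        ∂(stdGaussian (EuclideanSpace ℝ (CoeffIndex ℓ m R))) ≤
        ∑ k ∈ Finset.range (4 * ℓ + 1), ENNReal.ofReal (330 * t ^ 5) := by
      rw [lintegral_finsetSum _ fun k _ => by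
        rw [hB]; dsimp only; rw [Set.Ioo_inter_Ioo]
        exact measurable_zeroCount_blockPoly _ _]
      exact Finset.sum_le_sum fun k _ => lintegral_zeroCount_bad hn hR ht htn k
    calc I ≤ ∫⁻ g, (∑ k ∈ Finset.range (4 * ℓ), zeroCount (blockPoly ℓ m R n g) (G k) +
            ∑ k ∈ Finset.range (4 * ℓ + 1), zeroCount (blockPoly ℓ m R n g) (B k))
            ∂(stdGaussian _) := by
          refine lintegral_mono fun g => (zeroCount_mono hcover).trans ?_
          exact (zeroCount_union_le _ _ _).trans
            (add_le_add (zeroCount_biUnion_le _ _ _) (zeroCount_biUnion_le _ _ _))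
      _ = ∑ k ∈ Finset.range (4 * ℓ), ∫⁻ g, zeroCount (blockPoly ℓ m R n g) (G k)
            ∂(stdGaussian _) +
          ∫⁻ g, ∑ k ∈ Finset.range (4 * ℓ + 1), zeroCount (blockPoly ℓ m R n g) (B k)
            ∂(stdGaussian _) := by
          rw [lintegral_add_left (Finset.measurable_sum _ fun k _ =>
            measurable_zeroCount_blockPoly _ _),
            lintegral_finsetSum _ fun k _ => measurable_zeroCount_blockPoly _ _]
      _ ≤ ∑ _k ∈ Finset.range (4 * ℓ), ENNReal.ofReal ((h - 2 * t⁻¹) * (L + D) / Real.pi) +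
          ∑ _k ∈ Finset.range (4 * ℓ + 1), ENNReal.ofReal (330 * t ^ 5) :=
          add_le_add (Finset.sum_le_sum fun k _ => (hgood k).2) hBint
      _ = _ := by
          have : 0 ≤ (h - 2 * t⁻¹) * (L + D) / Real.pi :=
            div_nonneg (mul_nonneg (by linarith) hLD) (by linarith)
          rw [ENNReal.ofReal_add (by positivity) (by positivity),
            ENNReal.ofReal_mul (Nat.cast_nonneg (4 * ℓ)),
            ENNReal.ofReal_mul (Nat.cast_nonneg (4 * ℓ + 1))]
          simp only [Finset.sum_const, Finset.card_range, nsmul_eq_mul, ENNReal.ofReal_natCast]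
  have hfin : I ≠ ∞ := ne_top_of_le_ne_top ENNReal.ofReal_ne_top hupp
  refine ⟨hfin, ?_⟩
  have hLD : 0 ≤ L + D := by positivity
  have r1 := (ENNReal.ofReal_le_iff_le_toReal hfin).1 hlow
  have r2 := ENNReal.toReal_le_of_le_ofReal (by
    have : 0 ≤ (h - 2 * t⁻¹) * (L + D) / Real.pi :=
      div_nonneg (mul_nonneg (by linarith) hLD) (by linarith)
    positivity) hupp
  -- the total length of the good intervals over `π`
  have hlen : ∀ y, ((4 * ℓ : ℕ) : ℝ) * ((h - 2 * t⁻¹) * y / Real.pi) =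
      2 * y - 8 * ℓ / Real.pi * (t⁻¹ * y) := by
    intro y
    have : ((4 * ℓ : ℕ) : ℝ) * ((h - 2 * t⁻¹) * y / Real.pi) =
      (((4 * ℓ : ℕ) : ℝ) * h) * y / Real.pi - ((4 * ℓ : ℕ) : ℝ) * 2 * t⁻¹ * y / Real.pi := by ring
    rw [this, h4]; push_cast; field_simp; ring
  rw [hlen] at r1 r2
  have hs1 : 1 ≤ Real.sqrt 3 := by rw [Real.one_le_sqrt]; norm_num
  have hL0 : 0 ≤ L := by positivity
  have hD0 : 0 ≤ D := by positivity
  have hLt : t⁻¹ * L ≤ t ^ 5 := by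
    have : L ≤ n := div_le_self (by positivity) hs1
    calc t⁻¹ * L ≤ t⁻¹ * n := by gcongr
      _ = t ^ 5 := by rw [← htn]; field_simp
  have hDt : D ≤ 1616 * ℓ ^ 3 * t ^ 5 := by
    have : t ^ 2 ≤ t ^ 5 := pow_le_pow_right₀ ht1 (by norm_num)
    rw [hD]; gcongr
  have hcoef : 8 * (ℓ : ℝ) / Real.pi ≤ 3 * ℓ := by
    rw [div_le_iff₀ (by linarith)]; nlinarith
  have hl3 : (ℓ : ℝ) ≤ ℓ ^ 3 := le_self_pow₀ hℓ' (by norm_num)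
  have ht5 : 0 ≤ t ^ 5 := by positivity
  have hlt : ℓ * t ^ 5 ≤ ℓ ^ 3 * t ^ 5 := by gcongr
  have hcoef0 : 0 ≤ 8 * (ℓ : ℝ) / Real.pi := by positivity
  have hloss : 8 * (ℓ : ℝ) / Real.pi * (t⁻¹ * L) ≤ 3 * ℓ * t ^ 5 := by gcongr
  have hloss0 : 0 ≤ 8 * (ℓ : ℝ) / Real.pi * (t⁻¹ * (L + D)) := by positivity
  have hlossD : 0 ≤ 8 * (ℓ : ℝ) / Real.pi * (t⁻¹ * D) := by positivity
  have e1 : 8 * (ℓ : ℝ) / Real.pi * (t⁻¹ * (L - D)) =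
    8 * (ℓ : ℝ) / Real.pi * (t⁻¹ * L) - 8 * (ℓ : ℝ) / Real.pi * (t⁻¹ * D) := by ring
  have e2 : 2 * (n : ℝ) / Real.sqrt 3 = 2 * L := by rw [hL]; ring
  have hbad : ((4 * ℓ + 1 : ℕ) : ℝ) * (330 * t ^ 5) ≤ 1650 * (ℓ * t ^ 5) := by
    push_cast
    nlinarith
  rw [e1] at r1
  rw [e2, abs_le]
  constructor <;> linarith

end Expectation

/-! ### Reduction to a standard Gaussian vector -/

section Reindexing

open scoped RealInnerProductSpace

variable {ℓ m R n : ℕ}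

/-- The index of the coefficient of the cosine polynomial that a `CoeffIndex` stands for, chosen in
the even block of each pair of equal blocks. -/
def coeffIndexToNat (ℓ m R : ℕ) : CoeffIndex ℓ m R → ℕ
  | Sum.inl p => 2 * ℓ * p.1 + p.2
  | Sum.inr s => 2 * ℓ * m + s

lemma coeffIndexToNat_mem (hn : n + 1 = 2 * ℓ * m + R) (i : CoeffIndex ℓ m R) :
    coeffIndexToNat ℓ m R i ∈ freeIndices ℓ m n := by
  unfold freeIndices remainingIndices blockIndices
  rcases i with ⟨a, k⟩ | s
  · refine Finset.mem_union_left _ (Finset.mem_biUnion.2 ⟨a, Finset.mem_range.2 a.2, ?_⟩)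
    have hk := k.2
    have e : ℓ * (2 * (a : ℕ)) = 2 * ℓ * a := by ring
    simp only [coeffIndexToNat, Finset.mem_Ico, e]
    omega
  · refine Finset.mem_union_right _ (Finset.mem_sdiff.2 ⟨?_, ?_⟩)
    · have hs := s.2
      simp only [coeffIndexToNat, Finset.mem_range]
      omega
    · simp only [Finset.mem_biUnion, Finset.mem_range, Finset.mem_Ico, not_exists, not_and]
      intro i hi _
      simp only [coeffIndexToNat, not_lt]
      calc ℓ * i + ℓ = ℓ * (i + 1) := by ring
        _ ≤ ℓ * (2 * m) := Nat.mul_le_mul_left _ hi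
        _ = 2 * ℓ * m := by ring
        _ ≤ 2 * ℓ * m + s := Nat.le_add_right _ _

lemma coeffIndexToNat_injective (ℓ m R : ℕ) : Function.Injective (coeffIndexToNat ℓ m R) := by
  rintro (⟨a, k⟩ | s) (⟨b, q⟩ | s') h <;> simp only [coeffIndexToNat] at h
  · have hk := k.2
    have hq := q.2
    have h1 : (a : ℕ) = b := by
      have := congrArg (· / (2 * ℓ)) h
      simp only [Nat.mul_add_div (show 2 * ℓ > 0 by omega),
        Nat.div_eq_of_lt (show (k : ℕ) < 2 * ℓ by omega),
        Nat.div_eq_of_lt (show (q : ℕ) < 2 * ℓ by omega), add_zero] at this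
      exact this
    have h2 : (k : ℕ) = q := by rw [h1] at h; omega
    rw [Fin.ext h1, Fin.ext h2]
  · have := two_mul_mul_add_lt (ℓ := ℓ) a.2 (show (k : ℕ) < 2 * ℓ by have := k.2; omega)
    omega
  · have := two_mul_mul_add_lt (ℓ := ℓ) b.2 (show (q : ℕ) < 2 * ℓ by have := q.2; omega)
    omega
  · rw [Fin.ext (show (s : ℕ) = s' by omega)]

variable {Ω : Type*} [MeasurableSpace Ω] {P : Measure Ω} {σ : ℝ≥0}
  {a : ℕ → Ω → ℝ}

/-- The vector of normalized independent coefficients. -/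
noncomputable def normalizedCoeffs (ℓ m R : ℕ) (σ : ℝ≥0) (a : ℕ → Ω → ℝ) (ω : Ω) :
    EuclideanSpace ℝ (CoeffIndex ℓ m R) :=
  WithLp.toLp 2 (fun i => a (coeffIndexToNat ℓ m R i) ω / σ)

lemma hasLaw_normalizedCoeffs (hn : n + 1 = 2 * ℓ * m + R) (hσ : 0 < σ)
    (hlaw : ∀ i ∈ freeIndices ℓ m n, HasLaw (a i) (gaussianReal 0 (σ ^ 2)) P)
    (hind : iIndepFun (fun (i : freeIndices ℓ m n) => a i) P) :
    HasLaw (normalizedCoeffs ℓ m R σ a) (stdGaussian _) P := by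
  have hlaw1 : ∀ i : CoeffIndex ℓ m R,
      HasLaw (fun ω => a (coeffIndexToNat ℓ m R i) ω / σ) (gaussianReal 0 1) P := by
    intro i
    have := gaussianReal_div_const (hlaw _ (coeffIndexToNat_mem hn i)) (σ : ℝ)
    convert this using 2
    · simp
    · ext
      have : (σ : ℝ) ≠ 0 := by exact_mod_cast hσ.ne'
      simp [this]
  have hind1 : iIndepFun (fun (i : CoeffIndex ℓ m R) ω => a (coeffIndexToNat ℓ m R i) ω / σ) P := by
    have h1 := hind.precomp (g := fun i : CoeffIndex ℓ m R =>
      (⟨coeffIndexToNat ℓ m R i, coeffIndexToNat_mem hn i⟩ : freeIndices ℓ m n))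
      (fun i j h => coeffIndexToNat_injective ℓ m R (congrArg Subtype.val h))
    exact h1.comp (fun _ y => y / (σ : ℝ)) (fun _ => by fun_prop)
  have hpi := hind1.hasLaw_pi hlaw1
  rw [← map_pi_eq_stdGaussian]
  have hcomp : HasLaw (WithLp.toLp 2 : (CoeffIndex ℓ m R → ℝ) → EuclideanSpace ℝ _)
      ((Measure.pi fun _ => gaussianReal 0 1).map (WithLp.toLp 2))
      (Measure.pi fun _ : CoeffIndex ℓ m R => gaussianReal 0 1) :=
    ⟨by fun_prop, rfl⟩
  exact hcomp.comp hpi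

lemma zeroCount_cosPoly_ae_eq (hn : n + 1 = 2 * ℓ * m + R) (hσ : 0 < σ)
    (hpair : ∀ j < m, ∀ k < ℓ, a (2 * ℓ * j + k) =ᵐ[P] a (2 * ℓ * j + ℓ + k)) (s : Set ℝ) :
    (fun ω => zeroCount (cosPoly n (fun j => a j ω)) s) =ᵐ[P]
      fun ω => zeroCount (blockPoly ℓ m R n (normalizedCoeffs ℓ m R σ a ω)) s := by
  have hσ' : (σ : ℝ) ≠ 0 := by exact_mod_cast hσ.ne'
  have hall : ∀ᵐ ω ∂P, ∀ (j : Fin m) (k : Fin ℓ),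
      a (2 * ℓ * j + k) ω = a (2 * ℓ * j + ℓ + k) ω :=
    ae_all_iff.2 fun j => ae_all_iff.2 fun k => hpair j j.2 k k.2
  filter_upwards [hall] with ω hω
  refine zeroCount_congr fun x _ => ?_
  have heq : cosPoly n (fun j => a j ω) x =
      σ * blockPoly ℓ m R n (normalizedCoeffs ℓ m R σ a ω) x := by
    unfold blockPoly cosPoly
    rw [hn, sum_range_blocks, sum_range_blocks, mul_add]
    congr 1
    · rw [Finset.sum_range, Finset.sum_range, Finset.mul_sum]
      refine Finset.sum_congr rfl fun j _ => ?_
      rw [Finset.sum_range, Finset.sum_range, Finset.mul_sum]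
      refine Finset.sum_congr rfl fun k _ => ?_
      dsimp only
      rw [inner_coeffVector_even, inner_coeffVector_odd, ← hω j k]
      change _ = σ * (a (2 * ℓ * j + k) ω / σ * _ + a (2 * ℓ * j + k) ω / σ * _)
      field_simp
    · rw [Finset.sum_range, Finset.sum_range, Finset.mul_sum]
      refine Finset.sum_congr rfl fun s _ => ?_
      dsimp only
      rw [inner_coeffVector_rem]
      change _ = σ * (a (2 * ℓ * m + s) ω / σ * _)
      field_simp
  rw [heq]
  simp [hσ']

end Reindexing

theorem theorem2p1 (ℓ : ℕ) (hℓ : 1 ≤ ℓ) :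
    ∃ (C : ℝ) (N₀ : ℕ),
      ∀ (n m : ℕ) (r : ℤ), N₀ ≤ n → 1 ≤ m → -1 ≤ r → r ≤ 2 * (ℓ : ℤ) - 2 →
        (n : ℤ) = 2 * (ℓ : ℤ) * (m : ℤ) + r →
      ∀ (Ω : Type*) (_ : MeasurableSpace Ω) (P : Measure Ω) (_ : IsProbabilityMeasure P)
        (σ : ℝ≥0) (_ : 0 < σ) (a : ℕ → Ω → ℝ),
        -- the coefficients of the even blocks and the remaining ones are i.i.d. `N(0, σ²)`
        (∀ i ∈ freeIndices ℓ m n, HasLaw (a i) (gaussianReal 0 (σ ^ 2)) P) →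
        iIndepFun (fun (i : freeIndices ℓ m n) => a i) P →
        -- consecutive blocks are pairwise equal: `A_{2j} = A_{2j+1}`
        (∀ j < m, ∀ k < ℓ, a (2 * ℓ * j + k) =ᵐ[P] a (2 * ℓ * j + ℓ + k)) →
        -- the number of zeros is a random variable with a finite expectation, and
        AEMeasurable
          (fun ω => zeroCount (cosPoly n (fun j => a j ω)) (Set.Ioo 0 (2 * Real.pi))) P ∧
        ∫⁻ ω, zeroCount (cosPoly n (fun j => a j ω)) (Set.Ioo 0 (2 * Real.pi)) ∂P ≠ ∞ ∧
        |(∫⁻ ω, zeroCount (cosPoly n (fun j => a j ω)) (Set.Ioo 0 (2 * Real.pi)) ∂P).toReal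
            - 2 * (n : ℝ) / Real.sqrt 3| ≤ C * (n : ℝ) ^ (5 / 6 : ℝ) := by
  refine ⟨5000 * ℓ ^ 3, (80 * ℓ) ^ 6, ?_⟩
  intro n m r hN hm hr1 hr2 hnm Ω _ P _ σ hσ a hlaw hind hpair
  obtain ⟨R, hR⟩ : ∃ R : ℕ, (R : ℤ) = r + 1 := ⟨(r + 1).toNat, by omega⟩
  have hn : n + 1 = 2 * ℓ * m + R := by zify; linarith
  have hR2 : R < 2 * ℓ := by omega
  set t : ℝ := (n : ℝ) ^ (1 / 6 : ℝ) with ht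
  have ht6 : t ^ 6 = n := by
    rw [ht, ← Real.rpow_natCast, ← Real.rpow_mul (by positivity)]
    norm_num
  have ht5 : t ^ 5 = (n : ℝ) ^ (5 / 6 : ℝ) := by
    rw [ht, ← Real.rpow_natCast, ← Real.rpow_mul (by positivity)]
    norm_num
  have ht0 : 0 ≤ t := by positivity
  have ht80 : 80 * (ℓ : ℝ) ≤ t := by
    refine le_of_pow_le_pow_left₀ (n := 6) (by norm_num) ht0 ?_
    rw [ht6]
    exact_mod_cast hN
  have hae := zeroCount_cosPoly_ae_eq (R := R) hn hσ hpair (Set.Ioo 0 (2 * Real.pi))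
  have hX := hasLaw_normalizedCoeffs hn hσ hlaw hind
  have hmeas := measurable_zeroCount_blockPoly (ℓ := ℓ) (m := m) (R := R) (n := n)
    0 (2 * Real.pi)
  have hint : ∫⁻ ω, zeroCount (cosPoly n (fun j => a j ω)) (Set.Ioo 0 (2 * Real.pi)) ∂P =
      ∫⁻ g, zeroCount (blockPoly ℓ m R n g) (Set.Ioo 0 (2 * Real.pi)) ∂(stdGaussian _) := by
    rw [lintegral_congr_ae hae]
    exact hX.lintegral_comp hmeas.aemeasurable
  refine ⟨(hmeas.comp_aemeasurable hX.aemeasurable).congr hae.symm, ?_⟩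
  rw [hint, ← ht5]
  exact lintegral_zeroCount_blockPoly hm hn hR2 ht80 ht6
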